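/- Let $(\Gamma,d)$ be a finite metric space, let $F:[0,\infty)\to(0,\infty)$ be non-increasing, and for each $x\in\Gamma$ let $\mathcal H_x$ be a complex Hilbert space and $H_x$ a (possibly unbounded) self-adjoint operator on $\mathcal H_x$ with domain $D(H_x)$. For $X\subseteq\Gamma$ let $\mathcal H_X=\bigotimes_{x\in X}\mathcal H_x$ be the Hilbert space tensor product and let $\mathcal A_X=\bigotimes_{x\in X}\mathcal B(\mathcal H_x)=\mathcal B(\mathcal H_X)$ be the von Neumann tensor product. For $X\subseteq\Lambda$ identify $A\in\mathcal A_X$ with $A\otimes 1\in\mathcal A_\Lambda$. Let $\Phi$ be an interaction: for each $X\subseteq\Gamma$ an operator $\Phi(X)=\Phi(X)^*\in\mathcal A_X$. Put $$C_{x,y}=\inf\Big\{c\in\mathbb R:\sum_{z\in\Gamma}F(d(x,z))F(d(z,y))\le c\,F(d(x,y))\Big\},\qquad C=\max_{x,y\in\Gamma}C_{x,y},$$ $$\|\Phi\|=\max_{x,y\in\Gamma}\ \sum_{X\subseteq\Gamma:\ x,y\in X}\frac{\|\Phi(X)\|}{F(d(x,y))}.$$ For $X\subseteq\Gamma$ let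 the $\Phi$-boundary $\partial_\Phi X$ be the set of all $x\in X$ for which there is $Z\subseteq\Gamma$ with $x\in Z$, $Z\cap X\ne\emptyset$, $Z\cap(\Gamma\setminus X)\neq\emptyset$ and $\Phi(Z)\ne0$, and put $$D(X,Y)=\min\Big[\sum_{x\in\partial_\Phi X}\sum_{y\in Y}F(d(x,y)),\ \sum_{x\in X}\sum_{y\in\partial_\Phi Y}F(d(x,y))\Big].$$ Let $X,Y\subseteq\Gamma$ with $d(X,Y)=\min_{x\in X,y\in Y}d(x,y)>0$ (where $d(X,Y)=\infty$ if $X$ or $Y$ is empty), and let $\Lambda\subseteq\Gamma$ be any set with $X\cup Y\subseteq\Lambda$. Then the closure $H_\Lambda$ of the operator $\sum_{x\in\Lambda}H_x+\sum_{Z\subseteq\Lambda}\Phi(Z)$, defined on the algebraic tensor product of the domains $D(H_x)$, $x\in\Lambda$, is a self-adjoint operator on $\mathcal H_\Lambda$, hence generates the strongly continuous unitary group $e^{itH_\Lambda}$; and with $\tau_t^\Lambda(A)=e^{itH_\Lambda}Ae^{-itH_\Lambda}$, for all $A\in\mathcal A_X$, $B\in\mathcal A_Y$ and $t\in\mathbb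 R$, $$\big\|[\tau_t^\Lambda(A),B]\big\|\le\frac{2\|A\|\|B\|}{C}\left(e^{2C\|\Phi\||t|}-1\right)D(X,Y).$$ (If $\Gamma$ is empty, both sides are read as $0$.) -/

import Mathlib

set_option linter.unusedSectionVars false

open scoped TensorProduct ComplexOrder InnerProductSpace

noncomputable section

namespace LR

variable {ι : Type*} [Fintype ι] (E : ι → Type*) [∀ i, NormedAddCommGroup (E i)]
  [∀ i, InnerProductSpace ℂ (E i)]

/-- The algebraic tensor product `⨂ᵢ Eᵢ`, to be equipped with the inner product determined by
`⟪⊗ aᵢ, ⊗ bᵢ⟫ = ∏ ⟪aᵢ, bᵢ⟫` (and not with the projective seminorm). -/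
def AlgTensor : Type _ := PiTensorProduct ℂ E

instance : AddCommGroup (AlgTensor E) := inferInstanceAs (AddCommGroup (PiTensorProduct ℂ E))

instance : Module ℂ (AlgTensor E) := inferInstanceAs (Module ℂ (PiTensorProduct ℂ E))

namespace AlgTensor

/-- The pure tensor `⊗ aᵢ`. -/
def tprod : MultilinearMap ℂ E (AlgTensor E) := PiTensorProduct.tprod ℂ

/-- Universal property of the algebraic tensor product. -/
def lift {V : Type*} [AddCommGroup V] [Module ℂ V] :
    MultilinearMap ℂ E V ≃ₗ[ℂ] (AlgTensor E →ₗ[ℂ] V) := PiTensorProduct.lift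

variable {E}

lemma lift_tprod {V : Type*} [AddCommGroup V] [Module ℂ V] (f : MultilinearMap ℂ E V)
    (a : ∀ i, E i) : lift E f (tprod E a) = f a := PiTensorProduct.lift.tprod a

lemma span_tprod : Submodule.span ℂ (Set.range (tprod E)) = ⊤ := PiTensorProduct.span_tprod_eq_top

lemma mem_span_tprod (x : AlgTensor E) : x ∈ Submodule.span ℂ (Set.range (tprod E)) := by
  rw [span_tprod]; exact Submodule.mem_top

lemma hom_ext {V : Type*} [AddCommGroup V] [Module ℂ V] {f g : AlgTensor E →ₗ[ℂ] V}
    (h : ∀ a, f (tprod E a) = g (tprod E a)) : f = g :=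
  PiTensorProduct.ext (MultilinearMap.ext h)

/-- The linear functional `⊗ bᵢ ↦ ∏ ⟪aᵢ, bᵢ⟫`. -/
def bra (a : ∀ i, E i) : AlgTensor E →ₗ[ℂ] ℂ :=
  lift E ((MultilinearMap.mkPiAlgebra ℂ ι ℂ).compLinearMap fun i => innerₛₗ ℂ (a i))

lemma bra_tprod (a b : ∀ i, E i) : bra a (tprod E b) = ∏ i, ⟪a i, b i⟫_ℂ := by
  simp [bra, lift_tprod]

/-- For fixed `y`, the map `a ↦ conj (bra a y)`, which is multilinear in `a`. -/
def conjBra (y : AlgTensor E) : MultilinearMap ℂ E ℂ where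
  toFun a := starRingEnd ℂ (bra a y)
  map_update_add' {_} a i u v := by
    have : bra (Function.update a i (u + v))
        = bra (Function.update a i u) + bra (Function.update a i v) := by
      refine hom_ext fun b => ?_
      simp only [bra_tprod, LinearMap.add_apply]
      rw [← Finset.mul_prod_erase _ _ (Finset.mem_univ i),
        ← Finset.mul_prod_erase _ _ (Finset.mem_univ i),
        ← Finset.mul_prod_erase _ _ (Finset.mem_univ i)]
      have key : ∀ w : E i, ∏ x ∈ Finset.univ.erase i, ⟪Function.update a i w x, b x⟫_ℂ
          = ∏ x ∈ Finset.univ.erase i, ⟪a x, b x⟫_ℂ := fun w =>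
        Finset.prod_congr rfl fun x hx => by
          rw [Function.update_of_ne (Finset.ne_of_mem_erase hx)]
      simp only [key, Function.update_self, inner_add_left, add_mul]
    rw [this, LinearMap.add_apply, map_add]
  map_update_smul' {_} a i c u := by
    have : bra (Function.update a i (c • u))
        = starRingEnd ℂ c • bra (Function.update a i u) := by
      refine hom_ext fun b => ?_
      simp only [bra_tprod, LinearMap.smul_apply]
      rw [← Finset.mul_prod_erase _ _ (Finset.mem_univ i),
        ← Finset.mul_prod_erase _ _ (Finset.mem_univ i)]
      have key : ∀ w : E i, ∏ x ∈ Finset.univ.erase i, ⟪Function.update a i w x, b x⟫_ℂ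
          = ∏ x ∈ Finset.univ.erase i, ⟪a x, b x⟫_ℂ := fun w =>
        Finset.prod_congr rfl fun x hx => by
          rw [Function.update_of_ne (Finset.ne_of_mem_erase hx)]
      simp only [key, Function.update_self, inner_smul_left, smul_eq_mul, mul_assoc]
    rw [this, LinearMap.smul_apply, smul_eq_mul, map_mul, Complex.conj_conj, smul_eq_mul]

/-- The inner product on the algebraic tensor product (conjugate-linear in the first argument). -/
def form (x y : AlgTensor E) : ℂ := starRingEnd ℂ (lift E (conjBra y) x)

lemma form_tprod_left (a : ∀ i, E i) (y : AlgTensor E) : form (tprod E a) y = bra a y := by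
  simp [form, lift_tprod, conjBra]

lemma form_add_left (x y z : AlgTensor E) : form (x + y) z = form x z + form y z := by
  simp [form]

lemma form_smul_left (c : ℂ) (x y : AlgTensor E) :
    form (c • x) y = starRingEnd ℂ c * form x y := by
  simp [form]

lemma form_add_right (x y z : AlgTensor E) : form x (y + z) = form x y + form x z := by
  have hx := mem_span_tprod x
  induction hx using Submodule.span_induction with
  | mem x h => obtain ⟨a, rfl⟩ := h; simp [form_tprod_left]
  | zero => simp [form]
  | add u v _ _ hu hv => simp only [form_add_left, hu, hv]; ring
  | smul c u _ hu => simp only [form_smul_left, hu]; ring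

lemma form_smul_right (c : ℂ) (x y : AlgTensor E) : form x (c • y) = c * form x y := by
  have hx := mem_span_tprod x
  induction hx using Submodule.span_induction with
  | mem x h => obtain ⟨a, rfl⟩ := h; simp [form_tprod_left]
  | zero => simp [form]
  | add u v _ _ hu hv => simp only [form_add_left, hu, hv]; ring
  | smul d u _ hu => simp only [form_smul_left, hu]; ring

lemma form_conj (x y : AlgTensor E) : starRingEnd ℂ (form y x) = form x y := by
  have hx := mem_span_tprod x
  have hy := mem_span_tprod y
  induction hx using Submodule.span_induction with
  | zero =>
    have h0 : form y (0 : AlgTensor E) = 0 := by simpa using form_smul_right 0 y 0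
    rw [h0]; simp [form]
  | add u v _ _ hu hv => simp only [form_add_left, form_add_right, map_add, hu, hv]
  | smul c u _ hu => simp only [form_smul_left, form_smul_right, map_mul, hu]
  | mem x h =>
    obtain ⟨a, rfl⟩ := h
    induction hy using Submodule.span_induction with
    | zero => simp [form_tprod_left]; simp [form]
    | add u v _ _ hu hv => simp only [form_add_left, form_add_right, map_add, hu, hv]
    | smul c u _ hu => simp only [form_smul_left, form_smul_right, map_mul, hu, Complex.conj_conj]
    | mem y h =>
      obtain ⟨b, rfl⟩ := h
      simp only [form_tprod_left, bra_tprod, map_prod, inner_conj_symm]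

/-- Gram matrices of pure tensors are positive semidefinite (Schur product theorem). -/
lemma posSemidef_gram {n : Type*} [Finite n] (v : n → ∀ i, E i) :
    (Matrix.of fun k l => ∏ i, ⟪v k i, v l i⟫_ℂ).PosSemidef := by
  classical
  suffices h : ∀ s : Finset ι,
      (Matrix.of fun k l => ∏ i ∈ s, ⟪v k i, v l i⟫_ℂ).PosSemidef from h _
  intro s
  induction s using Finset.induction_on with
  | empty =>
    have h1 := Matrix.posSemidef_gram (𝕜 := ℂ) (fun _ : n => (1 : ℂ))
    have h2 : (Matrix.of fun k l => ∏ i ∈ (∅ : Finset ι), ⟪v k i, v l i⟫_ℂ)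
        = Matrix.gram ℂ (fun _ : n => (1 : ℂ)) := by
      ext k l; simp [Matrix.gram]
    rw [h2]; exact h1
  | insert i s hi ih =>
    have h1 := (Matrix.posSemidef_gram (𝕜 := ℂ) (fun k => v k i)).hadamard ih
    have h2 : (Matrix.of fun k l => ∏ i ∈ insert i s, ⟪v k i, v l i⟫_ℂ)
        = Matrix.hadamard (Matrix.gram ℂ fun k => v k i)
          (Matrix.of fun k l => ∏ i ∈ s, ⟪v k i, v l i⟫_ℂ) := by
      ext k l; simp [Matrix.gram, Matrix.hadamard, Finset.prod_insert hi]
    rw [h2]; exact h1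

lemma form_self_nonneg (x : AlgTensor E) : 0 ≤ (form x x).re := by
  obtain ⟨n, c, g, rfl⟩ := Submodule.mem_span_set'.1 (mem_span_tprod x)
  choose v hv using fun k => (g k).2
  have h := (posSemidef_gram v).dotProduct_mulVec_nonneg c
  let L : AlgTensor E → (AlgTensor E →+ ℂ) := fun y =>
    AddMonoidHom.mk' (fun x => form x y) fun u v => form_add_left u v y
  let R : AlgTensor E → (AlgTensor E →+ ℂ) := fun x =>
    AddMonoidHom.mk' (fun y => form x y) fun u v => form_add_right x u v
  have hL : ∀ x y, form x y = L y x := fun _ _ => rfl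
  have hR : ∀ x y, form x y = R x y := fun _ _ => rfl
  have e : form (∑ k, c k • (g k : AlgTensor E)) (∑ k, c k • (g k : AlgTensor E))
      = star c ⬝ᵥ (Matrix.of fun k l => ∏ i, ⟪v k i, v l i⟫_ℂ).mulVec c := by
    simp only [← hv]
    rw [hL, map_sum, dotProduct]
    refine Finset.sum_congr rfl fun k _ => ?_
    rw [← hL, hR, map_sum, Matrix.mulVec, dotProduct, Finset.mul_sum]
    refine Finset.sum_congr rfl fun l _ => ?_
    rw [← hR, form_smul_left, form_smul_right, form_tprod_left, bra_tprod]
    simp only [Matrix.of_apply, Pi.star_apply, starRingEnd_apply]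
    ring
  rw [e]
  exact (Complex.le_def.1 h).1

instance : PreInnerProductSpace.Core ℂ (AlgTensor E) where
  inner := form
  conj_inner_symm := form_conj
  re_inner_nonneg := form_self_nonneg
  add_left := form_add_left
  smul_left x y c := form_smul_left c x y

instance : SeminormedAddCommGroup (AlgTensor E) :=
  InnerProductSpace.Core.toSeminormedAddCommGroup (𝕜 := ℂ)

instance : InnerProductSpace ℂ (AlgTensor E) := InnerProductSpace.ofCore _

lemma inner_tprod (a b : ∀ i, E i) : ⟪tprod E a, tprod E b⟫_ℂ = ∏ i, ⟪a i, b i⟫_ℂ :=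
  (form_tprod_left a _).trans (bra_tprod a b)

end AlgTensor

/-- The Hilbert space tensor product `⨂ᵢ Eᵢ`: the completion of the algebraic one. -/
abbrev HilbertTensor : Type _ := UniformSpace.Completion (AlgTensor E)

namespace HilbertTensor

/-- The pure tensor `⊗ aᵢ` in the Hilbert space tensor product. -/
def tprod (a : ∀ i, E i) : HilbertTensor E := ((AlgTensor.tprod E a : AlgTensor E) : HilbertTensor E)

variable {E}

lemma inner_tprod (a b : ∀ i, E i) : ⟪tprod E a, tprod E b⟫_ℂ = ∏ i, ⟪a i, b i⟫_ℂ := by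
  rw [tprod, tprod, UniformSpace.Completion.inner_coe, AlgTensor.inner_tprod]

lemma dense_span_tprod :
    Dense (Submodule.span ℂ (Set.range (tprod E)) : Set (HilbertTensor E)) := by
  have h : (Submodule.span ℂ (Set.range (tprod E)) : Set (HilbertTensor E))
      = Set.range ((↑) : AlgTensor E → HilbertTensor E) := by
    have e : Set.range (tprod E)
        = (UniformSpace.Completion.toComplL (𝕜 := ℂ) (E := AlgTensor E)).toLinearMap ''
          Set.range (AlgTensor.tprod E) := by
      rw [← Set.range_comp]; rfl
    rw [e, Submodule.span_image, AlgTensor.span_tprod, Submodule.map_top]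
    rfl
  rw [h]
  exact UniformSpace.Completion.denseRange_coe

end HilbertTensor


/-! ### Local observables and their identification with observables on larger sets -/

variable {Γ : Type*} (H : Γ → Type*) [∀ x, NormedAddCommGroup (H x)]
  [∀ x, InnerProductSpace ℂ (H x)]

/-- The Hilbert space `⨂_{x ∈ X} H x` of the subsystem `X`. -/
abbrev LocalSpace (X : Finset Γ) : Type _ := HilbertTensor fun x : X => H x

/-- The algebra of observables over `X`: all bounded operators on `⨂_{x ∈ X} H x`, that is, the
von Neumann tensor product `⨂_{x ∈ X} B(H x)`. -/
abbrev LocalAlgebra (X : Finset Γ) : Type _ := LocalSpace H X →L[ℂ] LocalSpace H X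

variable {H} [DecidableEq Γ]

/-- Combine vectors at the sites of `X` and at the sites of `Λ \ X` to vectors at the sites
of `Λ`. -/
def glue {X Λ : Finset Γ} (a : ∀ x : X, H x) (b : ∀ x : (Λ \ X : Finset Γ), H x) :
    ∀ x : Λ, H x := fun x =>
  if hx : (x : Γ) ∈ X then a ⟨x, hx⟩ else b ⟨x, Finset.mem_sdiff.2 ⟨x.2, hx⟩⟩

/-- Formal linear combinations of pairs `(a, b)`, sent to `∑ c • (⊗ a) ⊗ (⊗ b)`. -/
def splitTensor (X Λ : Finset Γ) :
    (((∀ x : X, H x) × (∀ x : (Λ \ X : Finset Γ), H x)) →₀ ℂ) →ₗ[ℂ]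
      LocalSpace H X ⊗[ℂ] LocalSpace H (Λ \ X) :=
  Finsupp.linearCombination ℂ fun p =>
    HilbertTensor.tprod (fun x : X => H x) p.1 ⊗ₜ[ℂ]
      HilbertTensor.tprod (fun x : (Λ \ X : Finset Γ) => H x) p.2

/-- Formal linear combinations of pairs `(a, b)`, sent to `∑ c • ⊗ (glue a b)`. -/
def glueTensor (X Λ : Finset Γ) :
    (((∀ x : X, H x) × (∀ x : (Λ \ X : Finset Γ), H x)) →₀ ℂ) →ₗ[ℂ] LocalSpace H Λ :=
  Finsupp.linearCombination ℂ fun p => HilbertTensor.tprod (fun x : Λ => H x) (glue p.1 p.2)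

lemma inner_glue {X Λ : Finset Γ} (h : X ⊆ Λ) (a a' : ∀ x : X, H x)
    (b b' : ∀ x : (Λ \ X : Finset Γ), H x) :
    ∏ x : Λ, ⟪glue a b x, glue a' b' x⟫_ℂ
      = (∏ x : X, ⟪a x, a' x⟫_ℂ) * ∏ x : (Λ \ X : Finset Γ), ⟪b x, b' x⟫_ℂ := by
  let f : Γ → ℂ := fun x =>
    if hx : x ∈ X then ⟪a ⟨x, hx⟩, a' ⟨x, hx⟩⟫_ℂ
    else if hx' : x ∈ Λ \ X then ⟪b ⟨x, hx'⟩, b' ⟨x, hx'⟩⟫_ℂ else 1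
  have h1 : ∏ x : X, ⟪a x, a' x⟫_ℂ = ∏ x ∈ X, f x := by
    rw [← Finset.prod_coe_sort X f]
    exact Finset.prod_congr rfl fun x _ => by simp [f]
  have h2 : ∏ x : (Λ \ X : Finset Γ), ⟪b x, b' x⟫_ℂ = ∏ x ∈ Λ \ X, f x := by
    rw [← Finset.prod_coe_sort (Λ \ X) f]
    refine Finset.prod_congr rfl fun x _ => ?_
    have hx := Finset.mem_sdiff.1 x.2
    simp [f, hx.1, hx.2]
  have h3 : ∏ x : Λ, ⟪glue a b x, glue a' b' x⟫_ℂ = ∏ x ∈ Λ, f x := by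
    rw [← Finset.prod_coe_sort Λ f]
    refine Finset.prod_congr rfl fun x _ => ?_
    by_cases hx : (x : Γ) ∈ X <;> simp [f, glue, hx]
  rw [h1, h2, h3, mul_comm, Finset.prod_sdiff h]

lemma norm_glueTensor {X Λ : Finset Γ} (h : X ⊆ Λ)
    (c : ((∀ x : X, H x) × (∀ x : (Λ \ X : Finset Γ), H x)) →₀ ℂ) :
    ‖glueTensor X Λ c‖ = ‖splitTensor X Λ c‖ := by
  have e : ⟪glueTensor X Λ c, glueTensor X Λ c⟫_ℂ = ⟪splitTensor X Λ c, splitTensor X Λ c⟫_ℂ := by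
    simp only [glueTensor, splitTensor, Finsupp.linearCombination_apply, Finsupp.sum, sum_inner,
      inner_sum, inner_smul_left, inner_smul_right, HilbertTensor.inner_tprod, inner_glue h,
      TensorProduct.inner_tmul]
  rw [@norm_eq_sqrt_re_inner ℂ, @norm_eq_sqrt_re_inner ℂ _ _ _ _ (splitTensor X Λ c), e]

lemma denseRange_glueTensor {X Λ : Finset Γ} (h : X ⊆ Λ) :
    DenseRange (glueTensor (H := H) X Λ) := by
  have e : Set.range (fun p : (∀ x : X, H x) × (∀ x : (Λ \ X : Finset Γ), H x) =>
      HilbertTensor.tprod (fun x : Λ => H x) (glue p.1 p.2))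
      = Set.range (HilbertTensor.tprod fun x : Λ => H x) := by
    refine Set.Subset.antisymm (by rintro _ ⟨p, rfl⟩; exact ⟨_, rfl⟩) ?_
    rintro _ ⟨a, rfl⟩
    refine ⟨(fun x => a ⟨x, h x.2⟩, fun x => a ⟨x, (Finset.mem_sdiff.1 x.2).1⟩), ?_⟩
    refine congrArg (HilbertTensor.tprod fun x : Λ => H x) (funext fun x => ?_)
    by_cases hx : (x : Γ) ∈ X <;> simp [glue, hx]
  have := HilbertTensor.dense_span_tprod (E := fun x : Λ => H x)
  rw [← e, ← Finsupp.range_linearCombination] at this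
  exact this

lemma denseRange_splitTensor (X Λ : Finset Γ) :
    DenseRange (splitTensor (H := H) X Λ) := by
  have hD : ∀ (ξ : LocalSpace H X) (η : LocalSpace H (Λ \ X)),
      ξ ⊗ₜ[ℂ] η ∈ (LinearMap.range (splitTensor (H := H) X Λ)).topologicalClosure := by
    intro ξ η
    have hξ := (HilbertTensor.dense_span_tprod (E := fun x : X => H x)) ξ
    have hη := (HilbertTensor.dense_span_tprod
      (E := fun x : (Λ \ X : Finset Γ) => H x)) η
    refine map_mem_closure₂ (f := fun ξ η => ξ ⊗ₜ[ℂ] η) TensorProduct.continuous_tmul hξ hη ?_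
    intro u hu v hv
    change u ⊗ₜ[ℂ] v ∈ LinearMap.range (splitTensor (H := H) X Λ)
    rw [splitTensor, Finsupp.range_linearCombination]
    induction hu using Submodule.span_induction with
    | zero => simp
    | add _ _ _ _ h1 h2 => rw [TensorProduct.add_tmul]; exact add_mem h1 h2
    | smul c _ _ h1 => rw [← TensorProduct.smul_tmul']; exact Submodule.smul_mem _ c h1
    | mem u hu =>
      obtain ⟨a, rfl⟩ := hu
      induction hv using Submodule.span_induction with
      | zero => simp
      | add _ _ _ _ h1 h2 => rw [TensorProduct.tmul_add]; exact add_mem h1 h2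
      | smul c _ _ h1 => rw [TensorProduct.tmul_smul]; exact Submodule.smul_mem _ c h1
      | mem v hv =>
        obtain ⟨b, rfl⟩ := hv
        exact Submodule.subset_span ⟨(a, b), rfl⟩
  have htop : (LinearMap.range (splitTensor (H := H) X Λ)).topologicalClosure = ⊤ := by
    rw [eq_top_iff, ← TensorProduct.span_tmul_eq_top, Submodule.span_le]
    rintro _ ⟨ξ, η, rfl⟩
    exact hD ξ η
  intro z
  have : z ∈ (LinearMap.range (splitTensor (H := H) X Λ)).topologicalClosure := by
    rw [htop]; exact Submodule.mem_top
  exact this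

/-- The canonical isometry `(⨂_{x ∈ X} H x) ⊗ (⨂_{x ∈ Λ \ X} H x) → ⨂_{x ∈ Λ} H x`. -/
def join (X Λ : Finset Γ) :
    LocalSpace H X ⊗[ℂ] LocalSpace H (Λ \ X) →L[ℂ] LocalSpace H Λ :=
  (glueTensor X Λ).extendOfNorm (splitTensor X Λ)

lemma join_tmul {X Λ : Finset Γ} (h : X ⊆ Λ) (a : ∀ x : X, H x)
    (b : ∀ x : (Λ \ X : Finset Γ), H x) :
    join X Λ (HilbertTensor.tprod _ a ⊗ₜ[ℂ] HilbertTensor.tprod _ b)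
      = HilbertTensor.tprod _ (glue a b) := by
  have := LinearMap.extendOfNorm_eq (denseRange_splitTensor (H := H) X Λ)
    ⟨1, fun c => by rw [norm_glueTensor h, one_mul]⟩ (Finsupp.single (a, b) 1)
  simpa [join, splitTensor, glueTensor] using this

lemma norm_join {X Λ : Finset Γ} (h : X ⊆ Λ)
    (z : LocalSpace H X ⊗[ℂ] LocalSpace H (Λ \ X)) : ‖join X Λ z‖ = ‖z‖ := by
  refine (denseRange_splitTensor (H := H) X Λ).induction_on z
    (isClosed_eq (by fun_prop) (by fun_prop)) fun c => ?_
  rw [join, LinearMap.extendOfNorm_eq (denseRange_splitTensor (H := H) X Λ)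
    ⟨1, fun c => by rw [norm_glueTensor h, one_mul]⟩, norm_glueTensor h]

lemma denseRange_join {X Λ : Finset Γ} (h : X ⊆ Λ) : DenseRange (join (H := H) X Λ) := by
  refine (denseRange_glueTensor (H := H) h).mono ?_
  rintro _ ⟨c, rfl⟩
  exact ⟨splitTensor X Λ c, LinearMap.extendOfNorm_eq (denseRange_splitTensor (H := H) X Λ)
    ⟨1, fun c => by rw [norm_glueTensor h, one_mul]⟩ c⟩

/-- The identification of `A ∈ B(H_X)` with `A ⊗ 1 ∈ B(H_Λ)`, for `X ⊆ Λ`. -/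
def ampliate {X : Finset Γ} (Λ : Finset Γ) (A : LocalAlgebra H X) : LocalAlgebra H Λ :=
  ((join X Λ).toLinearMap ∘ₗ (A.rTensor (LocalSpace H (Λ \ X))).toLinearMap).extendOfNorm
    (join X Λ).toLinearMap

lemma ampliate_join {X Λ : Finset Γ} (h : X ⊆ Λ) (A : LocalAlgebra H X)
    (ξ : LocalSpace H X) (η : LocalSpace H (Λ \ X)) :
    ampliate Λ A (join X Λ (ξ ⊗ₜ[ℂ] η)) = join X Λ (A ξ ⊗ₜ[ℂ] η) := by
  refine (LinearMap.extendOfNorm_eq (f := (join X Λ).toLinearMap ∘ₗ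
    (A.rTensor (LocalSpace H (Λ \ X))).toLinearMap) (e := (join X Λ).toLinearMap)
    (denseRange_join h) ⟨‖A‖, fun z => ?_⟩ (ξ ⊗ₜ[ℂ] η)).trans rfl
  change ‖join X Λ (A.rTensor _ z)‖ ≤ ‖A‖ * ‖join X Λ z‖
  rw [norm_join h, norm_join h]
  exact (ContinuousLinearMap.le_opNorm _ _).trans
    (mul_le_mul_of_nonneg_right (ContinuousLinearMap.norm_rTensor_le (LocalSpace H (Λ \ X)) A) (norm_nonneg _))

/-! ### Dynamics -/

/-- `U` is the strongly continuous one-parameter unitary group with generator `A`, that is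
`U t = exp (i t A)`: `U t ψ` is differentiable at `t = 0` exactly for `ψ` in the domain of `A`,
and the derivative is then `i A ψ`. -/
structure IsUnitaryGroupOf {K : Type*} [NormedAddCommGroup K] [InnerProductSpace ℂ K]
    [CompleteSpace K] (A : K →ₗ.[ℂ] K) (U : ℝ → K →L[ℂ] K) : Prop where
  unitary (t : ℝ) : U t ∈ unitary (K →L[ℂ] K)
  map_add (s t : ℝ) : U (s + t) = U s * U t
  continuous (ψ : K) : Continuous fun t => U t ψ
  generator (ψ φ : K) : HasDerivAt (fun t => U t ψ) (Complex.I • φ) 0 ↔ (ψ, φ) ∈ A.graph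

open Classical in
/-- `expI A t = exp (i t A)` for a self-adjoint operator `A`. -/
def expI {K : Type*} [NormedAddCommGroup K] [InnerProductSpace ℂ K]
    [CompleteSpace K] (A : K →ₗ.[ℂ] K) : ℝ → K →L[ℂ] K :=
  if h : ∃ U, IsUnitaryGroupOf A U then h.choose else 0

/-- The graph of `∑_{x ∈ Λ} H_x + ∑_{X ⊆ Λ} Φ(X)` on the algebraic tensor product of the domains
of the on-site operators `H_x` (here written `h x`): the span of the pairs `(⊗ ψ_x, H (⊗ ψ_x))`
with `ψ_x ∈ D(H_x)`. -/
def coreGraph (h : ∀ x, H x →ₗ.[ℂ] H x) (Φ : ∀ X : Finset Γ, LocalAlgebra H X) (Λ : Finset Γ) :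
    Submodule ℂ (LocalSpace H Λ × LocalSpace H Λ) :=
  Submodule.span ℂ <| Set.range fun ψ : ∀ x : Λ, (h x).domain =>
    (HilbertTensor.tprod (fun x : Λ => H x) (fun x => (ψ x : H x)),
      ∑ x : Λ, HilbertTensor.tprod (fun x : Λ => H x)
          (Function.update (fun y => (ψ y : H y)) x (h x (ψ x)))
        + ∑ X ∈ Λ.powerset, ampliate Λ (Φ X)
          (HilbertTensor.tprod (fun x : Λ => H x) fun x => (ψ x : H x)))

/-- The self-adjoint Hamiltonian `H_Λ`: the closure of `∑_{x ∈ Λ} H_x + ∑_{X ⊆ Λ} Φ(X)` from the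
algebraic tensor product of the domains of the `H_x`. -/
def hamiltonian (h : ∀ x, H x →ₗ.[ℂ] H x) (Φ : ∀ X : Finset Γ, LocalAlgebra H X)
    (Λ : Finset Γ) : LocalSpace H Λ →ₗ.[ℂ] LocalSpace H Λ :=
  (coreGraph h Φ Λ).topologicalClosure.toLinearPMap

/-- The Heisenberg dynamics `τ_t^Λ(A) = exp(i t H_Λ) A exp(-i t H_Λ)`. -/
def dynamics (h : ∀ x, H x →ₗ.[ℂ] H x) (Φ : ∀ X : Finset Γ, LocalAlgebra H X)
    (Λ : Finset Γ) (t : ℝ) (A : LocalAlgebra H Λ) : LocalAlgebra H Λ :=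
  expI (hamiltonian h Φ Λ) t * A * expI (hamiltonian h Φ Λ) (-t)

/-! ### Geometry of `Γ` and norms of interactions -/

section Geometry

variable [Fintype Γ]

/-- The surface of `X` in `Γ`: the sets that meet both `X` and its complement. -/
def surface (X : Finset Γ) : Finset (Finset Γ) :=
  Finset.univ.filter fun Z => (Z ∩ X).Nonempty ∧ (Z ∩ Xᶜ).Nonempty

open Classical in
/-- The `Φ`-boundary of `X`: the points of `X` that lie in some `Z` in the surface of `X` with
`Φ Z ≠ 0`. -/
def boundary (Φ : ∀ X : Finset Γ, LocalAlgebra H X) (X : Finset Γ) : Finset Γ :=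
  X.filter fun x => ∃ Z ∈ surface X, x ∈ Z ∧ Φ Z ≠ 0

variable [MetricSpace Γ]

/-- The distance `min_{x ∈ X, y ∈ Y} d(x, y)` (infinite if `X` or `Y` is empty). -/
def setDist (X Y : Finset Γ) : ENNReal := ⨅ x ∈ X, ⨅ y ∈ Y, edist x y

/-- `C_{x,y}`: the infimum of all `c` with `∑_z F(d(x,z)) F(d(z,y)) ≤ c F(d(x,y))`. -/
def convConstAt (F : NNReal → ℝ) (x y : Γ) : ℝ :=
  sInf {c : ℝ | ∑ z, F (nndist x z) * F (nndist z y) ≤ c * F (nndist x y)}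

/-- The convolution constant `C = max_{x,y} C_{x,y}`. -/
def convConst (Γ : Type*) [Fintype Γ] [MetricSpace Γ] (F : NNReal → ℝ) : ℝ :=
  ⨆ p : Γ × Γ, convConstAt F p.1 p.2

/-- `‖Φ‖ = max_{x,y} ∑_{X ∋ x,y} ‖Φ(X)‖ / F(d(x,y))`. -/
def interactionNorm (F : NNReal → ℝ) (Φ : ∀ X : Finset Γ, LocalAlgebra H X) : ℝ :=
  ⨆ p : Γ × Γ, ∑ X : Finset Γ with p.1 ∈ X ∧ p.2 ∈ X, ‖Φ X‖ / F (nndist p.1 p.2)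

/-- `D(X,Y)`: the smaller one of `∑_{x ∈ ∂X} ∑_{y ∈ Y} F(d(x,y))` and
`∑_{x ∈ X} ∑_{y ∈ ∂Y} F(d(x,y))`, where `∂` is the `Φ`-boundary. -/
def boundarySum (F : NNReal → ℝ) (Φ : ∀ X : Finset Γ, LocalAlgebra H X) (X Y : Finset Γ) : ℝ :=
  min (∑ x ∈ boundary Φ X, ∑ y ∈ Y, F (nndist x y)) (∑ x ∈ X, ∑ y ∈ boundary Φ Y, F (nndist x y))

end Geometry

end LR

end

/-! Self-adjointness: the algebraic tensor product of the domains `D(H_x)` is invariant under the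
product group `⨂ exp(i t H_x)`. A dense core that is invariant under a unitary group, with generator
the given operator, has vanishing deficiency spaces
(`IsInvariantCore.topologicalClosure_eq_adjoint`), and the bounded self-adjoint interaction only
shears graphs (`topologicalClosure_map_shear_eq_adjoint`). Stone's theorem then gives the unitary
group `W` of `H_Λ`.

The bound: since the `H_x` are unbounded, `τ_t(A)` is in general not norm differentiable in `t`, and
the usual differential inequality is replaced by a discrete Gronwall argument. Let `T` be the free
group and `V` the total interaction. In operator norm, `W ε T(-ε) = 1 + i ∫₀^ε T_s V T_{-s} ds +
O(ε²)` (`norm_mul_neg_sub_one_sub_le`), and free evolution does not spread localization. For `A`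
localized in `X`, terms `Φ(Z)` with `Z` disjoint from `X` commute with `A`; terms with `Z ⊆ X` act
as a conjugation inside the observables localized in `X` that is isometric up to `O(ε²)`; only `Z`
in the surface of `X` costs something at first order. So if `‖[A,B]‖ ≤ γ_X ‖A‖` for all `X` and all
`A` localized in `X`, then after time `ε` the same holds with `γ_X + 2ε ∑_{Z ∈ surface X} ‖Φ(Z)‖ γ_Z
+ O(ε²)` (`CommutatorBound.step`).

The convolution inequality for `F` makes `majorant` a supersolution of this recursion
(`majorant_step`). Splitting `[0,t]` into `n` steps leaves an error `O(1/n)` (`bound_of_recursion`),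
and `n → ∞` gives the bound with the boundary of `X`. Exchanging the two observables and reversing
time gives the one with the boundary of `Y`. -/

noncomputable section

namespace LR

/-! ### Stone's theorem for unbounded self-adjoint operators. -/

section Stone

variable {K : Type*} [NormedAddCommGroup K] [InnerProductSpace ℂ K] [CompleteSpace K]

/-- This converts self-adjointness into a membership test: a vector is placed in the domain,
together with its image, by checking symmetry against all pairs of the graph. -/
lemma mem_graph_iff_of_isSelfAdjoint {A : K →ₗ.[ℂ] K} (hA : IsSelfAdjoint A) (p : K × K) :
    p ∈ A.graph ↔ ∀ a b, (a, b) ∈ A.graph → ⟪b, p.1⟫_ℂ = ⟪a, p.2⟫_ℂ := by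
  have h := LinearPMap.adjoint_graph_eq_graph_adjoint hA.dense_domain
  rw [LinearPMap.isSelfAdjoint_def.1 hA] at h
  conv_lhs => rw [h]
  simp only [Submodule.mem_adjoint_iff, sub_eq_zero]

lemma inner_eq_of_mem_graph {A : K →ₗ.[ℂ] K} (hA : IsSelfAdjoint A) {p q : K × K}
    (hp : p ∈ A.graph) (hq : q ∈ A.graph) : ⟪p.2, q.1⟫_ℂ = ⟪p.1, q.2⟫_ℂ :=
  (mem_graph_iff_of_isSelfAdjoint hA q).1 hq _ _ hp

/-- The cross term is the real part of `i r ⟪b, a⟫`, and `⟪b, a⟫` is real. This bounds `A + i r`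
from below. -/
lemma norm_sq_add_I_smul {a b : K} (h : ⟪b, a⟫_ℂ = ⟪a, b⟫_ℂ) (r : ℝ) :
    ‖b + (Complex.I * r) • a‖ ^ 2 = ‖b‖ ^ 2 + r ^ 2 * ‖a‖ ^ 2 := by
  have him : (⟪b, a⟫_ℂ).im = 0 := by
    have := inner_conj_symm (𝕜 := ℂ) b a
    rw [← h] at this
    exact Complex.conj_eq_iff_im.1 this
  rw [@norm_add_sq ℂ, inner_smul_right, norm_smul, mul_pow]
  simp [him]

lemma isClosed_graph_of_isSelfAdjoint {A : K →ₗ.[ℂ] K} (hA : IsSelfAdjoint A) :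
    IsClosed (A.graph : Set (K × K)) := hA.isClosed

/-- The bounded operator `i r (A + i r)⁻¹` for a self-adjoint operator `A` and real `r ≠ 0`. -/
lemma exists_scaled_resolvent {A : K →ₗ.[ℂ] K} (hA : IsSelfAdjoint A) {r : ℝ} (hr : r ≠ 0) :
    ∃ P : K →L[ℂ] K, (∀ x, (P x, (Complex.I * r) • (x - P x)) ∈ A.graph) ∧
      (∀ a b, (a, b) ∈ A.graph → P ((Complex.I * r) • a + b) = (Complex.I * r) • a) ∧
      ∀ x, ‖P x‖ ≤ ‖x‖ := by
  let S : A.graph →L[ℂ] K := ((ContinuousLinearMap.snd ℂ K K)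
    + (Complex.I * r : ℂ) • ContinuousLinearMap.fst ℂ K K).comp A.graph.subtypeL
  have hS : ∀ p : A.graph, S p = (p : K × K).2 + (Complex.I * r : ℂ) • (p : K × K).1 :=
    fun p => rfl
  have hnorm : ∀ p : A.graph, ‖S p‖ ^ 2 = ‖(p : K × K).2‖ ^ 2 + r ^ 2 * ‖(p : K × K).1‖ ^ 2 :=
    fun p => norm_sq_add_I_smul (inner_eq_of_mem_graph hA p.2 p.2) r
  have h1 : ∀ p : A.graph, ‖(p : K × K).2‖ ≤ ‖S p‖ := fun p => by
    refine le_of_sq_le_sq ?_ (norm_nonneg _)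
    rw [hnorm]; nlinarith [mul_nonneg (sq_nonneg r) (sq_nonneg ‖(p : K × K).1‖)]
  have h2 : ∀ p : A.graph, |r| * ‖(p : K × K).1‖ ≤ ‖S p‖ := fun p => by
    refine le_of_sq_le_sq ?_ (norm_nonneg _)
    rw [hnorm, mul_pow, sq_abs]; nlinarith [sq_nonneg ‖(p : K × K).2‖]
  have hr' : 0 < |r| := abs_pos.2 hr
  have hanti : ∃ k, AntilipschitzWith k S := by
    refine ⟨⟨max 1 |r|⁻¹, by positivity⟩, ContinuousLinearMap.antilipschitz_of_bound _ ?_⟩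
    intro p
    change ‖(p : K × K)‖ ≤ max 1 |r|⁻¹ * ‖S p‖
    rw [Prod.norm_def]
    refine max_le ?_ ?_
    · calc ‖(p : K × K).1‖ = |r|⁻¹ * (|r| * ‖(p : K × K).1‖) := by field_simp
        _ ≤ |r|⁻¹ * ‖S p‖ := by gcongr; exact h2 p
        _ ≤ _ := by gcongr; exact le_max_right _ _
    · calc ‖(p : K × K).2‖ ≤ 1 * ‖S p‖ := by rw [one_mul]; exact h1 p
        _ ≤ _ := by gcongr; exact le_max_left _ _
  obtain ⟨k, hk⟩ := hanti
  have : CompleteSpace A.graph :=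
    (isClosed_graph_of_isSelfAdjoint hA).isComplete.completeSpace_coe
  have hcl : IsClosed (Set.range S) := hk.isClosed_range S.uniformContinuous
  have hsurj : Function.Surjective S := by
    have hcl' : IsClosed ((LinearMap.range S.toLinearMap : Submodule ℂ K) : Set K) := hcl
    have : CompleteSpace (LinearMap.range S.toLinearMap : Submodule ℂ K) :=
      hcl'.isComplete.completeSpace_coe
    rw [← ContinuousLinearMap.coe_coe, ← LinearMap.range_eq_top,
      ← Submodule.orthogonal_eq_bot_iff, Submodule.eq_bot_iff]
    intro y hy
    have hy' : ∀ a b, (a, b) ∈ A.graph → ⟪b + (Complex.I * r : ℂ) • a, y⟫_ℂ = 0 := fun a b hab =>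
      (Submodule.mem_orthogonal _ _).1 hy _ ⟨⟨(a, b), hab⟩, rfl⟩
    -- A vector orthogonal to the range of `A + i r` would be an eigenvector with eigenvalue `i r`;
    -- pairing it with its own image under `A + i r`, which is `2 i r y`, shows that it vanishes.
    have hmem : (y, (Complex.I * r : ℂ) • y) ∈ A.graph := by
      refine (mem_graph_iff_of_isSelfAdjoint hA _).2 fun a b hab => ?_
      have := hy' a b hab
      rw [inner_add_left, inner_smul_left] at this
      rw [inner_smul_right]
      simp only [map_mul, Complex.conj_I, Complex.conj_ofReal] at this
      linear_combination this
    have h0 := hy' _ _ hmem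
    have : ⟪y, y⟫_ℂ = 0 := by
      rw [← two_smul ℂ, inner_smul_left, inner_smul_left] at h0
      simpa [hr] using h0
    exact inner_self_eq_zero.1 this
  let e := LinearEquiv.ofBijective S.toLinearMap ⟨hk.injective, hsurj⟩
  have he : ∀ x, S (e.symm x) = x := fun x => e.apply_symm_apply x
  have hPb : ∀ x, ‖((Complex.I * r : ℂ) • (LinearMap.fst ℂ K K ∘ₗ A.graph.subtype ∘ₗ
      e.symm.toLinearMap)) x‖ ≤ 1 * ‖x‖ := fun x => by
    have := h2 (e.symm x)
    rw [he] at this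
    rw [one_mul]
    change ‖(Complex.I * r : ℂ) • ((e.symm x : K × K)).1‖ ≤ _
    rw [norm_smul]
    simpa using this
  refine ⟨LinearMap.mkContinuous _ 1 hPb, fun x => ?_, fun a b hab => ?_, fun x => ?_⟩
  · have hx := he x
    rw [hS] at hx
    have : ((Complex.I * r : ℂ) • (e.symm x : K × K).1,
        (Complex.I * r : ℂ) • (x - (Complex.I * r : ℂ) • (e.symm x : K × K).1))
        = (Complex.I * r : ℂ) • (e.symm x : K × K) := by
      refine Prod.ext rfl ?_
      change _ = (Complex.I * r : ℂ) • (e.symm x : K × K).2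
      exact congrArg _ (sub_eq_of_eq_add hx.symm)
    change ((Complex.I * r : ℂ) • (e.symm x : K × K).1,
        (Complex.I * r : ℂ) • (x - (Complex.I * r : ℂ) • (e.symm x : K × K).1)) ∈ _
    rw [this]
    exact A.graph.smul_mem _ (e.symm x).2
  · have : e.symm ((Complex.I * r : ℂ) • a + b) = ⟨(a, b), hab⟩ := by
      rw [LinearEquiv.symm_apply_eq, add_comm]; rfl
    change (Complex.I * r : ℂ) • (e.symm ((Complex.I * r : ℂ) • a + b) : K × K).1 = _
    rw [this]
  · exact (hPb x).trans_eq (one_mul _)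

/-- Yosida approximation: bounded self-adjoint operators converging strongly to `A` on its
domain. -/
lemma exists_yosida {A : K →ₗ.[ℂ] K} (hA : IsSelfAdjoint A) :
    ∃ B : ℕ → K →L[ℂ] K, (∀ n, IsSelfAdjoint (B n)) ∧ (∀ n m, Commute (B n) (B m)) ∧
      ∀ a b, (a, b) ∈ A.graph → Filter.Tendsto (fun n => B n a) Filter.atTop (nhds b) := by
  choose! P hP1 hP2 hP3 using fun r : ℝ => exists_scaled_resolvent hA (r := r)
  have hgr : ∀ r ≠ 0, ∀ a b, (a, b) ∈ A.graph → P r b = (Complex.I * r : ℂ) • (a - P r a) := by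
    intro r hr a b hab
    have := hP2 r hr a b hab
    rw [map_add, map_smul] at this
    rw [smul_sub, ← this]; abel
  have hmap : ∀ r ≠ 0, ∀ a b, (a, b) ∈ A.graph → (P r a, P r b) ∈ A.graph := by
    intro r hr a b hab
    rw [hgr r hr a b hab]; exact hP1 r hr a
  have hcomm : ∀ r ≠ 0, ∀ s ≠ 0, ∀ x, P r (P s x) = P s (P r x) := by
    intro r hr s hs x
    have h1 := hmap s hs _ _ (hP1 r hr x)
    have h2 := hP2 r hr _ _ h1
    -- `P s` maps the graph pair of `P r x` to a graph pair; recovering its first entry through `P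
    -- r` shows that `P r` and `P s` commute.
    rw [map_smul, map_sub, ← smul_add, map_smul] at h2
    have hc : (Complex.I * r : ℂ) ≠ 0 := by simp [hr]
    have := smul_right_injective K hc h2
    simpa using this
  have hadj : ∀ r ≠ 0, ∀ x y, ⟪P r x, y⟫_ℂ = ⟪x, P (-r) y⟫_ℂ := by
    intro r hr x y
    have hc : (Complex.I * r : ℂ) ≠ 0 := by simp [hr]
    have h := inner_eq_of_mem_graph hA (hP1 r hr x) (hP1 (-r) (neg_ne_zero.2 hr) y)
    simp only [inner_smul_left, inner_smul_right, inner_sub_left, inner_sub_right, map_mul,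
      Complex.conj_I, Complex.conj_ofReal, Complex.ofReal_neg] at h
    refine mul_left_cancel₀ hc ?_
    linear_combination h
  have hconv : ∀ s : ℕ → ℝ, (∀ n, |s n| = n + 1) → ∀ x,
      Filter.Tendsto (fun n => P (s n) x) Filter.atTop (nhds x) := by
    intro s hs x
    have hs0 : ∀ n, s n ≠ 0 := fun n h0 => by
      have := hs n; rw [h0, abs_zero] at this; linarith [n.cast_nonneg (α := ℝ)]
    rw [Metric.tendsto_atTop]
    intro ε hε
    obtain ⟨a, ha, hxa⟩ := Metric.dense_iff.1 hA.dense_domain x (ε / 3) (by positivity)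
    obtain ⟨N, hN⟩ := exists_nat_gt (‖A ⟨a, hxa⟩‖ / (ε / 3))
    refine ⟨N, fun n hn => ?_⟩
    have h1 := hgr _ (hs0 n) _ _ (A.mem_graph ⟨a, hxa⟩)
    have h2 : (n + 1 : ℝ) * ‖a - P (s n) a‖ ≤ ‖A ⟨a, hxa⟩‖ := by
      have := hP3 _ (hs0 n) (A ⟨a, hxa⟩)
      rw [h1, norm_smul] at this
      simpa [hs] using this
    have h3 : ‖a - P (s n) a‖ < ε / 3 := by
      rw [div_lt_iff₀ (by positivity)] at hN
      have hn' : (N : ℝ) ≤ n := by exact_mod_cast hn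
      by_contra hcon
      push Not at hcon
      nlinarith
    have h4 : ‖P (s n) (x - a)‖ ≤ ‖x - a‖ := hP3 _ (hs0 n) _
    have h5 : ‖x - a‖ < ε / 3 := by
      rw [Metric.mem_ball, dist_comm, dist_eq_norm] at ha; exact ha
    rw [dist_eq_norm]
    calc ‖P (s n) x - x‖ = ‖P (s n) (x - a) - (x - a) - (a - P (s n) a)‖ := by
          rw [map_sub]; congr 1; abel
      _ ≤ ‖P (s n) (x - a)‖ + ‖x - a‖ + ‖a - P (s n) a‖ :=
          (norm_sub_le _ _).trans (by gcongr; exact norm_sub_le _ _)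
      _ < ε := by linarith
  let c : ℕ → ℝ := fun n => n + 1
  have hc0 : ∀ n, c n ≠ 0 := fun n => by positivity
  have hc0' : ∀ n, -c n ≠ 0 := fun n => neg_ne_zero.2 (hc0 n)
  -- Since `A P(c) = i c (1 - P(c))`, this operator is `P(-c) A P(c)`. It is symmetric because
  -- `P(-c)` is the adjoint of `P(c)`, and on the domain it equals `P(-c) P(c) A`, which converges
  -- strongly to `A`. The choice `c n = n + 1` avoids `c = 0`.
  refine ⟨fun n => P (-c n) ∘L ((Complex.I * c n : ℂ) • (1 - P (c n))), fun n => ?_,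
    fun n m => ?_, fun a b hab => ?_⟩
  · rw [ContinuousLinearMap.isSelfAdjoint_iff_isSymmetric]
    intro x y
    have h1 := hadj _ (hc0' n) ((Complex.I * c n : ℂ) • (x - P (c n) x)) y
    have h2 := inner_eq_of_mem_graph hA (hP1 _ (hc0 n) x) (hP1 _ (hc0 n) y)
    have h3 := hadj _ (hc0 n) x ((Complex.I * c n : ℂ) • (y - P (c n) y))
    rw [neg_neg] at h1
    exact h1.trans (h2.trans h3)
  · ext x
    simp only [mul_apply_eq_comp, ContinuousLinearMap.comp_apply,
      smul_apply, sub_apply, one_apply_eq_self, map_smul, map_sub]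
    simp only [hcomm _ (hc0 n) _ (hc0' m), hcomm _ (hc0' n) _ (hc0' m),
      hcomm _ (hc0 n) _ (hc0 m), hcomm _ (hc0' n) _ (hc0 m)]
    module
  · have h1 : ∀ n, (P (-c n) ∘L ((Complex.I * c n : ℂ) • (1 - P (c n)))) a
        = P (-c n) (P (c n) b) := fun n => by
      rw [hgr _ (hc0 n) a b hab]; rfl
    simp only [h1]
    have hcn : ∀ n, |c n| = n + 1 := fun n => abs_of_pos (by positivity)
    have t1 := hconv c hcn b
    have t2 := hconv (fun n => -c n) (fun n => by rw [abs_neg, hcn]) b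
    have t3 : Filter.Tendsto (fun n => P (-c n) (P (c n) b - b)) Filter.atTop (nhds 0) :=
      squeeze_zero_norm (fun n => hP3 _ (hc0' n) _) (by
        simpa using (t1.sub_const b).norm)
    simpa using t3.add t2

lemma mem_unitary_of_norm_map {U V : K →L[ℂ] K} (hU : ∀ x, ‖U x‖ = ‖x‖) (h : U * V = 1) :
    U ∈ unitary (K →L[ℂ] K) := by
  have h1 : star U * U = 1 := (ContinuousLinearMap.norm_map_iff_adjoint_comp_self U).1 hU
  have h2 : star U = V := by rw [← mul_one (star U), ← h, ← mul_assoc, h1, one_mul]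
  exact Unitary.mem_iff.2 ⟨h1, by rw [h2, h]⟩

/-- Because every `U t` is isometric, approximating `x` from `D` is uniform in `t`. -/
lemma continuous_apply_of_dense {U : ℝ → K →L[ℂ] K} (hU : ∀ t x, ‖U t x‖ = ‖x‖) {D : Set K}
    (hD : Dense D) (h : ∀ x ∈ D, Continuous fun t => U t x) (x : K) :
    Continuous fun t => U t x := by
  refine continuous_of_uniform_approx_of_continuous fun u hu => ?_
  obtain ⟨ε, hε, hεu⟩ := Metric.mem_uniformity_dist.1 hu
  obtain ⟨a, ha, haD⟩ := Metric.dense_iff.1 hD x ε hε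
  refine ⟨_, h a haD, fun t => hεu ?_⟩
  rw [dist_eq_norm, ← map_sub, hU, ← dist_eq_norm, dist_comm]
  exact ha

section BoundedGroup

variable {B : K →L[ℂ] K}

/-- The unitary group `exp (i t B)` of a bounded operator. -/
def boundedExp (B : K →L[ℂ] K) (t : ℝ) : K →L[ℂ] K := NormedSpace.exp (t • (Complex.I • B))

lemma boundedExp_mem_unitary (hB : IsSelfAdjoint B) (t : ℝ) :
    boundedExp B t ∈ unitary (K →L[ℂ] K) := by
  let _ := NormedAlgebra.restrictScalars ℚ ℂ (K →L[ℂ] K)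
  refine NormedSpace.exp_mem_unitary_of_mem_skewAdjoint ?_
  rw [skewAdjoint.mem_iff]
  simp [star_smul, hB.star_eq]

lemma norm_apply_of_mem_unitary {U : K →L[ℂ] K} (hU : U ∈ unitary (K →L[ℂ] K)) (x : K) :
    ‖U x‖ = ‖x‖ :=
  ContinuousLinearMap.norm_map_of_mem_unitary hU x

lemma boundedExp_zero (B : K →L[ℂ] K) : boundedExp B 0 = 1 := by simp [boundedExp]

lemma boundedExp_add (B : K →L[ℂ] K) (s t : ℝ) :
    boundedExp B (s + t) = boundedExp B s * boundedExp B t := by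
  let _ := NormedAlgebra.restrictScalars ℚ ℂ (K →L[ℂ] K)
  rw [boundedExp, add_smul, NormedSpace.exp_add_of_commute]
  · rfl
  · exact ((Commute.refl _).smul_left _).smul_right _

lemma hasDerivAt_boundedExp (B : K →L[ℂ] K) (x : K) (t : ℝ) :
    HasDerivAt (fun t => boundedExp B t x) (Complex.I • boundedExp B t (B x)) t := by
  have h := ((ContinuousLinearMap.apply ℂ K x).restrictScalars ℝ).hasFDerivAt.comp_hasDerivAt t
    (hasDerivAt_exp_smul_const (𝕂 := ℝ) (Complex.I • B) t)
  simpa [boundedExp, Function.comp_def] using h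

lemma norm_boundedExp_sub_le (hB : IsSelfAdjoint B) (x : K) (t : ℝ) :
    ‖boundedExp B t x - x‖ ≤ |t| * ‖B x‖ := by
  have h := Convex.norm_image_sub_le_of_norm_hasDerivWithin_le (𝕜 := ℝ) (s := Set.univ)
    (f := fun t => boundedExp B t x) (C := ‖B x‖) (x := 0) (y := t)
    (fun s _ => (hasDerivAt_boundedExp B x s).hasDerivWithinAt)
    (fun s _ => by
      rw [norm_smul, norm_apply_of_mem_unitary (boundedExp_mem_unitary hB s)]; simp)
    convex_univ (Set.mem_univ _) (Set.mem_univ _)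
  simpa [boundedExp_zero, mul_comm] using h

/-- The vector `y` is a substitute for `B x`. When `B` runs through Yosida approximations there is
no uniform control of `B (B x)`, whereas `B y` converges as soon as `y` lies in the domain. -/
lemma norm_boundedExp_sub_sub_le (hB : IsSelfAdjoint B) (x y : K) (t : ℝ) :
    ‖boundedExp B t x - x - t • Complex.I • B x‖ ≤ |t| * (2 * ‖B x - y‖ + |t| * ‖B y‖) := by
  have h := Convex.norm_image_sub_le_of_norm_hasDerivWithin_le (𝕜 := ℝ)
    (s := Metric.closedBall 0 |t|)
    (f := fun t : ℝ => boundedExp B t x - x - t • Complex.I • B x)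
    (C := 2 * ‖B x - y‖ + |t| * ‖B y‖) (x := 0) (y := t)
    (fun s _ => (((hasDerivAt_boundedExp B x s).sub_const x).sub
      ((hasDerivAt_id s).smul_const _)).hasDerivWithinAt)
    (fun s hs => by
      have hs' : |s| ≤ |t| := by simpa using hs
      rw [one_smul, ← smul_sub, norm_smul, Complex.norm_I, one_mul]
      have e : boundedExp B s (B x) - B x
          = boundedExp B s (B x - y) - (B x - y) + (boundedExp B s y - y) := by
        rw [map_sub]; abel
      have h1 := norm_apply_of_mem_unitary (boundedExp_mem_unitary hB s) (B x - y)
      calc ‖boundedExp B s (B x) - B x‖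
          ≤ ‖boundedExp B s (B x - y)‖ + ‖B x - y‖ + |s| * ‖B y‖ := by
            rw [e]
            exact (norm_add_le _ _).trans
              (add_le_add (norm_sub_le _ _) (norm_boundedExp_sub_le hB y s))
        _ ≤ _ := by rw [h1, ← two_mul]; gcongr)
    (convex_closedBall _ _) (by simp) (by simp)
  simpa [boundedExp_zero, mul_comm] using h

/-- Commutation factors `exp(itB)` as `exp(itB') exp(it(B - B'))`, which turns convergence of the
Yosida approximations on the domain into convergence of their groups. -/
lemma norm_boundedExp_sub_boundedExp_le {B' : K →L[ℂ] K} (hB : IsSelfAdjoint B)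
    (hB' : IsSelfAdjoint B') (h : Commute B B') (x : K) (t : ℝ) :
    ‖boundedExp B t x - boundedExp B' t x‖ ≤ |t| * ‖B x - B' x‖ := by
  let _ := NormedAlgebra.restrictScalars ℚ ℂ (K →L[ℂ] K)
  have e : boundedExp B t = boundedExp B' t * boundedExp (B - B') t := by
    rw [boundedExp, boundedExp, boundedExp, ← NormedSpace.exp_add_of_commute]
    · congr 1; module
    · exact ((((h.symm.sub_right (Commute.refl _)).smul_left _).smul_right _).smul_left
        _).smul_right _
  rw [e, mul_apply_eq_comp, ← map_sub, norm_apply_of_mem_unitary (boundedExp_mem_unitary hB' t)]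
  exact norm_boundedExp_sub_le (hB.sub hB') x t

end BoundedGroup

lemma hasDerivAt_zero_of_norm_sub_sub_le {f : ℝ → K} {v : K}
    (h : ∀ ε > 0, ∃ M, ∀ t, ‖f t - f 0 - t • v‖ ≤ |t| * (ε + |t| * M)) :
    HasDerivAt f v 0 := by
  rw [hasDerivAt_iff_isLittleO, Asymptotics.isLittleO_iff]
  intro c hc
  obtain ⟨M, hM⟩ := h (c / 2) (by positivity)
  have : ∀ᶠ t : ℝ in nhds 0, |t| * M < c / 2 := by
    have hcont : Continuous fun t : ℝ => |t| * M := by fun_prop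
    have := hcont.tendsto 0
    simp only [abs_zero, zero_mul] at this
    exact this.eventually_lt_const (by positivity)
  filter_upwards [this] with t ht
  rw [sub_zero]
  refine (hM t).trans ?_
  rw [mul_comm, Real.norm_eq_abs]
  gcongr
  linarith

/-- Stone's theorem: every self-adjoint operator generates a strongly continuous one-parameter
unitary group. -/
theorem exists_isUnitaryGroupOf {A : K →ₗ.[ℂ] K} (hA : IsSelfAdjoint A) :
    ∃ U, IsUnitaryGroupOf A U := by
  obtain ⟨B, hB, hcomm, hlim⟩ := exists_yosida hA
  have hiso : ∀ n t x, ‖boundedExp (B n) t x‖ = ‖x‖ := fun n t x =>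
    norm_apply_of_mem_unitary (boundedExp_mem_unitary (hB n) t) x
  have hcauchy : ∀ t x, CauchySeq fun n => boundedExp (B n) t x := by
    intro t x
    rw [Metric.cauchySeq_iff]
    intro ε hε
    obtain ⟨a, ha, hxa⟩ := Metric.dense_iff.1 hA.dense_domain x (ε / 4) (by positivity)
    have hxa' : ‖x - a‖ < ε / 4 := by
      rw [Metric.mem_ball, dist_comm, dist_eq_norm] at ha; exact ha
    obtain ⟨N, hN⟩ := Metric.cauchySeq_iff.1 (hlim _ _ (A.mem_graph ⟨a, hxa⟩)).cauchySeq
      (ε / (2 * (|t| + 1))) (by positivity)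
    refine ⟨N, fun m hm n hn => ?_⟩
    have h1 := norm_boundedExp_sub_boundedExp_le (hB m) (hB n) (hcomm m n) a t
    have h2 : |t| * ‖B m a - B n a‖ ≤ ε / 2 := by
      have := hN m hm n hn
      rw [dist_eq_norm] at this
      calc |t| * ‖B m a - B n a‖ ≤ (|t| + 1) * (ε / (2 * (|t| + 1))) := by
            gcongr; linarith
        _ = ε / 2 := by field_simp
    rw [dist_eq_norm]
    calc ‖boundedExp (B m) t x - boundedExp (B n) t x‖
        = ‖boundedExp (B m) t (x - a) - boundedExp (B n) t (x - a)
          + (boundedExp (B m) t a - boundedExp (B n) t a)‖ := by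
          rw [map_sub, map_sub]; congr 1; abel
      _ ≤ ‖x - a‖ + ‖x - a‖ + |t| * ‖B m a - B n a‖ :=
          (norm_add_le _ _).trans (add_le_add ((norm_sub_le _ _).trans_eq
            (by rw [hiso, hiso])) h1)
      _ < ε := by linarith
  choose u hu using fun t x => cauchySeq_tendsto_of_complete (hcauchy t x)
  let U₀ : ℝ → K →ₗ[ℂ] K := fun t =>
    { toFun := u t
      map_add' := fun x y => tendsto_nhds_unique (hu t (x + y)) (by
        simpa only [map_add] using (hu t x).add (hu t y))
      map_smul' := fun c x => tendsto_nhds_unique (hu t (c • x)) (by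
        simpa only [map_smul, RingHom.id_apply] using (hu t x).const_smul c) }
  have hnorm : ∀ t x, ‖u t x‖ = ‖x‖ := fun t x =>
    tendsto_nhds_unique (hu t x).norm (by simp only [hiso]; exact tendsto_const_nhds)
  let U : ℝ → K →L[ℂ] K := fun t =>
    (U₀ t).mkContinuous 1 fun x => ((hnorm t x).trans (one_mul _).symm).le
  have hUu : ∀ t x, U t x = u t x := fun _ _ => rfl
  have hUadd : ∀ s t, U (s + t) = U s * U t := by
    intro s t
    ext x
    rw [mul_apply_eq_comp, hUu, hUu]
    refine tendsto_nhds_unique (hu _ x) ?_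
    have h1 : Filter.Tendsto (fun n => boundedExp (B n) s (boundedExp (B n) t x - u t x))
        Filter.atTop (nhds 0) := by
      rw [tendsto_zero_iff_norm_tendsto_zero]
      simp only [hiso]
      simpa using ((hu t x).sub_const (u t x)).norm
    have h2 := h1.add (hu s (u t x))
    simpa [boundedExp_add, hUu] using h2
  have hU0 : U 0 = 1 := by
    ext x
    refine tendsto_nhds_unique (hu 0 x) ?_
    simp [boundedExp_zero]
  have hderiv : ∀ a b, (a, b) ∈ A.graph → HasDerivAt (fun t => U t a) (Complex.I • b) 0 := by
    intro a b hab
    refine hasDerivAt_zero_of_norm_sub_sub_le fun ε hε => ?_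
    obtain ⟨y, hy, hya⟩ := Metric.dense_iff.1 hA.dense_domain b (ε / 2) (by positivity)
    have hyb : ‖b - y‖ ≤ ε / 2 := by
      rw [Metric.mem_ball, dist_comm, dist_eq_norm] at hy; exact hy.le
    refine ⟨‖A ⟨y, hya⟩‖, fun t => ?_⟩
    have h1 := hlim a b hab
    have h2 := hlim _ _ (A.mem_graph ⟨y, hya⟩)
    -- The quantitative Taylor bound for the approximating groups survives the limit, with `B n a →
    -- b` and `B n y → A y`.
    have h3 := le_of_tendsto_of_tendsto'
      ((((hu t a).sub_const a).sub ((h1.const_smul Complex.I).const_smul t)).norm)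
      ((((h1.sub_const y).norm.const_mul 2).add (h2.norm.const_mul |t|)).const_mul |t|)
      fun n => norm_boundedExp_sub_sub_le (hB n) a y t
    rw [hU0, one_apply_eq_self, hUu]
    refine h3.trans ?_
    gcongr
    linarith
  have hinv : ∀ t x, U (-t) (U t x) = x := fun t x => by
    rw [← mul_apply_eq_comp, ← hUadd, neg_add_cancel, hU0]; rfl
  have hunit : ∀ t, U t ∈ unitary (K →L[ℂ] K) := by
    intro t
    exact mem_unitary_of_norm_map (hnorm t) (V := U (-t)) (by rw [← hUadd, add_neg_cancel, hU0])
  have hcont : ∀ x, Continuous fun t => U t x := by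
    refine continuous_apply_of_dense hnorm hA.dense_domain fun a ha =>
      continuous_iff_continuousAt.2 fun s => ?_
    have h0 := (hderiv _ _ (A.mem_graph ⟨a, ha⟩)).continuousAt
    have h1 : (fun t => U t a) = fun t => U s (U (t - s) a) := by
      ext t; rw [← mul_apply_eq_comp, ← hUadd, add_sub_cancel]
    rw [h1]
    refine (U s).continuous.continuousAt.comp ?_
    have h2 : ContinuousAt (fun t : ℝ => t - s) s := by fun_prop
    exact ContinuousAt.comp (g := fun t => U t a) (by simpa using h0) h2
  refine ⟨U, hunit, hUadd, hcont, fun a b => ⟨fun hab => ?_, hderiv a b⟩⟩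
  -- Conversely, if `U t a` is differentiable at `0`, differentiating `⟪U (-t) c, a⟫ = ⟪c, U t a⟫`
  -- for every `(c, d)` in the graph gives exactly the symmetry test that puts `a` in the domain.
  refine (mem_graph_iff_of_isSelfAdjoint hA _).2 fun c d hcd => ?_
  have hUinner : ∀ t, ⟪U (-t) c, a⟫_ℂ = ⟪c, U t a⟫_ℂ := by
    intro t
    rw [← ContinuousLinearMap.inner_map_map_of_mem_unitary (hunit t) (U (-t) c) a,
      ← mul_apply_eq_comp, ← hUadd, add_neg_cancel, hU0, one_apply_eq_self]
  have h1 : HasDerivAt (fun t => ⟪U (-t) c, a⟫_ℂ) (Complex.I * ⟪d, a⟫_ℂ) 0 := by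
    have := (HasDerivAt.scomp (0 : ℝ) (by simpa using hderiv c d hcd)
      (hasDerivAt_neg (0 : ℝ))).inner ℂ (hasDerivAt_const (0 : ℝ) a)
    simpa [inner_smul_left] using this
  have h2 : HasDerivAt (fun t => ⟪c, U t a⟫_ℂ) (Complex.I * ⟪c, b⟫_ℂ) 0 := by
    have := (hasDerivAt_const (0 : ℝ) c).inner ℂ hab
    simpa [inner_smul_right] using this
  rw [funext hUinner] at h1
  exact mul_left_cancel₀ Complex.I_ne_zero (h1.unique h2)

end Stone

/-! ### Strongly continuous unitary groups and graphs invariant under them. -/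

section UnitaryGroups

variable {K : Type*} [NormedAddCommGroup K] [InnerProductSpace ℂ K] [CompleteSpace K]

/-- A strongly continuous one-parameter unitary group. -/
structure IsUnitaryGroup (U : ℝ → K →L[ℂ] K) : Prop where
  unitary (t : ℝ) : U t ∈ unitary (K →L[ℂ] K)
  map_add (s t : ℝ) : U (s + t) = U s * U t
  continuous (x : K) : Continuous fun t => U t x

lemma IsUnitaryGroupOf.isUnitaryGroup {A : K →ₗ.[ℂ] K} {U : ℝ → K →L[ℂ] K}
    (h : IsUnitaryGroupOf A U) : IsUnitaryGroup U := ⟨h.unitary, h.map_add, h.continuous⟩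

namespace IsUnitaryGroup

variable {U : ℝ → K →L[ℂ] K} (hU : IsUnitaryGroup U)
include hU

lemma norm_apply (t : ℝ) (x : K) : ‖U t x‖ = ‖x‖ := norm_apply_of_mem_unitary (hU.unitary t) x

lemma map_zero : U 0 = 1 := by
  have h := hU.map_add 0 0
  rw [add_zero] at h
  have := congrArg (star (U 0) * ·) h
  simp only [← mul_assoc, Unitary.star_mul_self_of_mem (hU.unitary 0), one_mul] at this
  exact this.symm

lemma neg_mul_self (t : ℝ) : U (-t) * U t = 1 := by
  rw [← hU.map_add, neg_add_cancel, hU.map_zero]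

lemma mul_neg_self (t : ℝ) : U t * U (-t) = 1 := by
  rw [← hU.map_add, add_neg_cancel, hU.map_zero]

lemma neg_apply_self (t : ℝ) (x : K) : U (-t) (U t x) = x := by
  rw [← mul_apply_eq_comp, hU.neg_mul_self, one_apply_eq_self]

lemma apply_neg_self (t : ℝ) (x : K) : U t (U (-t) x) = x := by
  rw [← mul_apply_eq_comp, hU.mul_neg_self, one_apply_eq_self]

lemma star_eq (t : ℝ) : star (U t) = U (-t) := by
  rw [← mul_one (star (U t)), ← hU.mul_neg_self t, ← mul_assoc,
    Unitary.star_mul_self_of_mem (hU.unitary t), one_mul]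

lemma inner_neg_left (t : ℝ) (x y : K) : ⟪U (-t) x, y⟫_ℂ = ⟪x, U t y⟫_ℂ := by
  rw [← ContinuousLinearMap.inner_map_map_of_mem_unitary (hU.unitary t) (U (-t) x) y,
    hU.apply_neg_self]

lemma hasDerivAt {x y : K} (h : HasDerivAt (fun t => U t x) y 0) (t : ℝ) :
    HasDerivAt (fun t => U t x) (U t y) t := by
  have h1 : (fun t => U t x) = fun s => U t (U (s - t) x) := by
    ext s; rw [← mul_apply_eq_comp, ← hU.map_add, add_sub_cancel]
  rw [h1]
  have h2 : HasDerivAt (fun s => U (s - t) x) y t :=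
    HasDerivAt.comp_sub_const (f := fun s => U s x) t t (by simpa using h)
  exact ((U t).restrictScalars ℝ).hasFDerivAt.comp_hasDerivAt t h2

/-- Joint continuity is what makes `s ↦ T s (V (T (-s) x))` continuous, where time and vector move
together. -/
lemma continuous_uncurry : Continuous fun p : ℝ × K => U p.1 p.2 := by
  rw [continuous_iff_continuousAt]
  rintro ⟨t, x⟩
  rw [ContinuousAt, tendsto_iff_norm_sub_tendsto_zero]
  have h1 : Filter.Tendsto (fun p : ℝ × K => ‖p.2 - x‖ + ‖U p.1 x - U t x‖) (nhds (t, x))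
      (nhds 0) := by
    have : Continuous fun p : ℝ × K => ‖p.2 - x‖ + ‖U p.1 x - U t x‖ :=
      (continuous_snd.sub continuous_const).norm.add
        (((hU.continuous x).comp continuous_fst).sub continuous_const).norm
    simpa using this.tendsto (t, x)
  refine squeeze_zero (fun _ => norm_nonneg _) (fun p => ?_) h1
  calc ‖U p.1 p.2 - U t x‖ = ‖U p.1 (p.2 - x) + (U p.1 x - U t x)‖ := by 
            rw [_root_.map_sub]; congr 1; abel
    _ ≤ _ := (norm_add_le _ _).trans_eq (by rw [hU.norm_apply])

end IsUnitaryGroup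

lemma IsUnitaryGroupOf.apply_mem_graph {A : K →ₗ.[ℂ] K} {U : ℝ → K →L[ℂ] K}
    (h : IsUnitaryGroupOf A U) {a b : K} (hab : (a, b) ∈ A.graph) (t : ℝ) :
    (U t a, U t b) ∈ A.graph := by
  rw [← h.generator] at hab ⊢
  have h1 := ((U t).restrictScalars ℝ).hasFDerivAt.comp_hasDerivAt 0 hab
  have h2 : (fun s => U s (U t a)) = (U t).restrictScalars ℝ ∘ fun s => U s a := by
    ext s
    change U s (U t a) = U t (U s a)
    rw [← mul_apply_eq_comp, ← mul_apply_eq_comp, ← h.map_add, ← h.map_add, add_comm]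
  rw [h2]
  simpa using h1

/-! ### Essential self-adjointness -/

/-- The closure is single-valued: a pair `(0, b)` in the adjoint graph has `b` orthogonal to the
dense domain. Moreover a graph and its closure have the same adjoint, as the defining relations are
closed conditions. -/
lemma isSelfAdjoint_toLinearPMap {G : Submodule ℂ (K × K)}
    (hG : Dense (G.map (LinearMap.fst ℂ K K) : Set K)) (h : G.topologicalClosure = G.adjoint) :
    IsSelfAdjoint G.topologicalClosure.toLinearPMap ∧
      G.topologicalClosure.toLinearPMap.graph = G.topologicalClosure := by
  have hgraph : G.topologicalClosure.toLinearPMap.graph = G.topologicalClosure := by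
    refine Submodule.toLinearPMap_graph_eq _ fun p hp hp0 => ?_
    rw [h, Submodule.mem_adjoint_iff] at hp
    refine hG.eq_zero_of_inner_right ℂ ?_
    rintro _ ⟨⟨a, b⟩, hab, rfl⟩
    simpa [hp0] using hp a b hab
  have hdense : Dense (G.topologicalClosure.toLinearPMap.domain : Set K) := by
    rw [Submodule.toLinearPMap_domain]
    exact hG.mono (Submodule.map_mono G.le_topologicalClosure)
  refine ⟨?_, hgraph⟩
  rw [LinearPMap.isSelfAdjoint_def]
  refine LinearPMap.eq_of_eq_graph ?_
  rw [LinearPMap.adjoint_graph_eq_graph_adjoint hdense, hgraph]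
  refine le_antisymm ?_ ?_
  · conv_rhs => rw [h]
    intro p hp
    rw [Submodule.mem_adjoint_iff] at hp ⊢
    exact fun a b hab => hp a b (G.le_topologicalClosure hab)
  · intro p hp
    rw [Submodule.mem_adjoint_iff]
    rw [h, Submodule.mem_adjoint_iff] at hp
    intro a b hab
    have hcl : IsClosed {q : K × K | ⟪q.2, p.1⟫_ℂ - ⟪q.1, p.2⟫_ℂ = 0} :=
      isClosed_eq (by fun_prop) continuous_const
    exact closure_minimal (fun q hq => hp q.1 q.2 hq) hcl hab

/-- The bounded perturbation `(a, b) ↦ (a, b + V a)` of graphs. -/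
def shear (V : K →L[ℂ] K) : (K × K) ≃L[ℂ] (K × K) :=
  ContinuousLinearEquiv.equivOfInverse
    ((ContinuousLinearMap.fst ℂ K K).prod
      (ContinuousLinearMap.snd ℂ K K + V.comp (ContinuousLinearMap.fst ℂ K K)))
    ((ContinuousLinearMap.fst ℂ K K).prod
      (ContinuousLinearMap.snd ℂ K K - V.comp (ContinuousLinearMap.fst ℂ K K)))
    (fun p => by simp) (fun p => by simp)

lemma shear_apply (V : K →L[ℂ] K) (p : K × K) : shear V p = (p.1, p.2 + V p.1) := rfl

/-- The shear is a homeomorphism, so it commutes with closure; by symmetry of `V` it carries the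
adjoint relation of `G` to that of the sheared graph. -/
lemma topologicalClosure_map_shear_eq_adjoint {G : Submodule ℂ (K × K)} {V : K →L[ℂ] K}
    (hV : IsSelfAdjoint V) (h : G.topologicalClosure = G.adjoint) :
    (G.map (shear V).toLinearMap).topologicalClosure = (G.map (shear V).toLinearMap).adjoint := by
  have hVs : ∀ x y, ⟪V x, y⟫_ℂ = ⟪x, V y⟫_ℂ :=
    (ContinuousLinearMap.isSelfAdjoint_iff_isSymmetric.1 hV)
  have h1 : ∀ p, p ∈ (G.map (shear V).toLinearMap).topologicalClosure
      ↔ (p.1, p.2 - V p.1) ∈ G.topologicalClosure := by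
    intro p
    have e : ((G.map (shear V).toLinearMap : Submodule ℂ (K × K)) : Set (K × K))
        = shear V '' (G : Set (K × K)) := rfl
    rw [← SetLike.mem_coe, Submodule.topologicalClosure_coe, e, ← ContinuousLinearEquiv.image_closure,
      ← SetLike.mem_coe, Submodule.topologicalClosure_coe]
    constructor
    · rintro ⟨q, hq, rfl⟩
      simpa [shear_apply] using hq
    · intro hp
      exact ⟨_, hp, by simp [shear_apply]⟩
  ext p
  rw [h1, h, Submodule.mem_adjoint_iff, Submodule.mem_adjoint_iff]
  constructor
  · rintro hp _ _ ⟨⟨a, b⟩, hab, he⟩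
    obtain ⟨rfl, rfl⟩ := Prod.ext_iff.1 he
    have := hp a b hab
    change ⟪b + V a, p.1⟫_ℂ - ⟪a, p.2⟫_ℂ = 0
    rw [inner_add_left, hVs]
    rw [inner_sub_right] at this
    linear_combination this
  · intro hp a b hab
    have := hp _ _ ⟨(a, b), hab, rfl⟩
    change ⟪b + V a, p.1⟫_ℂ - ⟪a, p.2⟫_ℂ = 0 at this
    rw [inner_add_left, hVs] at this
    rw [inner_sub_right]
    linear_combination this

/-- A symmetric graph which is invariant under a unitary group that it generates. -/
structure IsInvariantCore (G : Submodule ℂ (K × K)) (T : ℝ → K →L[ℂ] K) : Prop where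
  dense : Dense (G.map (LinearMap.fst ℂ K K) : Set K)
  apply_mem : ∀ p ∈ G, ∀ t, (T t p.1, T t p.2) ∈ G
  hasDerivAt : ∀ p ∈ G, HasDerivAt (fun t => T t p.1) (Complex.I • p.2) 0

namespace IsInvariantCore

variable {G : Submodule ℂ (K × K)} {T : ℝ → K →L[ℂ] K}

lemma inner_eq (h : IsInvariantCore G T) (hT : IsUnitaryGroup T) {p q : K × K} (hp : p ∈ G)
    (hq : q ∈ G) : ⟪p.2, q.1⟫_ℂ = ⟪p.1, q.2⟫_ℂ := by
  have h1 := (h.hasDerivAt p hp).inner ℂ (h.hasDerivAt q hq)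
  have h2 : (fun t => ⟪T t p.1, T t q.1⟫_ℂ) = fun _ => ⟪p.1, q.1⟫_ℂ := by
    ext t; exact ContinuousLinearMap.inner_map_map_of_mem_unitary (hT.unitary t) _ _
  rw [h2, hT.map_zero] at h1
  have h3 := h1.unique (hasDerivAt_const _ _)
  simp only [one_apply_eq_self, inner_smul_left, inner_smul_right, Complex.conj_I] at h3
  have h4 : Complex.I * (⟪p.2, q.1⟫_ℂ - ⟪p.1, q.2⟫_ℂ) = 0 := by linear_combination -h3
  exact sub_eq_zero.1 ((mul_eq_zero.1 h4).resolve_left Complex.I_ne_zero)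

/-- The deficiency spaces of an invariant core vanish. -/
lemma eq_zero_of_deficiency (h : IsInvariantCore G T) (hT : IsUnitaryGroup T) {μ : ℝ}
    (hμ : μ ^ 2 = 1) {w : K} (hw : ∀ p ∈ G, ⟪p.1, w⟫_ℂ + (Complex.I * μ) * ⟪p.2, w⟫_ℂ = 0) :
    w = 0 := by
  refine h.dense.eq_zero_of_inner_right ℂ ?_
  rintro _ ⟨p, hp, rfl⟩
  change ⟪p.1, w⟫_ℂ = 0
  have hμ' : (μ : ℂ) ^ 2 = 1 := by exact_mod_cast hμ
  -- By invariance of the core, `hw` holds along the whole orbit, so `f(t) = ⟪T t p.1, w⟫` solves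
  -- `f' = μ f`. An exponential that stays bounded in both time directions must vanish.
  have hf : ∀ t, HasDerivAt (fun t => ⟪T t p.1, w⟫_ℂ) (μ * ⟪T t p.1, w⟫_ℂ) t := by
    intro t
    have h1 := (hT.hasDerivAt (h.hasDerivAt p hp) t).inner ℂ (hasDerivAt_const t w)
    have h2 := hw _ (h.apply_mem p hp t)
    convert! h1 using 1
    simp only [map_smul, inner_zero_right, zero_add, inner_smul_left, Complex.conj_I]
    linear_combination μ * h2 - Complex.I * ⟪T t p.2, w⟫_ℂ * hμ'
  have hg : ∀ t : ℝ, HasDerivAt (fun t : ℝ => Complex.exp (-(μ * t : ℝ)) * ⟪T t p.1, w⟫_ℂ) 0 t := by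
    intro t
    have h1 : HasDerivAt (fun t : ℝ => Complex.exp (-(μ * t : ℝ)))
        (Complex.exp (-(μ * t : ℝ)) * -μ) t := by
      have h0 : HasDerivAt (fun t : ℝ => (-(μ * t : ℝ) : ℂ)) (-μ : ℂ) t := by
        have := ((hasDerivAt_id t).const_mul μ).neg.ofReal_comp
        simpa using this
      exact h0.cexp
    convert! h1.mul (hf t) using 1
    ring
  have hconst : ∀ t : ℝ, Complex.exp (-(μ * t : ℝ)) * ⟪T t p.1, w⟫_ℂ = ⟪p.1, w⟫_ℂ := by
    intro t
    have := is_const_of_deriv_eq_zero (fun t => (hg t).differentiableAt) (fun t => (hg t).deriv) t 0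
    simpa [hT.map_zero] using this
  have hbound : ∀ s : ℝ, ‖⟪p.1, w⟫_ℂ‖ ≤ Real.exp (-s) * (‖p.1‖ * ‖w‖) := by
    intro s
    -- At time `μ s` the prefactor is `exp(-μ² s) = exp(-s)`, whichever sign `μ` has.
    rw [← hconst (μ * s), norm_mul]
    gcongr
    · rw [Complex.norm_exp]
      apply le_of_eq
      congr 1
      rw [Complex.neg_re, Complex.ofReal_re]
      linear_combination -s * hμ
    · exact (norm_inner_le_norm _ _).trans_eq (by rw [hT.norm_apply])
  have hlim : Filter.Tendsto (fun s : ℝ => Real.exp (-s) * (‖p.1‖ * ‖w‖)) Filter.atTop (nhds 0) := by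
    simpa using Real.tendsto_exp_neg_atTop_nhds_zero.mul_const (‖p.1‖ * ‖w‖)
  exact norm_le_zero_iff.1 (ge_of_tendsto' hlim hbound)

/-- An invariant core is essentially self-adjoint. -/
lemma topologicalClosure_eq_adjoint (h : IsInvariantCore G T) (hT : IsUnitaryGroup T) :
    G.topologicalClosure = G.adjoint := by
  have hle : G.topologicalClosure ≤ G.adjoint := by
    intro q hq
    rw [Submodule.mem_adjoint_iff]
    intro a b hab
    have hcl : IsClosed {q : K × K | ⟪b, q.1⟫_ℂ - ⟪a, q.2⟫_ℂ = 0} :=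
      isClosed_eq (by fun_prop) continuous_const
    exact closure_minimal (fun q hq => sub_eq_zero.2 (h.inner_eq hT hab hq)) hcl hq
  -- The product carries the sup norm; the `ℓ²` norm makes it a Hilbert space, in which it suffices
  -- that nothing in the adjoint graph is orthogonal to the closure.
  let e := WithLp.prodContinuousLinearEquiv 2 ℂ K K
  let M : Submodule ℂ (WithLp 2 (K × K)) := G.topologicalClosure.comap e.toLinearMap
  let N : Submodule ℂ (WithLp 2 (K × K)) := G.adjoint.comap e.toLinearMap
  have hM : IsClosed (M : Set (WithLp 2 (K × K))) :=
    G.isClosed_topologicalClosure.preimage e.continuous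
  have : CompleteSpace M := hM.isComplete.completeSpace_coe
  have hMN : M ≤ N := Submodule.comap_mono hle
  have hinf : Mᗮ ⊓ N = ⊥ := by
    rw [eq_bot_iff]
    rintro q ⟨hq1, hq2⟩
    have h1 : ∀ p ∈ G, ⟪p.1, q.fst⟫_ℂ + ⟪p.2, q.snd⟫_ℂ = 0 := fun p hp =>
      (Submodule.mem_orthogonal _ _).1 hq1 (WithLp.toLp 2 p) (G.le_topologicalClosure hp)
    have h2 : ∀ p ∈ G, ⟪p.2, q.fst⟫_ℂ - ⟪p.1, q.snd⟫_ℂ = 0 := fun p hp =>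
      (Submodule.mem_adjoint_iff _ _).1 hq2 _ _ hp
    -- Orthogonality and the adjoint relation combine to put `q.fst ∓ i q.snd` in the two deficiency
    -- spaces; both vanish, hence so does `q`.
    have key : ∀ μ : ℝ, μ ^ 2 = 1 → q.fst - (Complex.I * μ) • q.snd = 0 := by
      intro μ hμ
      have hμ' : (μ : ℂ) ^ 2 = 1 := by exact_mod_cast hμ
      refine h.eq_zero_of_deficiency hT hμ fun p hp => ?_
      rw [inner_sub_right, inner_sub_right, inner_smul_right, inner_smul_right]
      linear_combination h1 p hp + Complex.I * μ * h2 p hp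
        - ⟪p.2, q.snd⟫_ℂ * (μ ^ 2 * Complex.I_sq - hμ')
    have k1 := key 1 (by norm_num)
    have k2 := key (-1) (by norm_num)
    have hfst : q.fst = 0 := by
      have : (2 : ℂ) • q.fst = 0 := by
        have := congrArg₂ (· + ·) k1 k2
        simp only [add_zero] at this
        rw [← this]; push_cast; module
      simpa using this
    have hsnd : q.snd = 0 := by simpa [hfst] using k1
    exact WithLp.ofLp_injective 2 (Prod.ext hfst hsnd)
  have hNM : M = N := by
    have := Submodule.sup_orthogonal_inf_of_hasOrthogonalProjection hMN
    rwa [hinf, sup_bot_eq] at this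
  refine le_antisymm hle fun p hp => ?_
  have : WithLp.toLp 2 p ∈ M := by rw [hNM]; exact hp
  exact this

end IsInvariantCore

end UnitaryGroups

/-! ### Duhamel expansion of the interaction picture propagator in operator norm. -/

section Duhamel

variable {K : Type*} [NormedAddCommGroup K] [InnerProductSpace ℂ K] [CompleteSpace K]

lemma IsUnitaryGroup.continuous_conj {T : ℝ → K →L[ℂ] K} (hT : IsUnitaryGroup T) (V : K →L[ℂ] K)
    (x : K) : Continuous fun s => T s (V (T (-s) x)) :=
  hT.continuous_uncurry.comp
    (continuous_id.prodMk (V.continuous.comp ((hT.continuous x).comp continuous_neg)))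

/-- `L` is the strong integral `∫₀^ε T s V T(-s) ds`. -/
def IsStrongIntegral (T : ℝ → K →L[ℂ] K) (V : K →L[ℂ] K) (ε : ℝ) (L : K →L[ℂ] K) : Prop :=
  ∀ x, L x = ∫ s in (0 : ℝ)..ε, T s (V (T (-s) x))

lemma IsUnitaryGroup.norm_integral_conj_le {T : ℝ → K →L[ℂ] K} (hT : IsUnitaryGroup T)
    (V : K →L[ℂ] K) (ε : ℝ) (x : K) :
    ‖∫ s in (0 : ℝ)..ε, T s (V (T (-s) x))‖ ≤ |ε| * ‖V‖ * ‖x‖ := by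
  have := intervalIntegral.norm_integral_le_of_norm_le_const (a := 0) (b := ε)
    (f := fun s => T s (V (T (-s) x))) (C := ‖V‖ * ‖x‖) fun s _ => by
      rw [hT.norm_apply]
      exact (V.le_opNorm _).trans_eq (by rw [hT.norm_apply])
  rw [sub_zero] at this
  linarith

/-- The integrand is only strongly continuous, so the integral is formed vector by vector. -/
lemma IsUnitaryGroup.exists_isStrongIntegral {T : ℝ → K →L[ℂ] K} (hT : IsUnitaryGroup T)
    (V : K →L[ℂ] K) (ε : ℝ) : ∃ L, IsStrongIntegral T V ε L := by
  refine ⟨LinearMap.mkContinuous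
    { toFun := fun x => ∫ s in (0 : ℝ)..ε, T s (V (T (-s) x))
      map_add' := fun x y => ?_
      map_smul' := fun c x => ?_ } (|ε| * ‖V‖) (hT.norm_integral_conj_le V ε), fun x => rfl⟩
  · simp only [_root_.map_add]
    exact intervalIntegral.integral_add ((hT.continuous_conj V x).intervalIntegrable _ _)
      ((hT.continuous_conj V y).intervalIntegrable _ _)
  · simp only [_root_.map_smul, RingHom.id_apply]
    exact intervalIntegral.integral_smul c _

lemma IsStrongIntegral.norm_le {T : ℝ → K →L[ℂ] K} (hT : IsUnitaryGroup T) {V L : K →L[ℂ] K}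
    {ε : ℝ} (h : IsStrongIntegral T V ε L) : ‖L‖ ≤ |ε| * ‖V‖ :=
  L.opNorm_le_bound (by positivity) fun x => by rw [h]; exact hT.norm_integral_conj_le V ε x

lemma IsStrongIntegral.sum {T : ℝ → K →L[ℂ] K} (hT : IsUnitaryGroup T) {ι : Type*}
    {s : Finset ι} {V L : ι → K →L[ℂ] K} {ε : ℝ}
    (h : ∀ i ∈ s, IsStrongIntegral T (V i) ε (L i)) :
    IsStrongIntegral T (∑ i ∈ s, V i) ε (∑ i ∈ s, L i) := by
  intro x
  simp only [sum_apply, map_sum]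
  rw [intervalIntegral.integral_finsetSum
    fun i _ => (hT.continuous_conj (V i) x).intervalIntegrable _ _]
  exact Finset.sum_congr rfl fun i hi => h i hi x

lemma IsStrongIntegral.inner_right {T : ℝ → K →L[ℂ] K} (hT : IsUnitaryGroup T)
    {V L : K →L[ℂ] K} {ε : ℝ} (h : IsStrongIntegral T V ε L) (x y : K) :
    ⟪x, L y⟫_ℂ = ∫ s in (0 : ℝ)..ε, ⟪x, T s (V (T (-s) y))⟫_ℂ := by
  rw [h]
  exact ((innerSL ℂ x).intervalIntegral_comp_comm
    ((hT.continuous_conj V y).intervalIntegrable _ _)).symm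

lemma IsStrongIntegral.isSelfAdjoint {T : ℝ → K →L[ℂ] K} (hT : IsUnitaryGroup T)
    {V L : K →L[ℂ] K} {ε : ℝ} (h : IsStrongIntegral T V ε L) (hV : IsSelfAdjoint V) :
    IsSelfAdjoint L := by
  have hVs : ∀ x y, ⟪V x, y⟫_ℂ = ⟪x, V y⟫_ℂ :=
    (ContinuousLinearMap.isSelfAdjoint_iff_isSymmetric.1 hV)
  rw [ContinuousLinearMap.isSelfAdjoint_iff_isSymmetric]
  intro x y
  change ⟪L x, y⟫_ℂ = ⟪x, L y⟫_ℂ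
  rw [← inner_conj_symm, h.inner_right hT, h.inner_right hT, ← Complex.conjCLE_apply,
    ← ContinuousLinearEquiv.coe_coe, ← Complex.conjCLE.toContinuousLinearMap.intervalIntegral_comp_comm
    ((continuous_const.inner (hT.continuous_conj V x)).intervalIntegrable _ _)]
  refine intervalIntegral.integral_congr fun s _ => ?_
  have h1 := hT.inner_neg_left (-s) (V (T (-s) x)) y
  rw [neg_neg] at h1
  simp only [ContinuousLinearEquiv.coe_coe, Complex.conjCLE_apply, inner_conj_symm]
  rw [h1, hVs, hT.inner_neg_left]

lemma IsStrongIntegral.commute {T : ℝ → K →L[ℂ] K} (hT : IsUnitaryGroup T)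
    {V L : K →L[ℂ] K} {ε : ℝ} (h : IsStrongIntegral T V ε L) {A : K →L[ℂ] K}
    (hA : ∀ s, Commute A (T s * V * T (-s))) : Commute A L := by
  ext x
  rw [mul_apply_eq_comp, mul_apply_eq_comp, h, h, ← A.intervalIntegral_comp_comm
    ((hT.continuous_conj V x).intervalIntegrable _ _)]
  exact intervalIntegral.integral_congr fun s _ => congrArg (fun B : K →L[ℂ] K => B x) (hA s)

lemma norm_le_of_dense_inner {D : Set K} (hD : Dense D) {x : K} {c : ℝ} (hc : 0 ≤ c)
    (h : ∀ y ∈ D, ‖⟪y, x⟫_ℂ‖ ≤ c * ‖y‖) : ‖x‖ ≤ c := by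
  have h' : ∀ y, ‖⟪y, x⟫_ℂ‖ ≤ c * ‖y‖ := fun y =>
    closure_minimal (s := D) (t := {y | ‖⟪y, x⟫_ℂ‖ ≤ c * ‖y‖}) h
      (isClosed_le (by fun_prop) (by fun_prop)) (hD y)
  have hx := h' x
  rw [inner_self_eq_norm_sq_to_K] at hx
  rcases eq_or_ne x 0 with rfl | hx0
  · simpa using hc
  · have hpos := norm_pos_iff.2 hx0
    rw [norm_pow] at hx
    simp only [Complex.coe_algebraMap, Complex.norm_real, norm_norm] at hx
    nlinarith

/-- This lets operator norm bounds be checked on matrix elements between core and domain vectors,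
where the propagators are differentiable. -/
lemma opNorm_le_of_dense_inner {D D' : Set K} (hD : Dense D) (hD' : Dense D') {S : K →L[ℂ] K}
    {c : ℝ} (hc : 0 ≤ c) (h : ∀ x ∈ D, ∀ y ∈ D', ‖⟪y, S x⟫_ℂ‖ ≤ c * ‖x‖ * ‖y‖) : ‖S‖ ≤ c := by
  refine S.opNorm_le_bound hc fun x => ?_
  exact closure_minimal (s := D) (t := {x | ‖S x‖ ≤ c * ‖x‖})
    (fun x hx => norm_le_of_dense_inner hD' (by positivity) (h x hx))
    (isClosed_le (by fun_prop) (by fun_prop)) (hD x)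

variable {A : K →ₗ.[ℂ] K} {W T : ℝ → K →L[ℂ] K} {G : Submodule ℂ (K × K)} {V : K →L[ℂ] K}

/-- With one group on each side of the inner product, both vectors stay in the domains of their
generators. Symmetry of `A` cancels the unbounded parts, and only the bounded `V` is left. -/
lemma hasDerivAt_inner_interaction (hA : IsSelfAdjoint A) (hW : IsUnitaryGroupOf A W)
    (hT : IsUnitaryGroup T) (hG : IsInvariantCore G T)
    (hGA : ∀ p ∈ G, (p.1, p.2 + V p.1) ∈ A.graph) {p q : K × K} (hp : p ∈ G) (hq : q ∈ A.graph)
    (s : ℝ) :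
    HasDerivAt (fun s => ⟪W (-s) q.1, T (-s) p.1⟫_ℂ)
      (Complex.I * ⟪W (-s) q.1, V (T (-s) p.1)⟫_ℂ) s := by
  have h1 := (hW.isUnitaryGroup.hasDerivAt ((hW.generator _ _).2 hq) (-s)).scomp s
    (hasDerivAt_neg s)
  have h2 := (hT.hasDerivAt (hG.hasDerivAt p hp) (-s)).scomp s (hasDerivAt_neg s)
  have h3 := inner_eq_of_mem_graph hA (hW.apply_mem_graph hq (-s))
    (hGA _ (hG.apply_mem p hp (-s)))
  convert! h1.inner ℂ h2 using 1
  simp only [map_smul, neg_smul, one_smul, inner_neg_left, inner_neg_right, inner_smul_left,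
    inner_smul_right, Complex.conj_I, Function.comp_apply]
  rw [inner_add_right] at h3
  linear_combination -Complex.I * h3

/-- First order Duhamel bound for the interaction picture propagator. -/
lemma norm_mul_neg_sub_one_le (hA : IsSelfAdjoint A) (hW : IsUnitaryGroupOf A W)
    (hT : IsUnitaryGroup T) (hG : IsInvariantCore G T)
    (hGA : ∀ p ∈ G, (p.1, p.2 + V p.1) ∈ A.graph) (ε : ℝ) :
    ‖W ε * T (-ε) - 1‖ ≤ |ε| * ‖V‖ := by
  have hW' := hW.isUnitaryGroup
  refine opNorm_le_of_dense_inner hG.dense hA.dense_domain (by positivity) ?_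
  rintro _ ⟨p, hp, rfl⟩ y hy
  change ‖⟪y, W ε (T (-ε) p.1) - p.1⟫_ℂ‖ ≤ |ε| * ‖V‖ * ‖p.1‖ * ‖y‖
  have h := Convex.norm_image_sub_le_of_norm_hasDerivWithin_le (𝕜 := ℝ) (s := Set.univ)
    (C := ‖V‖ * ‖p.1‖ * ‖y‖) (x := 0) (y := ε)
    (fun s _ => (hasDerivAt_inner_interaction hA hW hT hG hGA hp
      (A.mem_graph ⟨y, hy⟩) s).hasDerivWithinAt)
    (fun s _ => by
      rw [norm_mul, Complex.norm_I, one_mul]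
      refine (norm_inner_le_norm _ _).trans ?_
      rw [hW'.norm_apply]
      have := V.le_opNorm (T (-s) p.1)
      rw [hT.norm_apply] at this
      rw [mul_comm]
      gcongr)
    convex_univ (Set.mem_univ _) (Set.mem_univ _)
  rw [inner_sub_right, ← hW'.inner_neg_left]
  simp only [neg_zero, hW'.map_zero, hT.map_zero, one_apply_eq_self, sub_zero,
    Real.norm_eq_abs] at h
  linarith

/-- Second order Duhamel bound for the interaction picture propagator. -/
lemma norm_mul_neg_sub_one_sub_le (hA : IsSelfAdjoint A) (hW : IsUnitaryGroupOf A W)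
    (hT : IsUnitaryGroup T) (hG : IsInvariantCore G T)
    (hGA : ∀ p ∈ G, (p.1, p.2 + V p.1) ∈ A.graph) {ε : ℝ} {L : K →L[ℂ] K}
    (hL : IsStrongIntegral T V ε L) :
    ‖W ε * T (-ε) - 1 - Complex.I • L‖ ≤ ε ^ 2 * ‖V‖ ^ 2 := by
  have hW' := hW.isUnitaryGroup
  refine opNorm_le_of_dense_inner hG.dense hA.dense_domain (by positivity) ?_
  rintro _ ⟨p, hp, rfl⟩ y hy
  change ‖⟪y, W ε (T (-ε) p.1) - p.1 - Complex.I • L p.1⟫_ℂ‖ ≤ ε ^ 2 * ‖V‖ ^ 2 * ‖p.1‖ * ‖y‖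
  have hcont : Continuous fun s => ⟪y, T s (V (T (-s) p.1))⟫_ℂ :=
    continuous_const.inner (hT.continuous_conj V p.1)
  have h := Convex.norm_image_sub_le_of_norm_hasDerivWithin_le (𝕜 := ℝ)
    (s := Metric.closedBall 0 |ε|)
    (C := |ε| * ‖V‖ ^ 2 * ‖p.1‖ * ‖y‖) (x := 0) (y := ε)
    (fun s _ => ((hasDerivAt_inner_interaction hA hW hT hG hGA hp
      (A.mem_graph ⟨y, hy⟩) s).sub
        ((hcont.integral_hasStrictDerivAt 0 s).hasDerivAt.const_mul Complex.I)).hasDerivWithinAt)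
    (fun s hs => by
      have hs' : |s| ≤ |ε| := by simpa using hs
      rw [← mul_sub, norm_mul, Complex.norm_I, one_mul, hW'.inner_neg_left, ← inner_sub_right]
      -- The derivative of the remainder contains `W s T(-s) - 1`, already of size `|s| ‖V‖`;
      -- integrating over a length `|ε|` produces `ε²`.
      have e : W s (V (T (-s) p.1)) - T s (V (T (-s) p.1))
          = (W s * T (-s) - 1) (T s (V (T (-s) p.1))) := by
        simp [mul_apply_eq_comp, hT.neg_apply_self]
      rw [e]
      refine (norm_inner_le_norm _ _).trans ?_
      have h1 := (W s * T (-s) - 1).le_opNorm (T s (V (T (-s) p.1)))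
      have h2 := norm_mul_neg_sub_one_le hA hW hT hG hGA s
      have h3 := V.le_opNorm (T (-s) p.1)
      rw [hT.norm_apply] at h1 h3
      calc ‖y‖ * ‖(W s * T (-s) - 1) (T s (V (T (-s) p.1)))‖
          ≤ ‖y‖ * (|ε| * ‖V‖ * (‖V‖ * ‖p.1‖)) := by
            gcongr
            refine h1.trans ?_
            gcongr
            exact h2.trans (by gcongr)
        _ = _ := by ring)
    (convex_closedBall _ _) (by simp) (by simp)
  rw [inner_sub_right, inner_sub_right, ← hW'.inner_neg_left, inner_smul_right, hL.inner_right hT]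
  simp only [Pi.sub_apply, neg_zero, hW'.map_zero, hT.map_zero, one_apply_eq_self, sub_zero,
    Real.norm_eq_abs, intervalIntegral.integral_same, mul_zero] at h
  rw [sub_right_comm]
  refine h.trans (le_of_eq ?_)
  rw [← sq_abs ε]
  ring

end Duhamel

/-! ### Operators on Hilbert space tensor products -/

namespace HilbertTensor

variable {ι : Type*} [Fintype ι] {E : ι → Type*} [∀ i, NormedAddCommGroup (E i)]
  [∀ i, InnerProductSpace ℂ (E i)]

lemma norm_tprod (a : ∀ i, E i) : ‖tprod E a‖ = ∏ i, ‖a i‖ := by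
  have h : ‖tprod E a‖ ^ 2 = (∏ i, ‖a i‖) ^ 2 := by
    have := inner_tprod a a
    simp only [inner_self_eq_norm_sq_to_K] at this
    rw [← Finset.prod_pow]
    exact_mod_cast this
  exact (sq_eq_sq₀ (norm_nonneg _) (Finset.prod_nonneg fun _ _ => norm_nonneg _)).1 h

variable (E) in
/-- The pure tensor as a continuous multilinear map. -/
def tprodL : ContinuousMultilinearMap ℂ E (HilbertTensor E) :=
  ((UniformSpace.Completion.toComplL (𝕜 := ℂ) (E := AlgTensor E)).toLinearMap.compMultilinearMap
    (AlgTensor.tprod E)).mkContinuous 1 fun a => by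
      rw [one_mul]; exact (norm_tprod a).le

lemma clm_ext {V : Type*} [NormedAddCommGroup V] [NormedSpace ℂ V]
    {f g : HilbertTensor E →L[ℂ] V} (h : ∀ a, f (tprod E a) = g (tprod E a)) : f = g :=
  ContinuousLinearMap.ext_on dense_span_tprod (by rintro _ ⟨a, rfl⟩; exact h a)

lemma isSelfAdjoint_of_inner_tprod {S : HilbertTensor E →L[ℂ] HilbertTensor E}
    (h : ∀ a b, ⟪S (tprod E a), tprod E b⟫_ℂ = ⟪tprod E a, S (tprod E b)⟫_ℂ) :
    IsSelfAdjoint S := by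
  rw [IsSelfAdjoint, ContinuousLinearMap.star_eq_adjoint]
  refine clm_ext fun a => ?_
  have h1 : innerSL ℂ (ContinuousLinearMap.adjoint S (tprod E a)) = innerSL ℂ (S (tprod E a)) :=
    clm_ext fun b => by
      rw [innerSL_apply_apply, innerSL_apply_apply, ContinuousLinearMap.adjoint_inner_left, h]
  exact ext_inner_right ℂ fun v => by
    rw [← innerSL_apply_apply ℂ, h1, innerSL_apply_apply]

section TensorMap

/-- The tensor product `⨂ᵢ Uᵢ` of isometries. -/
def tensorMap (U : ∀ i, E i →L[ℂ] E i) : HilbertTensor E →L[ℂ] HilbertTensor E :=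
  (Finsupp.linearCombination ℂ fun a : ∀ i, E i => tprod E fun i => U i (a i)).extendOfNorm
    (Finsupp.linearCombination ℂ fun a : ∀ i, E i => tprod E a)

lemma denseRange_linearCombination_tprod :
    DenseRange (Finsupp.linearCombination ℂ fun a : ∀ i, E i => tprod E a) := by
  have := dense_span_tprod (E := E)
  rw [← Finsupp.range_linearCombination] at this
  exact this

variable {U : ∀ i, E i →L[ℂ] E i} (hU : ∀ i x, ‖U i x‖ = ‖x‖)
include hU

/-- Isometries preserve the Gram matrix of a family of pure tensors, and the Gram matrix determines
the norms of all combinations. -/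
lemma norm_linearCombination_tprod_map (c : (∀ i, E i) →₀ ℂ) :
    ‖Finsupp.linearCombination ℂ (fun a : ∀ i, E i => tprod E fun i => U i (a i)) c‖
      = ‖Finsupp.linearCombination ℂ (fun a : ∀ i, E i => tprod E a) c‖ := by
  have hin : ∀ i x y, ⟪U i x, U i y⟫_ℂ = ⟪x, y⟫_ℂ := fun i x y =>
    LinearIsometry.inner_map_map ⟨(U i).toLinearMap, hU i⟩ x y
  rw [@norm_eq_sqrt_re_inner ℂ, @norm_eq_sqrt_re_inner ℂ _ _ _ _
    (Finsupp.linearCombination ℂ (fun a : ∀ i, E i => tprod E a) c)]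
  simp only [Finsupp.linearCombination_apply, Finsupp.sum, sum_inner,
    inner_sum, inner_smul_left, inner_smul_right, inner_tprod, hin]

lemma tensorMap_linearCombination (c : (∀ i, E i) →₀ ℂ) :
    tensorMap U (Finsupp.linearCombination ℂ (fun a : ∀ i, E i => tprod E a) c)
      = Finsupp.linearCombination ℂ (fun a : ∀ i, E i => tprod E fun i => U i (a i)) c :=
  LinearMap.extendOfNorm_eq denseRange_linearCombination_tprod
    ⟨1, fun c => by rw [norm_linearCombination_tprod_map hU, one_mul]⟩ c

lemma tensorMap_tprod (a : ∀ i, E i) : tensorMap U (tprod E a) = tprod E fun i => U i (a i) := by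
  simpa using tensorMap_linearCombination hU (Finsupp.single a 1)

lemma norm_tensorMap (x : HilbertTensor E) : ‖tensorMap U x‖ = ‖x‖ := by
  refine denseRange_linearCombination_tprod.induction_on x
    (isClosed_eq (by fun_prop) (by fun_prop)) fun c => ?_
  rw [tensorMap_linearCombination hU, norm_linearCombination_tprod_map hU]

end TensorMap

section TensorGroup

variable [∀ i, CompleteSpace (E i)] {U : ∀ i, ℝ → E i →L[ℂ] E i} (hU : ∀ i, IsUnitaryGroup (U i))
include hU

lemma isUnitaryGroup_tensorMap : IsUnitaryGroup fun t => tensorMap fun i => U i t := by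
  have hn : ∀ t i x, ‖U i t x‖ = ‖x‖ := fun t i x => (hU i).norm_apply t x
  have hadd : ∀ s t, tensorMap (fun i => U i (s + t))
      = tensorMap (fun i => U i s) * tensorMap fun i => U i t := by
    intro s t
    refine clm_ext fun a => ?_
    rw [mul_apply_eq_comp, tensorMap_tprod (hn _), tensorMap_tprod (hn _), tensorMap_tprod (hn _)]
    simp only [(hU _).map_add, mul_apply_eq_comp]
  have hzero : tensorMap (fun i => U i 0) = 1 := by
    refine clm_ext fun a => ?_
    rw [tensorMap_tprod (hn _)]
    simp only [(hU _).map_zero, one_apply_eq_self]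
  refine ⟨fun t => mem_unitary_of_norm_map (norm_tensorMap (hn t))
    (V := tensorMap fun i => U i (-t)) ?_, hadd, ?_⟩
  · rw [← hadd, add_neg_cancel, hzero]
  · refine continuous_apply_of_dense (fun t => norm_tensorMap (hn t)) dense_span_tprod fun x hx => ?_
    induction hx using Submodule.span_induction with
    | mem x hx =>
      obtain ⟨a, rfl⟩ := hx
      simp only [tensorMap_tprod (hn _)]
      exact (tprodL E).cont.comp (continuous_pi fun i => (hU i).continuous (a i))
    | zero => simpa using continuous_const
    | add x y _ _ hx hy => simp only [_root_.map_add]; exact hx.add hy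
    | smul c x _ hx => simp only [_root_.map_smul]; exact hx.const_smul c

end TensorGroup

variable (E) in
/-- The graph of `∑ᵢ hᵢ` on the algebraic tensor product of the domains. -/
def freeGraph [DecidableEq ι] (h : ∀ i, E i →ₗ.[ℂ] E i) :
    Submodule ℂ (HilbertTensor E × HilbertTensor E) :=
  Submodule.span ℂ <| Set.range fun ψ : ∀ i, (h i).domain =>
    (tprod E fun i => (ψ i : E i),
      ∑ i, tprod E (Function.update (fun j => (ψ j : E j)) i (h i (ψ i))))

/-- Each `U i t` preserves the domain of `h i` and commutes with `h i` there, which gives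
invariance; the derivative is the product rule for the multilinear map `tprodL`; density holds
because a product of dense domains is dense and `tprodL` is continuous. -/
lemma isInvariantCore_freeGraph [DecidableEq ι] [∀ i, CompleteSpace (E i)]
    {h : ∀ i, E i →ₗ.[ℂ] E i} (hh : ∀ i, IsSelfAdjoint (h i)) {U : ∀ i, ℝ → E i →L[ℂ] E i}
    (hU : ∀ i, IsUnitaryGroupOf (h i) (U i)) :
    IsInvariantCore (freeGraph E h) fun t => tensorMap fun i => U i t := by
  have hn : ∀ t i x, ‖U i t x‖ = ‖x‖ := fun t i x => (hU i).isUnitaryGroup.norm_apply t x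
  refine ⟨?_, fun p hp t => ?_, fun p hp => ?_⟩
  · have h1 : Set.range (tprod E) ⊆ closure ((freeGraph E h).map (LinearMap.fst ℂ _ _) : Set _) := by
      rintro _ ⟨a, rfl⟩
      have ha : a ∈ closure (Set.univ.pi fun i => ((h i).domain : Set (E i))) := by
        rw [closure_pi_set]
        exact fun i _ => (hh i).dense_domain (a i)
      refine map_mem_closure (tprodL E).cont ha fun ψ hψ => ?_
      exact ⟨_, Submodule.subset_span ⟨fun i => ⟨ψ i, hψ i (Set.mem_univ i)⟩, rfl⟩, rfl⟩
    have h2 : Submodule.span ℂ (Set.range (tprod E)) ≤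
        ((freeGraph E h).map (LinearMap.fst ℂ _ _)).topologicalClosure := Submodule.span_le.2 h1
    exact dense_closure.1 (dense_span_tprod.mono h2)
  · induction hp using Submodule.span_induction with
    | zero =>
      simp only [Prod.fst_zero, Prod.snd_zero, _root_.map_zero]
      exact zero_mem _
    | add p q _ _ hp hq =>
      simp only [Prod.fst_add, Prod.snd_add, _root_.map_add]
      exact add_mem hp hq
    | smul c p _ hp =>
      simp only [Prod.smul_fst, Prod.smul_snd, _root_.map_smul]
      exact Submodule.smul_mem _ c hp
    | mem p hp =>
      obtain ⟨ψ, rfl⟩ := hp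
      have hmem : ∀ i, (U i t (ψ i), U i t (h i (ψ i))) ∈ (h i).graph := fun i =>
        (hU i).apply_mem_graph ((h i).mem_graph (ψ i)) t
      choose χ hχ1 hχ2 using fun i => (LinearPMap.mem_graph_iff _).1 (hmem i)
      refine Submodule.subset_span ⟨χ, Prod.ext ?_ ?_⟩
      · simp only [tensorMap_tprod (hn t), hχ1]
      · simp only [map_sum, tensorMap_tprod (hn t)]
        refine Finset.sum_congr rfl fun i _ => congrArg (tprod E) (funext fun j => ?_)
        rcases eq_or_ne j i with rfl | hij
        · simp [hχ2]
        · simp [Function.update_of_ne hij, hχ1]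
  · induction hp using Submodule.span_induction with
    | zero => simpa using hasDerivAt_const (0 : ℝ) (0 : HilbertTensor E)
    | add p q _ _ hp hq =>
      simp only [Prod.fst_add, Prod.snd_add, _root_.map_add, smul_add]
      exact hp.add hq
    | smul c p _ hp =>
      have := hp.const_smul c
      rw [smul_comm] at this
      simp only [Prod.smul_fst, Prod.smul_snd, _root_.map_smul]
      exact this
    | mem p hp =>
      obtain ⟨ψ, rfl⟩ := hp
      simp only [tensorMap_tprod (hn _)]
      have h1 : HasDerivAt (fun t i => U i t (ψ i)) (fun i => Complex.I • h i (ψ i)) 0 :=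
        hasDerivAt_pi.2 fun i => ((hU i).generator _ _).2 ((h i).mem_graph (ψ i))
      have h2 := (((tprodL E).hasFDerivAt (fun i => U i 0 (ψ i))).restrictScalars ℝ).comp_hasDerivAt
        0 h1
      simp only [ContinuousLinearMap.coe_restrictScalars',
        ContinuousMultilinearMap.linearDeriv_apply, (hU _).isUnitaryGroup.map_zero,
        one_apply_eq_self, ContinuousMultilinearMap.map_update_smul] at h2
      rw [Finset.smul_sum]
      exact h2

end HilbertTensor

/-! ### Ampliations -/

section Ampliate

variable {Γ : Type*} {H : Γ → Type*} [∀ x, NormedAddCommGroup (H x)]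
  [∀ x, InnerProductSpace ℂ (H x)]

/-- The pure tensor over `X` of the restriction of `a`. -/
def localTensor {Λ : Finset Γ} (X : Finset Γ) (h : X ⊆ Λ) (a : ∀ x : Λ, H x) : LocalSpace H X :=
  HilbertTensor.tprod (fun x : X => H x) fun x => a ⟨x, h x.2⟩

variable [DecidableEq Γ] {X Y Λ : Finset Γ}

variable (H Λ) in
/-- The map `(ξ, η) ↦ join (ξ ⊗ η)` as a continuous map in `ξ`. -/
def joinLeft (X : Finset Γ) (η : LocalSpace H (Λ \ X)) : LocalSpace H X →L[ℂ] LocalSpace H Λ :=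
  (join X Λ).comp ⟨(TensorProduct.mk ℂ _ _).flip η,
    TensorProduct.continuous_tmul.comp (continuous_id.prodMk continuous_const)⟩

variable (Λ) in
/-- The map `(ξ, η) ↦ join (ξ ⊗ η)` as a continuous map in `η`. -/
def joinRight (ξ : LocalSpace H X) : LocalSpace H (Λ \ X) →L[ℂ] LocalSpace H Λ :=
  (join X Λ).comp ⟨TensorProduct.mk ℂ _ _ ξ,
    TensorProduct.continuous_tmul.comp (continuous_const.prodMk continuous_id)⟩

lemma join_localTensor (h : X ⊆ Λ) (a : ∀ x : Λ, H x) :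
    join X Λ (localTensor X h a ⊗ₜ localTensor (Λ \ X) Finset.sdiff_subset a)
      = HilbertTensor.tprod (fun x : Λ => H x) a := by
  rw [localTensor, localTensor, join_tmul h]
  refine congrArg _ (funext fun x => ?_)
  by_cases hx : (x : Γ) ∈ X <;> simp [glue, hx]

lemma inner_join (h : X ⊆ Λ) (ξ ξ' : LocalSpace H X) (η η' : LocalSpace H (Λ \ X)) :
    ⟪join X Λ (ξ ⊗ₜ η), join X Λ (ξ' ⊗ₜ η')⟫_ℂ = ⟪ξ, ξ'⟫_ℂ * ⟪η, η'⟫_ℂ := by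
  rw [← TensorProduct.inner_tmul]
  exact LinearIsometry.inner_map_map ⟨(join X Λ).toLinearMap, norm_join h⟩ _ _

lemma ampliate_tprod (h : X ⊆ Λ) (A : LocalAlgebra H X) (a : ∀ x : Λ, H x) :
    ampliate Λ A (HilbertTensor.tprod _ a)
      = join X Λ (A (localTensor X h a) ⊗ₜ localTensor (Λ \ X) Finset.sdiff_subset a) := by
  rw [← join_localTensor h, ampliate_join h]

lemma norm_ampliate_le (h : X ⊆ Λ) (A : LocalAlgebra H X) : ‖ampliate Λ A‖ ≤ ‖A‖ := by
  refine ContinuousLinearMap.opNorm_le_bound _ (norm_nonneg _) fun z => ?_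
  refine (denseRange_join (H := H) h).induction_on z
    (isClosed_le (by fun_prop) (by fun_prop)) fun u => ?_
  have e : ampliate Λ A (join X Λ u) = join X Λ (A.rTensor _ u) := by
    induction u using TensorProduct.induction_on with
    | zero => simp
    | add u v hu hv => rw [map_add, map_add, hu, hv, map_add, map_add]
    | tmul ξ η => exact ampliate_join h A ξ η
  rw [e, norm_join h, norm_join h]
  exact (ContinuousLinearMap.le_opNorm _ _).trans (mul_le_mul_of_nonneg_right
    (ContinuousLinearMap.norm_rTensor_le (LocalSpace H (Λ \ X)) A) (norm_nonneg _))

lemma isSelfAdjoint_ampliate (h : X ⊆ Λ) {A : LocalAlgebra H X} (hA : IsSelfAdjoint A) :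
    IsSelfAdjoint (ampliate Λ A) := by
  refine HilbertTensor.isSelfAdjoint_of_inner_tprod fun a b => ?_
  rw [ampliate_tprod h, ampliate_tprod h]
  nth_rw 1 [← join_localTensor h b]
  nth_rw 1 [← join_localTensor h a]
  rw [inner_join h, inner_join h]
  congr 1
  exact ContinuousLinearMap.isSelfAdjoint_iff_isSymmetric.1 hA _ _

section Disjoint

/-- On pure tensors both sides glue the same three families, and density extends this to `ζ` and
then to `ξ`. It allows either of the factors over `X` and `Y` to be brought to the front, where an
ampliated operator acts on it. -/
lemma join_join_comm (hX : X ⊆ Λ) (hY : Y ⊆ Λ) (hXY : Disjoint X Y) (a : ∀ x : Λ, H x)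
    (ξ : LocalSpace H X) (ζ : LocalSpace H Y) :
    join X Λ (ξ ⊗ₜ join Y (Λ \ X) (ζ ⊗ₜ localTensor ((Λ \ X) \ Y)
        (Finset.sdiff_subset.trans Finset.sdiff_subset) a))
      = join Y Λ (ζ ⊗ₜ join X (Λ \ Y) (ξ ⊗ₜ localTensor ((Λ \ Y) \ X)
        (Finset.sdiff_subset.trans Finset.sdiff_subset) a)) := by
  have hY' : Y ⊆ Λ \ X := Finset.subset_sdiff.2 ⟨hY, hXY.symm⟩
  have hX' : X ⊆ Λ \ Y := Finset.subset_sdiff.2 ⟨hX, hXY⟩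
  have h1 : ∀ (b : ∀ x : X, H x) (c : ∀ x : Y, H x),
      join X Λ (HilbertTensor.tprod _ b ⊗ₜ join Y (Λ \ X) (HilbertTensor.tprod _ c ⊗ₜ
        localTensor ((Λ \ X) \ Y) (Finset.sdiff_subset.trans Finset.sdiff_subset) a))
      = join Y Λ (HilbertTensor.tprod _ c ⊗ₜ join X (Λ \ Y) (HilbertTensor.tprod _ b ⊗ₜ
        localTensor ((Λ \ Y) \ X) (Finset.sdiff_subset.trans Finset.sdiff_subset) a)) := by
    intro b c
    rw [localTensor, localTensor, join_tmul hY', join_tmul hX', join_tmul hX, join_tmul hY]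
    refine congrArg _ (funext fun x => ?_)
    by_cases hx : (x : Γ) ∈ X
    · have hy : (x : Γ) ∉ Y := Finset.disjoint_left.1 hXY hx
      simp [glue, hx, hy]
    · by_cases hy : (x : Γ) ∈ Y <;> simp [glue, hx, hy]
  have h2 : ∀ (b : ∀ x : X, H x), ∀ ζ : LocalSpace H Y, _ := fun b ζ =>
    congrArg (fun f : LocalSpace H Y →L[ℂ] LocalSpace H Λ => f ζ) <|
      HilbertTensor.clm_ext (f := (joinRight Λ (HilbertTensor.tprod _ b)).comp
        (joinLeft H (Λ \ X) Y (localTensor ((Λ \ X) \ Y)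
          (Finset.sdiff_subset.trans Finset.sdiff_subset) a)))
        (g := joinLeft H Λ Y (join X (Λ \ Y) (HilbertTensor.tprod _ b ⊗ₜ
          localTensor ((Λ \ Y) \ X) (Finset.sdiff_subset.trans Finset.sdiff_subset) a))) (h1 b)
  exact congrArg (fun f : LocalSpace H X →L[ℂ] LocalSpace H Λ => f ξ) <|
    HilbertTensor.clm_ext (f := joinLeft H Λ X (join Y (Λ \ X) (ζ ⊗ₜ
        localTensor ((Λ \ X) \ Y) (Finset.sdiff_subset.trans Finset.sdiff_subset) a)))
      (g := (joinRight Λ ζ).comp (joinLeft H (Λ \ Y) X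
        (localTensor ((Λ \ Y) \ X) (Finset.sdiff_subset.trans Finset.sdiff_subset) a)))
      fun b => h2 b ζ

lemma tprod_eq_join_join (hX : X ⊆ Λ) (hY : Y ⊆ Λ) (hXY : Disjoint X Y) (a : ∀ x : Λ, H x) :
    HilbertTensor.tprod (fun x : Λ => H x) a
      = join X Λ (localTensor X hX a ⊗ₜ join Y (Λ \ X) (localTensor Y hY a ⊗ₜ
        localTensor ((Λ \ X) \ Y) (Finset.sdiff_subset.trans Finset.sdiff_subset) a)) := by
  have hY' : Y ⊆ Λ \ X := Finset.subset_sdiff.2 ⟨hY, hXY.symm⟩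
  rw [← join_localTensor hX a]
  congr 2
  exact (join_localTensor hY' fun x : (Λ \ X : Finset Γ) => a ⟨x, Finset.sdiff_subset x.2⟩).symm

lemma commute_ampliate (hX : X ⊆ Λ) (hY : Y ⊆ Λ) (hXY : Disjoint X Y) (A : LocalAlgebra H X)
    (B : LocalAlgebra H Y) : Commute (ampliate Λ A) (ampliate Λ B) := by
  refine HilbertTensor.clm_ext fun a => ?_
  rw [mul_apply_eq_comp, mul_apply_eq_comp, tprod_eq_join_join hX hY hXY, ampliate_join hX,
    join_join_comm hX hY hXY, join_join_comm hX hY hXY, ampliate_join hY, ampliate_join hY,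
    ← join_join_comm hX hY hXY, ← join_join_comm hX hY hXY, ampliate_join hX]

end Disjoint

section Dynamics

variable [∀ x, CompleteSpace (H x)] {U : ∀ x, ℝ → H x →L[ℂ] H x}
  (hU : ∀ x, IsUnitaryGroup (U x))

/-- The free dynamics `⨂_{x ∈ Λ} U x t`. -/
def freeGroup (U : ∀ x, ℝ → H x →L[ℂ] H x) (Λ : Finset Γ) (t : ℝ) : LocalAlgebra H Λ :=
  HilbertTensor.tensorMap fun x : Λ => U x t

include hU

lemma isUnitaryGroup_freeGroup (Λ : Finset Γ) : IsUnitaryGroup (freeGroup U Λ) :=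
  HilbertTensor.isUnitaryGroup_tensorMap fun x : Λ => hU x

lemma freeGroup_tprod (t : ℝ) (a : ∀ x : Λ, H x) :
    freeGroup U Λ t (HilbertTensor.tprod _ a) = HilbertTensor.tprod _ fun x : Λ => U x t (a x) :=
  HilbertTensor.tensorMap_tprod (fun (x : Λ) _ => (hU x).norm_apply t _) a

lemma freeGroup_join (h : X ⊆ Λ) (t : ℝ) (ξ : LocalSpace H X) (η : LocalSpace H (Λ \ X)) :
    freeGroup U Λ t (join X Λ (ξ ⊗ₜ η))
      = join X Λ (freeGroup U X t ξ ⊗ₜ freeGroup U (Λ \ X) t η) := by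
  have h1 : ∀ (a : ∀ x : X, H x) (b : ∀ x : (Λ \ X : Finset Γ), H x),
      freeGroup U Λ t (join X Λ (HilbertTensor.tprod _ a ⊗ₜ HilbertTensor.tprod _ b))
      = join X Λ (freeGroup U X t (HilbertTensor.tprod _ a) ⊗ₜ
          freeGroup U (Λ \ X) t (HilbertTensor.tprod _ b)) := by
    intro a b
    rw [freeGroup_tprod hU, freeGroup_tprod hU, join_tmul h, join_tmul h, freeGroup_tprod hU]
    refine congrArg _ (funext fun x => ?_)
    by_cases hx : (x : Γ) ∈ X <;> simp [glue, hx]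
  have h2 : ∀ (a : ∀ x : X, H x) η, _ := fun a η =>
    congrArg (fun f : LocalSpace H (Λ \ X) →L[ℂ] LocalSpace H Λ => f η) <|
      HilbertTensor.clm_ext (f := (freeGroup U Λ t).comp (joinRight Λ (HilbertTensor.tprod _ a)))
        (g := (joinRight Λ (freeGroup U X t (HilbertTensor.tprod _ a))).comp
          (freeGroup U (Λ \ X) t)) (h1 a)
  exact congrArg (fun f : LocalSpace H X →L[ℂ] LocalSpace H Λ => f ξ) <|
    HilbertTensor.clm_ext (f := (freeGroup U Λ t).comp (joinLeft H Λ X η))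
      (g := (joinLeft H Λ X (freeGroup U (Λ \ X) t η)).comp (freeGroup U X t)) fun a => h2 a η

/-- The free group factorizes over `X` and `Λ \ X`, and the outer factor cancels: free evolution
keeps an observable on its support. -/
lemma freeGroup_conj_ampliate (h : X ⊆ Λ) (t : ℝ) (A : LocalAlgebra H X) :
    freeGroup U Λ t * ampliate Λ A * freeGroup U Λ (-t)
      = ampliate Λ (freeGroup U X t * A * freeGroup U X (-t)) := by
  refine HilbertTensor.clm_ext fun a => ?_
  rw [← join_localTensor h a, ampliate_join h, mul_apply_eq_comp, mul_apply_eq_comp,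
    freeGroup_join hU h, ampliate_join h, freeGroup_join hU h,
    (isUnitaryGroup_freeGroup hU _).apply_neg_self]
  rfl

end Dynamics

end Ampliate

/-! ### One step of the recursion -/

section Step

variable {𝒜 : Type*} [NormedRing 𝒜] [StarRing 𝒜] [CStarRing 𝒜] [NormedAlgebra ℂ 𝒜]
  [StarModule ℂ 𝒜]

lemma norm_one_le_one : ‖(1 : 𝒜)‖ ≤ 1 := by
  cases subsingleton_or_nontrivial 𝒜
  · simp [Subsingleton.elim (1 : 𝒜) 0]
  · exact CStarRing.norm_one.le

lemma star_one_add_I_smul {S : 𝒜} (hS : IsSelfAdjoint S) :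
    star (1 + Complex.I • S) = 1 - Complex.I • S := by
  simp [star_smul, hS.star_eq, sub_eq_add_neg]

/-- The first order terms cancel in `(1 - iS)(1 + iS) = 1 + S²`, so `1 + iS` can replace a unitary
up to second order. -/
lemma norm_one_add_I_smul_sq_le {S : 𝒜} (hS : IsSelfAdjoint S) :
    ‖1 + Complex.I • S‖ ^ 2 ≤ 1 + ‖S‖ ^ 2 := by
  rw [sq, ← CStarRing.norm_star_mul_self, star_one_add_I_smul hS]
  have e : (1 - Complex.I • S) * (1 + Complex.I • S) = 1 + S * S := by
    simp only [sub_mul, mul_add, one_mul, mul_one, smul_mul_assoc, mul_smul_comm, smul_sub,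
      smul_smul, Complex.I_mul_I]
    module
  rw [e, sq]
  exact (norm_add_le _ _).trans (add_le_add norm_one_le_one (norm_mul_le _ _))

lemma norm_commutator_le (A B : 𝒜) : ‖A * B - B * A‖ ≤ 2 * ‖B‖ * ‖A‖ := by
  calc ‖A * B - B * A‖ ≤ ‖A‖ * ‖B‖ + ‖B‖ * ‖A‖ :=
        (norm_sub_le _ _).trans (add_le_add (norm_mul_le _ _) (norm_mul_le _ _))
    _ = _ := by ring

lemma norm_three_mul_le (A B C : 𝒜) : ‖A * B * C‖ ≤ ‖A‖ * ‖B‖ * ‖C‖ :=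
  (norm_mul_le _ _).trans (mul_le_mul_of_nonneg_right (norm_mul_le _ _) (norm_nonneg _))

variable {S I O Q A B : 𝒜} {δ γ : ℝ}

/-- The product of three approximate unitaries approximates `1 + i (S + I + O)`. -/
lemma norm_sub_product_le (hS : ‖S‖ ≤ δ) (hI : ‖I‖ ≤ δ) (hO : ‖O‖ ≤ δ) (hδ0 : 0 ≤ δ)
    (hδ : δ ≤ 1) (hQ : ‖Q - 1 - Complex.I • (S + I + O)‖ ≤ δ ^ 2) :
    ‖Q - (1 + Complex.I • S) * (1 + Complex.I • I) * (1 + Complex.I • O)‖ ≤ 5 * δ ^ 2 := by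
  have e : Q - (1 + Complex.I • S) * (1 + Complex.I • I) * (1 + Complex.I • O)
      = (Q - 1 - Complex.I • (S + I + O)) + S * I + S * O + I * O
        + Complex.I • (S * I * O) := by
    simp only [mul_add, add_mul, one_mul, mul_one, smul_mul_assoc, mul_smul_comm, smul_smul,
      Complex.I_mul_I, smul_add]
    module
  have h2 : ∀ {X Y : 𝒜}, ‖X‖ ≤ δ → ‖Y‖ ≤ δ → ‖X * Y‖ ≤ δ ^ 2 := fun hX hY =>
    (norm_mul_le _ _).trans (by rw [sq]; gcongr)
  have h3 : ‖Complex.I • (S * I * O)‖ ≤ δ ^ 2 := by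
    rw [norm_smul, Complex.norm_I, one_mul]
    calc ‖S * I * O‖ ≤ δ ^ 2 * 1 := (norm_mul_le _ _).trans
          (mul_le_mul (h2 hS hI) (hO.trans hδ) (norm_nonneg _) (by positivity))
      _ = δ ^ 2 := mul_one _
  rw [e]
  calc _ ≤ δ ^ 2 + δ ^ 2 + δ ^ 2 + δ ^ 2 + δ ^ 2 :=
        (norm_add_le _ _).trans (add_le_add ((norm_add_le _ _).trans (add_le_add
          ((norm_add_le _ _).trans (add_le_add ((norm_add_le _ _).trans (add_le_add hQ
            (h2 hS hI))) (h2 hS hO))) (h2 hI hO))) h3)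
    _ = _ := by ring

lemma norm_one_add_I_smul_le (hS : IsSelfAdjoint S) (hSδ : ‖S‖ ≤ δ) :
    ‖1 + Complex.I • S‖ ^ 2 ≤ 1 + δ ^ 2 :=
  (norm_one_add_I_smul_sq_le hS).trans (by gcongr)

/-- If `O` commutes with `A`, then conjugation by an approximation `Q` of `1 + i (S + I + O)` is,
to second order, conjugation by `1 + i I` followed by conjugation by `1 + i S`. -/
lemma norm_conj_sub_conj_le (hSa : IsSelfAdjoint S) (hIa : IsSelfAdjoint I)
    (hOa : IsSelfAdjoint O) (hS : ‖S‖ ≤ δ) (hI : ‖I‖ ≤ δ) (hO : ‖O‖ ≤ δ) (hδ0 : 0 ≤ δ)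
    (hδ : δ ≤ 1) (hQ1 : ‖Q‖ ≤ 1) (hQ : ‖Q - 1 - Complex.I • (S + I + O)‖ ≤ δ ^ 2)
    (hOA : Commute O A) :
    ‖Q * A * star Q - (1 + Complex.I • S) * ((1 + Complex.I • I) * A * star (1 + Complex.I • I))
      * star (1 + Complex.I • S)‖ ≤ 61 * δ ^ 2 * ‖A‖ := by
  have hp := norm_one_add_I_smul_le hSa hS
  have hu := norm_one_add_I_smul_le hIa hI
  have ho := norm_one_add_I_smul_le hOa hO
  have hP := norm_sub_product_le hS hI hO hδ0 hδ hQ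
  -- As `O` commutes with `A`, the outer factor changes `A` only by the second order term `A O²`.
  have hoA : (1 + Complex.I • O) * A * star (1 + Complex.I • O) = A + A * (O * O) := by
    rw [star_one_add_I_smul hOa]
    have h1 : (1 + Complex.I • O) * A = A * (1 + Complex.I • O) := by
      rw [add_mul, mul_add, smul_mul_assoc, mul_smul_comm, hOA.eq, one_mul, mul_one]
    rw [h1, mul_assoc]
    simp only [add_mul, mul_add, mul_sub, one_mul, mul_one, smul_mul_assoc, mul_smul_comm,
      smul_add, smul_smul, Complex.I_mul_I]
    module
  set p := 1 + Complex.I • S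
  set u := 1 + Complex.I • I
  set o := 1 + Complex.I • O
  have two : ∀ {x : 𝒜}, ‖x‖ ^ 2 ≤ 1 + δ ^ 2 → ‖x‖ ≤ 2 := fun {x} hx => by
    nlinarith [norm_nonneg x]
  have hp2 := two hp
  have hu2 := two hu
  have ho2 := two ho
  have e : Q * A * star Q - p * (u * A * star u) * star p
      = (Q - p * u * o) * A * star Q + (p * u * o) * A * star (Q - p * u * o)
        + p * u * (A * (O * O)) * (star u * star p) := by
    have : A * (O * O) = o * A * star o - A := by rw [hoA]; abel
    rw [this]
    simp only [star_sub, star_mul]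
    noncomm_ring
  have hpu : ‖p * u‖ ≤ 4 := (norm_mul_le _ _).trans (by nlinarith [norm_nonneg p, norm_nonneg u])
  have hpus : ‖star u * star p‖ ≤ 4 := by rw [← star_mul, norm_star]; exact hpu
  have hpuo : ‖p * u * o‖ ≤ 8 := (norm_mul_le _ _).trans
    (by nlinarith [norm_nonneg o, norm_nonneg (p * u)])
  have hOO : ‖O * O‖ ≤ δ ^ 2 := (norm_mul_le _ _).trans (by rw [sq]; gcongr)
  rw [e]
  -- The constant is `61 = 5 + 8·5 + 4·4`; each approximate unitary is bounded crudely by `2`.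
  calc _ ≤ 5 * δ ^ 2 * ‖A‖ * 1 + 8 * ‖A‖ * (5 * δ ^ 2) + 4 * (‖A‖ * δ ^ 2) * 4 := by
        refine (norm_add_le _ _).trans (add_le_add ((norm_add_le _ _).trans (add_le_add
          ((norm_three_mul_le _ _ _).trans ?_) ((norm_three_mul_le _ _ _).trans ?_)))
          ((norm_three_mul_le _ _ _).trans ?_))
        · rw [norm_star]; gcongr
        · rw [norm_star]; gcongr
        · gcongr
          exact (norm_mul_le _ _).trans (by gcongr)
    _ = _ := by ring

/-- One step of the Lieb-Robinson recursion. -/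
lemma norm_commutator_step_le (hSa : IsSelfAdjoint S) (hIa : IsSelfAdjoint I)
    (hOa : IsSelfAdjoint O) (hS : ‖S‖ ≤ δ) (hI : ‖I‖ ≤ δ) (hO : ‖O‖ ≤ δ) (hδ0 : 0 ≤ δ)
    (hδ : δ ≤ 1) (hQ1 : ‖Q‖ ≤ 1) (hQ : ‖Q - 1 - Complex.I • (S + I + O)‖ ≤ δ ^ 2)
    (hOA : Commute O A)
    (hγ : ‖(1 + Complex.I • I) * A * star (1 + Complex.I • I) * B
        - B * ((1 + Complex.I • I) * A * star (1 + Complex.I • I))‖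
      ≤ γ * ‖(1 + Complex.I • I) * A * star (1 + Complex.I • I)‖) (hγ0 : 0 ≤ γ) :
    ‖Q * A * star Q * B - B * (Q * A * star Q)‖
      ≤ (γ + 2 * ‖S * B - B * S‖ + 140 * ‖B‖ * δ ^ 2) * ‖A‖ := by
  have hp := norm_one_add_I_smul_le hSa hS
  have hu := norm_one_add_I_smul_le hIa hI
  have hQA := norm_conj_sub_conj_le hSa hIa hOa hS hI hO hδ0 hδ hQ1 hQ hOA
  have hpB : (1 + Complex.I • S) * B - B * (1 + Complex.I • S)
      = Complex.I • (S * B - B * S) := by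
    simp only [add_mul, mul_add, one_mul, mul_one, smul_mul_assoc, mul_smul_comm]; module
  have hpB' : star (1 + Complex.I • S) * B - B * star (1 + Complex.I • S)
      = -(Complex.I • (S * B - B * S)) := by
    rw [star_one_add_I_smul hSa]
    simp only [sub_mul, mul_sub, one_mul, mul_one, smul_mul_assoc, mul_smul_comm]; module
  set p := 1 + Complex.I • S
  set u := 1 + Complex.I • I
  set a := u * A * star u with ha
  set n := ‖S * B - B * S‖ with hn
  have hδ2 : δ ^ 2 ≤ 1 := by nlinarith
  have hn0 : 0 ≤ n := norm_nonneg _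
  have hnδ : n ≤ 2 * ‖B‖ * δ := (norm_commutator_le S B).trans (by gcongr)
  have hp1 : ‖p‖ ≤ 1 + δ ^ 2 := by nlinarith [norm_nonneg p, sq_nonneg δ]
  have haA : ‖a‖ ≤ (1 + δ ^ 2) * ‖A‖ := by
    refine (norm_three_mul_le _ _ _).trans ?_
    rw [norm_star]
    calc ‖u‖ * ‖A‖ * ‖u‖ = ‖u‖ ^ 2 * ‖A‖ := by ring
      _ ≤ _ := by gcongr
  -- Leibniz rule for `[p a p*, B]`, plus the error of replacing `Q A Q*`. The middle term is
  -- controlled by `γ`, and each of the two commutators with `p` contributes one `‖[S, B]‖`.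
  have e : Q * A * star Q * B - B * (Q * A * star Q)
      = ((Q * A * star Q - p * a * star p) * B - B * (Q * A * star Q - p * a * star p))
        + p * (a * B - B * a) * star p
        + p * a * (star p * B - B * star p) + (p * B - B * p) * a * star p := by
    noncomm_ring
  have t1 : ‖(Q * A * star Q - p * a * star p) * B - B * (Q * A * star Q - p * a * star p)‖
      ≤ 2 * ‖B‖ * (61 * δ ^ 2 * ‖A‖) := (norm_commutator_le _ _).trans (by gcongr)
  have t2 : ‖p * (a * B - B * a) * star p‖ ≤ (γ + 6 * ‖B‖ * δ ^ 2) * ‖A‖ := by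
    -- Capping `γ` by the trivial constant `2 ‖B‖` keeps `γ` out of the second order error, whose
    -- coefficient can then be fixed for the whole recursion.
    have m1 : ‖a * B - B * a‖ ≤ (1 + δ ^ 2) * (min γ (2 * ‖B‖) * ‖A‖) := by
      rcases min_choice γ (2 * ‖B‖) with h | h
      · rw [h]
        refine hγ.trans ?_
        calc γ * ‖a‖ ≤ γ * ((1 + δ ^ 2) * ‖A‖) := by gcongr
          _ = _ := by ring
      · rw [h]
        refine (norm_commutator_le a B).trans ?_
        calc 2 * ‖B‖ * ‖a‖ ≤ 2 * ‖B‖ * ((1 + δ ^ 2) * ‖A‖) := by gcongr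
          _ = _ := by ring
    have m0 : 0 ≤ min γ (2 * ‖B‖) := le_min hγ0 (by positivity)
    calc ‖p * (a * B - B * a) * star p‖ ≤ ‖p‖ * ‖a * B - B * a‖ * ‖star p‖ :=
          norm_three_mul_le _ _ _
      _ = ‖p‖ ^ 2 * ‖a * B - B * a‖ := by rw [norm_star]; ring
      _ ≤ (1 + δ ^ 2) * ((1 + δ ^ 2) * (min γ (2 * ‖B‖) * ‖A‖)) := by gcongr
      _ = (min γ (2 * ‖B‖) + (2 * δ ^ 2 + δ ^ 2 * δ ^ 2) * min γ (2 * ‖B‖)) * ‖A‖ := by ring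
      _ ≤ (γ + (2 * δ ^ 2 + δ ^ 2 * 1) * (2 * ‖B‖)) * ‖A‖ := by
          gcongr
          · exact min_le_left _ _
          · exact min_le_right _ _
      _ = _ := by ring
  have m2 : ‖p‖ * ‖a‖ * n ≤ (n + 6 * ‖B‖ * δ ^ 2) * ‖A‖ := by
    calc ‖p‖ * ‖a‖ * n ≤ (1 + δ ^ 2) * ((1 + δ ^ 2) * ‖A‖) * n := by gcongr
      _ = (n + (2 * δ ^ 2 + δ ^ 2 * δ ^ 2) * n) * ‖A‖ := by ring
      _ ≤ (n + (2 * δ ^ 2 + δ ^ 2 * 1) * (2 * ‖B‖ * 1)) * ‖A‖ := by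
          gcongr
          exact hnδ.trans (by gcongr)
      _ = _ := by ring
  have t3 : ‖p * a * (star p * B - B * star p)‖ ≤ (n + 6 * ‖B‖ * δ ^ 2) * ‖A‖ := by
    refine (norm_three_mul_le _ _ _).trans ?_
    rw [hpB', norm_neg, norm_smul, Complex.norm_I, one_mul]
    exact m2
  have t4 : ‖(p * B - B * p) * a * star p‖ ≤ (n + 6 * ‖B‖ * δ ^ 2) * ‖A‖ := by
    refine (norm_three_mul_le _ _ _).trans ?_
    rw [hpB, norm_smul, Complex.norm_I, one_mul, norm_star]
    refine le_trans (le_of_eq ?_) m2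
    ring
  rw [e]
  -- The constant is `140 = 2·61 + 3·6`.
  calc _ ≤ 2 * ‖B‖ * (61 * δ ^ 2 * ‖A‖) + (γ + 6 * ‖B‖ * δ ^ 2) * ‖A‖
        + (n + 6 * ‖B‖ * δ ^ 2) * ‖A‖ + (n + 6 * ‖B‖ * δ ^ 2) * ‖A‖ :=
        (norm_add_le _ _).trans (add_le_add ((norm_add_le _ _).trans (add_le_add
          ((norm_add_le _ _).trans (add_le_add t1 t2)) t3)) t4)
    _ = _ := by ring

end Step

/-! ### Iterating the recursion -/

section Iterate

variable {ι : Type*} {P : ℝ → (ι → ℝ) → Prop} {G : ι → ℝ → ℝ} {w : ι → ι → ℝ}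
  {s : Finset ι} {M k ε₀ : ℝ}

/-- A recursive bound with second order errors is dominated by every supersolution. -/
lemma bound_of_recursion (hw : ∀ i, ∑ j ∈ s, w i j ≤ M) (hM : 0 ≤ M) (hk : 0 ≤ k) (hε₀ : 0 < ε₀)
    (hmono : ∀ t γ γ', (∀ i, γ i ≤ γ' i) → P t γ → P t γ')
    (hstep : ∀ t ε γ, 0 ≤ t → 0 ≤ ε → ε ≤ ε₀ → (∀ i, 0 ≤ γ i) → P t γ →
      P (t + ε) fun i => γ i + ε * ∑ j ∈ s, w i j * γ j + k * ε ^ 2)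
    (hG0 : ∀ i t, 0 ≤ t → 0 ≤ G i t)
    (hG : ∀ i t ε, 0 ≤ t → 0 ≤ ε → G i t + ε * ∑ j ∈ s, w i j * G j t ≤ G i (t + ε))
    (h0 : P 0 fun i => G i 0) {t : ℝ} (ht : 0 ≤ t) :
    ∃ N : ℕ, ∀ n : ℕ, N ≤ n → P t fun i => G i t + k * t ^ 2 * Real.exp (M * t) / (n + 1) := by
  obtain ⟨N, hN⟩ := exists_nat_ge (t / ε₀)
  refine ⟨N, fun n hn => ?_⟩
  set ε := t / (n + 1) with hε
  have hn1 : (0 : ℝ) < n + 1 := by positivity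
  have hε0 : 0 ≤ ε := by positivity
  have hεle : ε ≤ ε₀ := by
    rw [div_le_iff₀ hε₀] at hN
    have : (N : ℝ) ≤ n := by exact_mod_cast hn
    rw [hε, div_le_iff₀ hn1]
    nlinarith
  have hr : 1 ≤ 1 + ε * M := by nlinarith
  -- Each step adds an error `k ε²` and amplifies the earlier ones by at most `1 + ε M`. After `n +
  -- 1` steps of length `t/(n+1)` the total is `O(1/n)`.
  have key : ∀ m : ℕ, P (m * ε) fun i => G i (m * ε) + m * (k * ε ^ 2) * (1 + ε * M) ^ m := by
    intro m
    induction m with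
    | zero => simpa using h0
    | succ m ih =>
      have hm : 0 ≤ m * ε := by positivity
      have he : 0 ≤ m * (k * ε ^ 2) * (1 + ε * M) ^ m := by positivity
      have h1 := hstep (m * ε) ε _ hm hε0 hεle (fun i => add_nonneg (hG0 i _ hm) he) ih
      have e1 : m * ε + ε = (m + 1 : ℕ) * ε := by push_cast; ring
      rw [e1] at h1
      refine hmono _ _ _ (fun i => ?_) h1
      have h2 := hG i (m * ε) ε hm hε0
      rw [e1] at h2
      have h3 : (1 : ℝ) ≤ (1 + ε * M) ^ (m + 1) := one_le_pow₀ hr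
      have h4 := hw i
      set R := m * (k * ε ^ 2) * (1 + ε * M) ^ m with hR
      have h5 : ∑ j ∈ s, w i j * (G j (m * ε) + R)
          = ∑ j ∈ s, w i j * G j (m * ε) + (∑ j ∈ s, w i j) * R := by
        rw [Finset.sum_mul, ← Finset.sum_add_distrib]
        exact Finset.sum_congr rfl fun j _ => by ring
      rw [h5]
      have h6 : ε * ((∑ j ∈ s, w i j) * R) ≤ ε * (M * R) := by gcongr
      have h7 : ((m + 1 : ℕ) : ℝ) * (k * ε ^ 2) * (1 + ε * M) ^ (m + 1)
          = R + ε * (M * R) + k * ε ^ 2 * (1 + ε * M) ^ (m + 1) := by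
        rw [hR, pow_succ]; push_cast; ring
      have h8 : k * ε ^ 2 ≤ k * ε ^ 2 * (1 + ε * M) ^ (m + 1) :=
        le_mul_of_one_le_right (by positivity) h3
      rw [h7]
      linarith
  have h1 := key (n + 1)
  have e1 : ((n + 1 : ℕ) : ℝ) * ε = t := by rw [hε]; push_cast; field_simp
  rw [e1] at h1
  refine hmono _ _ _ (fun i => ?_) h1
  have h2 : (1 + ε * M) ^ (n + 1) ≤ Real.exp (M * t) := by
    calc (1 + ε * M) ^ (n + 1) ≤ Real.exp (ε * M) ^ (n + 1) := by
          gcongr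
          rw [add_comm]; exact Real.add_one_le_exp _
      _ = Real.exp (M * t) := by
          rw [← Real.exp_nat_mul]
          congr 1
          rw [← e1]; ring
  have e2 : ((n + 1 : ℕ) : ℝ) * (k * ε ^ 2) = k * t ^ 2 / (n + 1) := by
    rw [hε]; push_cast; field_simp
  rw [e2]
  have h3 : k * t ^ 2 / (n + 1) * (1 + ε * M) ^ (n + 1)
      ≤ k * t ^ 2 / (n + 1) * Real.exp (M * t) := by gcongr
  calc _ ≤ G i t + k * t ^ 2 / (n + 1) * Real.exp (M * t) := by gcongr
    _ = _ := by ring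

end Iterate

/-! ### Geometry of the boundary sums -/

section BoundarySums

variable {Γ : Type*} [Fintype Γ] [DecidableEq Γ] [MetricSpace Γ] {H : Γ → Type*}
  [∀ x, NormedAddCommGroup (H x)] [∀ x, InnerProductSpace ℂ (H x)]
  {F : NNReal → ℝ} {Φ : ∀ X : Finset Γ, LocalAlgebra H X} {N C : ℝ}

lemma sum_le_of_interactionNorm_le [Nonempty Γ] (hF0 : ∀ r, 0 < F r) (x y : Γ) :
    ∑ Z : Finset Γ with x ∈ Z ∧ y ∈ Z, ‖Φ Z‖ ≤ interactionNorm F Φ * F (nndist x y) := by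
  rw [← div_le_iff₀ (hF0 _), Finset.sum_div]
  exact le_ciSup (f := fun p : Γ × Γ =>
    ∑ X : Finset Γ with p.1 ∈ X ∧ p.2 ∈ X, ‖Φ X‖ / F (nndist p.1 p.2))
    (Set.finite_range _).bddAbove (x, y)

lemma interactionNorm_nonneg (hF0 : ∀ r, 0 < F r) : 0 ≤ interactionNorm F Φ :=
  Real.iSup_nonneg fun _ => Finset.sum_nonneg fun _ _ => div_nonneg (norm_nonneg _) (hF0 _).le

lemma convConstAt_eq (hF0 : ∀ r, 0 < F r) (x y : Γ) :
    convConstAt F x y = (∑ z, F (nndist x z) * F (nndist z y)) / F (nndist x y) := by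
  rw [convConstAt]
  have : {c : ℝ | ∑ z, F (nndist x z) * F (nndist z y) ≤ c * F (nndist x y)}
      = Set.Ici ((∑ z, F (nndist x z) * F (nndist z y)) / F (nndist x y)) := by
    ext c; exact (div_le_iff₀ (hF0 _)).symm
  rw [this, csInf_Ici]

lemma convConstAt_le_convConst (x y : Γ) : convConstAt F x y ≤ convConst Γ F :=
  le_ciSup (f := fun p : Γ × Γ => convConstAt F p.1 p.2) (Set.finite_range _).bddAbove (x, y)

lemma sum_mul_le_convConst (hF0 : ∀ r, 0 < F r) (x y : Γ) :
    ∑ z, F (nndist x z) * F (nndist z y) ≤ convConst Γ F * F (nndist x y) := by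
  rw [← div_le_iff₀ (hF0 _), ← convConstAt_eq hF0]
  exact convConstAt_le_convConst x y

lemma convConst_pos [Nonempty Γ] (hF0 : ∀ r, 0 < F r) : 0 < convConst Γ F := by
  obtain ⟨x⟩ := ‹Nonempty Γ›
  refine lt_of_lt_of_le ?_ (convConstAt_le_convConst x x)
  rw [convConstAt_eq hF0]
  exact div_pos (Finset.sum_pos (fun z _ => mul_pos (hF0 _) (hF0 _)) ⟨x, Finset.mem_univ x⟩) (hF0 _)

variable (F Φ) in
/-- `∑_{x ∈ ∂X} ∑_{y ∈ Y} F(d(x,y))`. -/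
def leftBoundarySum (X Y : Finset Γ) : ℝ := ∑ x ∈ boundary Φ X, ∑ y ∈ Y, F (nndist x y)

lemma leftBoundarySum_nonneg (hF0 : ∀ r, 0 < F r) (X Y : Finset Γ) :
    0 ≤ leftBoundarySum F Φ X Y :=
  Finset.sum_nonneg fun _ _ => Finset.sum_nonneg fun _ _ => (hF0 _).le

lemma mem_boundary_iff {X : Finset Γ} {x : Γ} :
    x ∈ boundary Φ X ↔ x ∈ X ∧ ∃ Z ∈ surface X, x ∈ Z ∧ Φ Z ≠ 0 := by
  simp only [boundary, Finset.mem_filter]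

lemma exists_mem_boundary {X Z : Finset Γ} (hZ : Z ∈ surface X) (hΦ : Φ Z ≠ 0) :
    ∃ x ∈ boundary Φ X, x ∈ Z := by
  obtain ⟨x, hx⟩ := (Finset.mem_filter.1 hZ).2.1
  rw [Finset.mem_inter] at hx
  exact ⟨x, mem_boundary_iff.2 ⟨hx.2, Z, hZ, hx.1, hΦ⟩, hx.1⟩

/-- Summing `‖Φ Z‖ g Z` over the surface of `X` is controlled by summing over boundary points. -/
lemma sum_surface_le {X : Finset Γ} {g : Finset Γ → ℝ} (hg : ∀ Z, 0 ≤ g Z) :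
    ∑ Z ∈ surface X, ‖Φ Z‖ * g Z
      ≤ ∑ x ∈ boundary Φ X, ∑ Z : Finset Γ with x ∈ Z, ‖Φ Z‖ * g Z := by
  have h0 : ∀ Z, 0 ≤ ‖Φ Z‖ * g Z := fun Z => mul_nonneg (norm_nonneg _) (hg Z)
  simp only [Finset.sum_filter]
  rw [Finset.sum_comm]
  refine (Finset.sum_le_sum fun Z hZ => ?_).trans
    (Finset.sum_le_sum_of_subset_of_nonneg (Finset.subset_univ (surface X))
      fun Z _ _ => Finset.sum_nonneg fun x _ => ?_)
  · by_cases hΦ : Φ Z = 0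
    · simp [hΦ]
    · obtain ⟨x, hx, hxZ⟩ := exists_mem_boundary hZ hΦ
      refine le_trans (le_of_eq ?_) (Finset.single_le_sum (f := fun x =>
        if x ∈ Z then ‖Φ Z‖ * g Z else 0) (fun x _ => ?_) hx)
      · simp [hxZ]
      · split_ifs
        exacts [h0 Z, le_rfl]
  · split_ifs
    exacts [h0 Z, le_rfl]

/-- A surface set of `X` with `Φ Z ≠ 0` that meets `Y` contains a boundary point `x` of `X` and a
point `y` of `Y`, so it is counted in the sum over sets containing both, which `hN` bounds. -/
lemma sum_surface_indicator_le (hN : ∀ x y : Γ,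
      ∑ Z : Finset Γ with x ∈ Z ∧ y ∈ Z, ‖Φ Z‖ ≤ N * F (nndist x y)) (X Y : Finset Γ) :
    ∑ Z ∈ surface X, ‖Φ Z‖ * (if Disjoint Z Y then 0 else 1)
      ≤ N * leftBoundarySum F Φ X Y := by
  refine (sum_surface_le fun Z => by split_ifs <;> norm_num).trans ?_
  rw [leftBoundarySum, Finset.mul_sum]
  refine Finset.sum_le_sum fun x _ => ?_
  rw [Finset.mul_sum]
  calc ∑ Z : Finset Γ with x ∈ Z, ‖Φ Z‖ * (if Disjoint Z Y then 0 else 1)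
      ≤ ∑ Z : Finset Γ with x ∈ Z, ∑ y ∈ Y, if y ∈ Z then ‖Φ Z‖ else 0 := by
        refine Finset.sum_le_sum fun Z _ => ?_
        have h0 : ∀ y ∈ Y, 0 ≤ if y ∈ Z then ‖Φ Z‖ else 0 := fun y _ => by
          split_ifs
          exacts [norm_nonneg _, le_rfl]
        by_cases hd : Disjoint Z Y
        · simpa [hd] using Finset.sum_nonneg h0
        · obtain ⟨y, hyZ, hyY⟩ := Finset.not_disjoint_iff.1 hd
          refine le_trans (le_of_eq ?_) (Finset.single_le_sum h0 hyY)
          simp [hd, hyZ]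
    _ = ∑ y ∈ Y, ∑ Z : Finset Γ with x ∈ Z ∧ y ∈ Z, ‖Φ Z‖ := by
        rw [Finset.sum_comm]
        refine Finset.sum_congr rfl fun y _ => ?_
        rw [← Finset.sum_filter, Finset.filter_filter]
    _ ≤ _ := Finset.sum_le_sum fun y _ => hN x y

/-- Enlarge the boundary of `Z` to all of `Z`. Summing over the sets `Z` that contain `x ∈ ∂X` and
`z` gives `N F(d(x,z))`, and the convolution inequality absorbs the intermediate point `z`. -/
lemma sum_surface_leftBoundarySum_le (hF0 : ∀ r, 0 < F r) (hN0 : 0 ≤ N) (hN : ∀ x y : Γ,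
      ∑ Z : Finset Γ with x ∈ Z ∧ y ∈ Z, ‖Φ Z‖ ≤ N * F (nndist x y))
    (hC : ∀ x y : Γ, ∑ z, F (nndist x z) * F (nndist z y) ≤ C * F (nndist x y))
    (X Y : Finset Γ) :
    ∑ Z ∈ surface X, ‖Φ Z‖ * leftBoundarySum F Φ Z Y ≤ N * C * leftBoundarySum F Φ X Y := by
  refine (sum_surface_le fun Z => leftBoundarySum_nonneg hF0 Z Y).trans ?_
  rw [leftBoundarySum, Finset.mul_sum]
  refine Finset.sum_le_sum fun x _ => ?_
  set f : Γ → ℝ := fun z => ∑ y ∈ Y, F (nndist z y) with hf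
  have hf0 : ∀ z, 0 ≤ f z := fun z => Finset.sum_nonneg fun _ _ => (hF0 _).le
  calc ∑ Z : Finset Γ with x ∈ Z, ‖Φ Z‖ * leftBoundarySum F Φ Z Y
      ≤ ∑ Z : Finset Γ with x ∈ Z, ∑ z, if z ∈ Z then ‖Φ Z‖ * f z else 0 := by
        refine Finset.sum_le_sum fun Z _ => ?_
        rw [← Finset.sum_filter, ← Finset.mul_sum]
        refine mul_le_mul_of_nonneg_left ?_ (norm_nonneg _)
        refine Finset.sum_le_sum_of_subset_of_nonneg (fun z hz => ?_) fun z _ _ => hf0 z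
        exact Finset.mem_filter.2 ⟨Finset.mem_univ _, (mem_boundary_iff.1 hz).1⟩
    _ = ∑ z, (∑ Z : Finset Γ with x ∈ Z ∧ z ∈ Z, ‖Φ Z‖) * f z := by
        rw [Finset.sum_comm]
        refine Finset.sum_congr rfl fun z _ => ?_
        rw [← Finset.sum_filter, Finset.filter_filter, Finset.sum_mul]
    _ ≤ ∑ z, (N * F (nndist x z)) * f z :=
        Finset.sum_le_sum fun z _ => mul_le_mul_of_nonneg_right (hN x z) (hf0 z)
    _ = N * ∑ y ∈ Y, ∑ z, F (nndist x z) * F (nndist z y) := by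
        rw [Finset.sum_comm, Finset.mul_sum]
        refine Finset.sum_congr rfl fun z _ => ?_
        rw [hf, mul_assoc, Finset.mul_sum]
    _ ≤ N * ∑ y ∈ Y, C * F (nndist x y) := by
        gcongr with y _
        exact hC x y
    _ = _ := by rw [← Finset.mul_sum, mul_assoc]

variable (F Φ) in
/-- The majorant of the Lieb-Robinson recursion. -/
def majorant (b N C : ℝ) (Y X : Finset Γ) (s : ℝ) : ℝ :=
  2 * b * ((if Disjoint X Y then 0 else 1)
    + (Real.exp (2 * C * N * s) - 1) / C * leftBoundarySum F Φ X Y)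

lemma majorant_nonneg (hF0 : ∀ r, 0 < F r) {b s : ℝ} (hb : 0 ≤ b) (hN0 : 0 ≤ N) (hC0 : 0 < C)
    (hs : 0 ≤ s) (X Y : Finset Γ) : 0 ≤ majorant F Φ b N C Y X s := by
  have h1 : 0 ≤ Real.exp (2 * C * N * s) - 1 := by
    rw [sub_nonneg]; exact Real.one_le_exp (by positivity)
  have h2 := leftBoundarySum_nonneg (Φ := Φ) hF0 X Y
  have h3 : (0 : ℝ) ≤ if Disjoint X Y then 0 else 1 := by split_ifs <;> norm_num
  unfold majorant
  positivity

/-- The surface sum is at most `4b (N S + (E-1)/C · N C S) = 4 b N E S`, which is precisely the time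
derivative of the majorant; this fixes the exponent `2CN` and the prefactor `1/C`. By convexity of
the exponential the increment over `ε` dominates `ε` times the derivative. -/
lemma majorant_step (hF0 : ∀ r, 0 < F r) {b s ε : ℝ} (hb : 0 ≤ b) (hN0 : 0 ≤ N) (hC0 : 0 < C)
    (hN : ∀ x y : Γ, ∑ Z : Finset Γ with x ∈ Z ∧ y ∈ Z, ‖Φ Z‖ ≤ N * F (nndist x y))
    (hC : ∀ x y : Γ, ∑ z, F (nndist x z) * F (nndist z y) ≤ C * F (nndist x y))
    (hs : 0 ≤ s) (hε : 0 ≤ ε) (X Y Λ : Finset Γ) :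
    majorant F Φ b N C Y X s + ε * ∑ Z ∈ Λ.powerset,
        (if Z ∈ surface X then 2 * ‖Φ Z‖ else 0) * majorant F Φ b N C Y Z s
      ≤ majorant F Φ b N C Y X (s + ε) := by
  set E := Real.exp (2 * C * N * s) with hE
  have hE1 : 0 ≤ E - 1 := by rw [sub_nonneg]; exact Real.one_le_exp (by positivity)
  have hS := leftBoundarySum_nonneg (Φ := Φ) hF0 X Y
  set S := leftBoundarySum F Φ X Y with hSdef
  have h1 : ∑ Z ∈ Λ.powerset, (if Z ∈ surface X then 2 * ‖Φ Z‖ else 0) * majorant F Φ b N C Y Z s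
      ≤ ∑ Z ∈ surface X, 2 * ‖Φ Z‖ * majorant F Φ b N C Y Z s := by
    simp only [ite_mul, zero_mul]
    rw [← Finset.sum_filter]
    refine Finset.sum_le_sum_of_subset_of_nonneg (fun Z hZ => (Finset.mem_filter.1 hZ).2)
      fun Z _ _ => ?_
    have := majorant_nonneg (Φ := Φ) hF0 hb hN0 hC0 hs Z Y
    positivity
  have h2 : ∑ Z ∈ surface X, 2 * ‖Φ Z‖ * majorant F Φ b N C Y Z s
      = 4 * b * (∑ Z ∈ surface X, ‖Φ Z‖ * (if Disjoint Z Y then 0 else 1)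
        + (E - 1) / C * ∑ Z ∈ surface X, ‖Φ Z‖ * leftBoundarySum F Φ Z Y) := by
    rw [Finset.mul_sum (surface X) _ ((E - 1) / C), ← Finset.sum_add_distrib, Finset.mul_sum]
    refine Finset.sum_congr rfl fun Z _ => ?_
    rw [majorant]; ring
  have h3 : 4 * b * (∑ Z ∈ surface X, ‖Φ Z‖ * (if Disjoint Z Y then 0 else 1)
        + (E - 1) / C * ∑ Z ∈ surface X, ‖Φ Z‖ * leftBoundarySum F Φ Z Y)
      ≤ 4 * b * (N * S + (E - 1) / C * (N * C * S)) := by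
    gcongr
    · exact sum_surface_indicator_le hN X Y
    · exact sum_surface_leftBoundarySum_le hF0 hN0 hN hC X Y
  have h4 : 4 * b * (N * S + (E - 1) / C * (N * C * S)) = 4 * b * N * E * S := by
    field_simp; ring
  have h5 : Real.exp (2 * C * N * (s + ε)) = E * Real.exp (2 * C * N * ε) := by
    rw [hE, ← Real.exp_add]; ring_nf
  have h6 : 2 * C * N * ε + 1 ≤ Real.exp (2 * C * N * ε) := Real.add_one_le_exp _
  have h7 : ε * (4 * b * N * E * S) ≤ 2 * b * (E * (Real.exp (2 * C * N * ε) - 1) / C * S) := by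
    have : ε * (4 * b * N * E * S) = 2 * b * (E * (2 * C * N * ε) / C * S) := by
      field_simp; ring
    rw [this]
    gcongr
    linarith
  have h8 := mul_le_mul_of_nonneg_left (h1.trans (h2.le.trans (h3.trans h4.le))) hε
  calc _ ≤ majorant F Φ b N C Y X s + 2 * b * (E * (Real.exp (2 * C * N * ε) - 1) / C * S) := by
        linarith
    _ = _ := by
        rw [majorant, majorant, h5, ← hE, ← hSdef]; ring

end BoundarySums

/-! ### The Hamiltonian -/

section Hamiltonian

variable {Γ : Type*} [DecidableEq Γ] {H : Γ → Type*} [∀ x, NormedAddCommGroup (H x)]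
  [∀ x, InnerProductSpace ℂ (H x)] [∀ x, CompleteSpace (H x)] {h : ∀ x, H x →ₗ.[ℂ] H x}
  {Φ : ∀ X : Finset Γ, LocalAlgebra H X} {Λ : Finset Γ}

variable (Φ Λ) in
/-- The interaction `∑_{X ⊆ Λ} Φ X` as a bounded operator. -/
def totalInteraction : LocalAlgebra H Λ := ∑ Z ∈ Λ.powerset, ampliate Λ (Φ Z)

variable (h Λ) in
/-- The graph of `∑_{x ∈ Λ} H_x` on the algebraic tensor product of the domains. -/
abbrev freeCore : Submodule ℂ (LocalSpace H Λ × LocalSpace H Λ) :=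
  HilbertTensor.freeGraph (fun x : Λ => H x) fun x => h x

lemma isSelfAdjoint_totalInteraction (hΦ : ∀ X, IsSelfAdjoint (Φ X)) :
    IsSelfAdjoint (totalInteraction Φ Λ) :=
  isSelfAdjoint_sum _ fun Z hZ => isSelfAdjoint_ampliate (Finset.mem_powerset.1 hZ) (hΦ Z)

lemma coreGraph_eq_map_shear :
    coreGraph h Φ Λ = (freeCore h Λ).map (shear (totalInteraction Φ Λ)).toLinearMap := by
  rw [coreGraph, freeCore, HilbertTensor.freeGraph, Submodule.map_span, ← Set.range_comp]
  congr 2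
  ext1 ψ
  refine Prod.ext rfl ?_
  simp [shear_apply, totalInteraction]

variable {U : ∀ x, ℝ → H x →L[ℂ] H x}

lemma isInvariantCore_freeCore (hh : ∀ x, IsSelfAdjoint (h x))
    (hU : ∀ x, IsUnitaryGroupOf (h x) (U x)) :
    IsInvariantCore (freeCore h Λ) (freeGroup U Λ) :=
  HilbertTensor.isInvariantCore_freeGraph (fun x : Λ => hh x) fun x : Λ => hU x

/-- Invariance under the product group gives essential self-adjointness of the free core, and the
interaction is a bounded shear of it. -/
lemma isSelfAdjoint_hamiltonian (hh : ∀ x, IsSelfAdjoint (h x)) (hΦ : ∀ X, IsSelfAdjoint (Φ X)) :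
    IsSelfAdjoint (hamiltonian h Φ Λ) ∧
      (hamiltonian h Φ Λ).graph = (coreGraph h Φ Λ).topologicalClosure := by
  choose U hU using fun x => exists_isUnitaryGroupOf (hh x)
  have hcore := isInvariantCore_freeCore (Λ := Λ) hh hU
  have hT := isUnitaryGroup_freeGroup (fun x => (hU x).isUnitaryGroup) Λ
  have hadj := topologicalClosure_map_shear_eq_adjoint
    (isSelfAdjoint_totalInteraction (Λ := Λ) hΦ) (hcore.topologicalClosure_eq_adjoint hT)
  rw [← coreGraph_eq_map_shear] at hadj
  refine isSelfAdjoint_toLinearPMap ?_ hadj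
  refine hcore.dense.mono ?_
  rintro _ ⟨p, hp, rfl⟩
  rw [coreGraph_eq_map_shear]
  exact ⟨_, ⟨p, hp, rfl⟩, rfl⟩

lemma mem_graph_hamiltonian (hh : ∀ x, IsSelfAdjoint (h x)) (hΦ : ∀ X, IsSelfAdjoint (Φ X))
    {p : LocalSpace H Λ × LocalSpace H Λ} (hp : p ∈ freeCore h Λ) :
    (p.1, p.2 + totalInteraction Φ Λ p.1) ∈ (hamiltonian h Φ Λ).graph := by
  rw [(isSelfAdjoint_hamiltonian hh hΦ).2]
  refine Submodule.le_topologicalClosure _ ?_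
  rw [coreGraph_eq_map_shear]
  exact ⟨p, hp, rfl⟩

end Hamiltonian

/-! ### The Lieb-Robinson bound -/

section LiebRobinson

variable {Γ : Type*} [DecidableEq Γ] {H : Γ → Type*} [∀ x, NormedAddCommGroup (H x)]
  [∀ x, InnerProductSpace ℂ (H x)]

variable (H) in
/-- The operators on `⨂_{x ∈ Λ} H x` that commute with all observables supported off `X`. -/
def localCommutant (Λ X : Finset Γ) : Subalgebra ℂ (LocalAlgebra H Λ) :=
  Subalgebra.centralizer ℂ
    {S | ∃ (Y : Finset Γ) (C : LocalAlgebra H Y), Y ⊆ Λ ∧ Disjoint X Y ∧ ampliate Λ C = S}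

variable {Λ X Y Z : Finset Γ}

lemma mem_localCommutant {A : LocalAlgebra H Λ} :
    A ∈ localCommutant H Λ X ↔
      ∀ (Y : Finset Γ) (C : LocalAlgebra H Y), Y ⊆ Λ → Disjoint X Y → Commute A (ampliate Λ C) := by
  rw [localCommutant, Subalgebra.mem_centralizer_iff]
  constructor
  · intro hA Y C hY hXY
    exact (hA _ ⟨Y, C, hY, hXY, rfl⟩).symm
  · rintro hA _ ⟨Y, C, hY, hXY, rfl⟩
    exact (hA Y C hY hXY).symm.eq

lemma localCommutant_mono (hXZ : X ⊆ Z) : localCommutant H Λ X ≤ localCommutant H Λ Z :=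
  fun _ hA => mem_localCommutant.2 fun Y C hY hZY =>
    mem_localCommutant.1 hA Y C hY (Finset.disjoint_of_subset_left hXZ hZY)

lemma ampliate_mem_localCommutant (hX : X ⊆ Λ) (A : LocalAlgebra H X) :
    ampliate Λ A ∈ localCommutant H Λ X :=
  mem_localCommutant.2 fun _ C hY hXY => commute_ampliate hX hY hXY A C

variable [∀ x, CompleteSpace (H x)] {U : ∀ x, ℝ → H x →L[ℂ] H x}

/-- Commuting with `C` after free evolution is the same as commuting, before it, with the
back-evolved `C`, which still lives on `Y`. -/
lemma freeGroup_conj_mem_localCommutant (hU : ∀ x, IsUnitaryGroup (U x)) {A : LocalAlgebra H Λ}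
    (hA : A ∈ localCommutant H Λ X) (t : ℝ) :
    freeGroup U Λ t * A * freeGroup U Λ (-t) ∈ localCommutant H Λ X := by
  refine mem_localCommutant.2 fun Y C hY hXY => ?_
  have hT := isUnitaryGroup_freeGroup hU Λ
  have h1 := mem_localCommutant.1 hA Y (freeGroup U Y (-t) * C * freeGroup U Y t) hY hXY
  have h2 := freeGroup_conj_ampliate hU hY (-t) C
  rw [neg_neg] at h2
  rw [← h2] at h1
  have h3 := congrArg (fun S => freeGroup U Λ t * S * freeGroup U Λ (-t)) h1.eq
  have e1 := hT.mul_neg_self t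
  rw [Commute, SemiconjBy]
  calc _ = freeGroup U Λ t * (A * (freeGroup U Λ (-t) * ampliate Λ C * freeGroup U Λ t))
        * freeGroup U Λ (-t) := by
        simp only [mul_assoc, e1, mul_one]
    _ = _ := h3
    _ = (freeGroup U Λ t * freeGroup U Λ (-t)) * ampliate Λ C
        * (freeGroup U Λ t * A * freeGroup U Λ (-t)) := by simp only [mul_assoc]
    _ = _ := by rw [e1, one_mul]

lemma commute_isStrongIntegral (hU : ∀ x, IsUnitaryGroup (U x)) (hZ : Z ⊆ Λ)
    {C : LocalAlgebra H Z} {ε : ℝ} {L A : LocalAlgebra H Λ}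
    (hL : IsStrongIntegral (freeGroup U Λ) (ampliate Λ C) ε L) (hA : A ∈ localCommutant H Λ X)
    (hXZ : Disjoint X Z) : Commute A L := by
  refine hL.commute (isUnitaryGroup_freeGroup hU Λ) fun s => ?_
  rw [freeGroup_conj_ampliate hU hZ]
  exact mem_localCommutant.1 hA Z _ hZ hXZ

/-- Describing localization by commutation is convenient here: it passes to strong integrals at
once, with no need to write `L` in the form `C ⊗ 1`. -/
lemma isStrongIntegral_mem_localCommutant (hU : ∀ x, IsUnitaryGroup (U x)) (hZ : Z ⊆ Λ)
    {C : LocalAlgebra H Z} {ε : ℝ} {L : LocalAlgebra H Λ}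
    (hL : IsStrongIntegral (freeGroup U Λ) (ampliate Λ C) ε L) : L ∈ localCommutant H Λ Z :=
  mem_localCommutant.2 fun Y D hY hZY => by
    refine (hL.commute (isUnitaryGroup_freeGroup hU Λ) fun s => ?_).symm
    rw [freeGroup_conj_ampliate hU hZ]
    exact commute_ampliate hY hZ hZY.symm D _

lemma IsUnitaryGroup.norm_le_one {K : Type*} [NormedAddCommGroup K] [InnerProductSpace ℂ K]
    [CompleteSpace K] {V : ℝ → K →L[ℂ] K} (hV : IsUnitaryGroup V) (t : ℝ) : ‖V t‖ ≤ 1 :=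
  ContinuousLinearMap.opNorm_le_bound _ zero_le_one fun x => by rw [hV.norm_apply, one_mul]

lemma IsUnitaryGroup.norm_conj_le {K : Type*} [NormedAddCommGroup K] [InnerProductSpace ℂ K]
    [CompleteSpace K] {V : ℝ → K →L[ℂ] K} (hV : IsUnitaryGroup V) (t : ℝ) (S : K →L[ℂ] K) :
    ‖V t * S * V (-t)‖ ≤ ‖S‖ := by
  refine (norm_three_mul_le _ _ _).trans ?_
  calc ‖V t‖ * ‖S‖ * ‖V (-t)‖ ≤ 1 * ‖S‖ * 1 := by
        gcongr
        exacts [hV.norm_le_one t, hV.norm_le_one (-t)]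
    _ = ‖S‖ := by ring

lemma IsUnitaryGroup.norm_conj_le' {K : Type*} [NormedAddCommGroup K] [InnerProductSpace ℂ K]
    [CompleteSpace K] {V : ℝ → K →L[ℂ] K} (hV : IsUnitaryGroup V) (t : ℝ) (S : K →L[ℂ] K) :
    ‖V (-t) * S * V t‖ ≤ ‖S‖ := by
  simpa using hV.norm_conj_le (-t) S

variable [Fintype Γ] {h : ∀ x, H x →ₗ.[ℂ] H x} {Φ : ∀ X : Finset Γ, LocalAlgebra H X}
  {W : ℝ → LocalAlgebra H Λ}

lemma disjoint_of_notMem_surface (hZ : Z ∉ surface X) (hZX : ¬Z ⊆ X) : Disjoint X Z := by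
  obtain ⟨z, hz, hzX⟩ := Finset.not_subset.1 hZX
  rw [Finset.disjoint_iff_inter_eq_empty, Finset.inter_comm, ← Finset.not_nonempty_iff_eq_empty]
  intro hne
  exact hZ (Finset.mem_filter.2 ⟨Finset.mem_univ _, hne, z,
    Finset.mem_inter.2 ⟨hz, Finset.mem_compl.2 hzX⟩⟩)

/-- `‖[A, B]‖ ≤ γ X ‖A‖` for all `A` localized in `X`. -/
def CommutatorBound (B : LocalAlgebra H Λ) (γ : Finset Γ → ℝ) : Prop :=
  ∀ X, ∀ A ∈ localCommutant H Λ X, ‖A * B - B * A‖ ≤ γ X * ‖A‖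

/-- The Duhamel integrals of the `Φ Z` are grouped into `s₁` (surface of `X`), `s₂` (inside `X`) and
`s₃` (disjoint from `X`). The last commute with the freely evolved `A`, the second keep it localized
in `X` so that `γ X` applies, and the first enter through `[L Z, B]`, bounded by `γ Z`. Evolving `B`
leaves the quantifier over all localized `A` intact, so the step can be iterated. -/
lemma CommutatorBound.step (hh : ∀ x, IsSelfAdjoint (h x)) (hΦ : ∀ X, IsSelfAdjoint (Φ X))
    (hU : ∀ x, IsUnitaryGroupOf (h x) (U x)) (hW : IsUnitaryGroupOf (hamiltonian h Φ Λ) W)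
    {B : LocalAlgebra H Λ} {γ : Finset Γ → ℝ} (hγ : CommutatorBound B γ) (hγ0 : ∀ X, 0 ≤ γ X)
    {ε : ℝ} (hε : |ε| * ∑ Z ∈ Λ.powerset, ‖Φ Z‖ ≤ 1) :
    CommutatorBound (W (-ε) * B * W ε) fun X => γ X
      + |ε| * ∑ Z ∈ Λ.powerset, (if Z ∈ surface X then 2 * ‖Φ Z‖ else 0) * γ Z
      + 140 * ‖B‖ * (∑ Z ∈ Λ.powerset, ‖Φ Z‖) ^ 2 * |ε| ^ 2 := by
  intro X A hA
  set v := ∑ Z ∈ Λ.powerset, ‖Φ Z‖ with hv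
  have hv0 : 0 ≤ v := Finset.sum_nonneg fun _ _ => norm_nonneg _
  have hU' := fun x => (hU x).isUnitaryGroup
  have hT := isUnitaryGroup_freeGroup hU' Λ
  have hW' := hW.isUnitaryGroup
  choose L hL using fun Z => hT.exists_isStrongIntegral (ampliate Λ (Φ Z)) ε
  have hLsa : ∀ Z ∈ Λ.powerset, IsSelfAdjoint (L Z) := fun Z hZ =>
    (hL Z).isSelfAdjoint hT (isSelfAdjoint_ampliate (Finset.mem_powerset.1 hZ) (hΦ Z))
  have hLn : ∀ Z ∈ Λ.powerset, ‖L Z‖ ≤ |ε| * ‖Φ Z‖ := fun Z hZ =>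
    ((hL Z).norm_le hT).trans (by gcongr; exact norm_ampliate_le (Finset.mem_powerset.1 hZ) _)
  have hsub : ∀ s ⊆ Λ.powerset, IsSelfAdjoint (∑ Z ∈ s, L Z) ∧ ‖∑ Z ∈ s, L Z‖ ≤ |ε| * v :=
    fun s hs => ⟨isSelfAdjoint_sum _ fun Z hZ => hLsa Z (hs hZ), by
      refine (norm_sum_le_of_le _ fun Z hZ => hLn Z (hs hZ)).trans ?_
      rw [← Finset.mul_sum]
      gcongr
      exact Finset.sum_le_sum_of_subset_of_nonneg hs fun _ _ _ => norm_nonneg _⟩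
  set s₁ := Λ.powerset.filter fun Z => Z ∈ surface X with hs₁
  set s₂ := (Λ.powerset.filter fun Z => Z ∉ surface X).filter fun Z => Z ⊆ X with hs₂
  set s₃ := (Λ.powerset.filter fun Z => Z ∉ surface X).filter fun Z => ¬Z ⊆ X with hs₃
  have hs₁' : s₁ ⊆ Λ.powerset := Finset.filter_subset _ _
  have hs₂' : s₂ ⊆ Λ.powerset := (Finset.filter_subset _ _).trans (Finset.filter_subset _ _)
  have hs₃' : s₃ ⊆ Λ.powerset := (Finset.filter_subset _ _).trans (Finset.filter_subset _ _)
  have hsplit : ∑ Z ∈ s₁, L Z + ∑ Z ∈ s₂, L Z + ∑ Z ∈ s₃, L Z = ∑ Z ∈ Λ.powerset, L Z := by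
    rw [add_assoc, Finset.sum_filter_add_sum_filter_not, Finset.sum_filter_add_sum_filter_not]
  have hVn : ‖totalInteraction Φ Λ‖ ≤ v :=
    norm_sum_le_of_le _ fun Z hZ => norm_ampliate_le (Finset.mem_powerset.1 hZ) _
  have hQ : ‖W ε * freeGroup U Λ (-ε) - 1 - Complex.I •
      (∑ Z ∈ s₁, L Z + ∑ Z ∈ s₂, L Z + ∑ Z ∈ s₃, L Z)‖ ≤ (|ε| * v) ^ 2 := by
    rw [hsplit]
    refine (norm_mul_neg_sub_one_sub_le (isSelfAdjoint_hamiltonian hh hΦ).1 hW hT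
      (isInvariantCore_freeCore hh hU) (fun p hp => mem_graph_hamiltonian hh hΦ hp)
      (IsStrongIntegral.sum hT fun Z _ => hL Z)).trans ?_
    rw [mul_pow, sq_abs]
    gcongr
  have hQ1 : ‖W ε * freeGroup U Λ (-ε)‖ ≤ 1 :=
    (norm_mul_le _ _).trans (mul_le_one₀ (hW'.norm_le_one _) (norm_nonneg _) (hT.norm_le_one _))
  -- Conjugating `A'` by the interaction picture propagator `W ε T(-ε)` gives the full evolution `W
  -- ε A W(-ε)`.
  set A' := freeGroup U Λ ε * A * freeGroup U Λ (-ε) with hA'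
  have hA'm : A' ∈ localCommutant H Λ X := freeGroup_conj_mem_localCommutant hU' hA ε
  have hOA : Commute (∑ Z ∈ s₃, L Z) A' := by
    refine Commute.sum_left _ _ _ fun Z hZ => ?_
    refine (commute_isStrongIntegral hU' (Finset.mem_powerset.1 (hs₃' hZ)) (hL Z) hA'm ?_).symm
    rw [hs₃, Finset.mem_filter, Finset.mem_filter] at hZ
    exact disjoint_of_notMem_surface hZ.1.2 hZ.2
  have hIm : 1 + Complex.I • ∑ Z ∈ s₂, L Z ∈ localCommutant H Λ X ∧
      star (1 + Complex.I • ∑ Z ∈ s₂, L Z) ∈ localCommutant H Λ X := by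
    have : ∑ Z ∈ s₂, L Z ∈ localCommutant H Λ X := sum_mem fun Z hZ =>
      localCommutant_mono (Finset.mem_filter.1 hZ).2
        (isStrongIntegral_mem_localCommutant hU' (Finset.mem_powerset.1 (hs₂' hZ)) (hL Z))
    rw [star_one_add_I_smul (hsub s₂ hs₂').1]
    exact ⟨add_mem (one_mem _) (Subalgebra.smul_mem _ this _),
      sub_mem (one_mem _) (Subalgebra.smul_mem _ this _)⟩
  have key := norm_commutator_step_le (B := B) (hsub s₁ hs₁').1 (hsub s₂ hs₂').1 (hsub s₃ hs₃').1
    (hsub s₁ hs₁').2 (hsub s₂ hs₂').2 (hsub s₃ hs₃').2 (by positivity) hε hQ1 hQ hOA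
    (hγ X _ (mul_mem (mul_mem hIm.1 hA'm) hIm.2)) (hγ0 X)
  have hSB : ‖(∑ Z ∈ s₁, L Z) * B - B * ∑ Z ∈ s₁, L Z‖
      ≤ ∑ Z ∈ s₁, |ε| * ‖Φ Z‖ * γ Z := by
    rw [Finset.sum_mul, Finset.mul_sum, ← Finset.sum_sub_distrib]
    refine norm_sum_le_of_le _ fun Z hZ => ?_
    refine (hγ Z _ (isStrongIntegral_mem_localCommutant hU'
      (Finset.mem_powerset.1 (hs₁' hZ)) (hL Z))).trans ?_
    rw [mul_comm]
    exact mul_le_mul_of_nonneg_right (hLn Z (hs₁' hZ)) (hγ0 Z)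
  have hsum : ∑ Z ∈ Λ.powerset, (if Z ∈ surface X then 2 * ‖Φ Z‖ else 0) * γ Z
      = ∑ Z ∈ s₁, 2 * ‖Φ Z‖ * γ Z := by
    simp only [ite_mul, zero_mul]
    rw [← Finset.sum_filter]
  have e1 : W ε * freeGroup U Λ (-ε) * A' * star (W ε * freeGroup U Λ (-ε))
      = W ε * A * W (-ε) := by
    have h1 : freeGroup U Λ (-ε) * A' = A * freeGroup U Λ (-ε) := by
      rw [hA', ← mul_assoc, ← mul_assoc, hT.neg_mul_self, one_mul]
    rw [star_mul, hW'.star_eq, hT.star_eq, neg_neg, mul_assoc (W ε), h1]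
    calc _ = W ε * A * (freeGroup U Λ (-ε) * freeGroup U Λ ε) * W (-ε) := by
          simp only [mul_assoc]
      _ = _ := by rw [hT.neg_mul_self, mul_one]
  have e2 : A * (W (-ε) * B * W ε) - W (-ε) * B * W ε * A
      = W (-ε) * (W ε * A * W (-ε) * B - B * (W ε * A * W (-ε))) * W ε := by
    have h1 : W (-ε) * W ε = 1 := hW'.neg_mul_self ε
    have h2 : ∀ S, W (-ε) * (W ε * S) = S := fun S => by rw [← mul_assoc, h1, one_mul]
    simp only [mul_sub, sub_mul, mul_assoc, h1, h2, mul_one]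
  rw [e1] at key
  rw [e2]
  refine (hW'.norm_conj_le' ε _).trans (key.trans ?_)
  have hsB : 0 ≤ ∑ Z ∈ s₁, |ε| * ‖Φ Z‖ * γ Z := Finset.sum_nonneg fun Z _ =>
    mul_nonneg (by positivity) (hγ0 Z)
  refine mul_le_mul ?_ (hT.norm_conj_le ε A) (norm_nonneg _) ?_
  · beta_reduce
    rw [hsum]
    have e3 : |ε| * ∑ Z ∈ s₁, 2 * ‖Φ Z‖ * γ Z = 2 * ∑ Z ∈ s₁, |ε| * ‖Φ Z‖ * γ Z := by
      rw [Finset.mul_sum, Finset.mul_sum]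
      exact Finset.sum_congr rfl fun Z _ => by ring
    rw [e3]
    have e4 : 140 * ‖B‖ * (|ε| * v) ^ 2 = 140 * ‖B‖ * v ^ 2 * |ε| ^ 2 := by ring
    rw [e4]
    gcongr
  · beta_reduce
    rw [hsum]
    have : 0 ≤ ∑ Z ∈ s₁, 2 * ‖Φ Z‖ * γ Z := Finset.sum_nonneg fun Z _ =>
      mul_nonneg (by positivity) (hγ0 Z)
    have := hγ0 X
    positivity

lemma CommutatorBound.mono {B : LocalAlgebra H Λ} {γ γ' : Finset Γ → ℝ} (hγ : CommutatorBound B γ)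
    (h : ∀ X, γ X ≤ γ' X) : CommutatorBound B γ' := fun X A hA =>
  (hγ X A hA).trans (mul_le_mul_of_nonneg_right (h X) (norm_nonneg _))

variable [MetricSpace Γ] {F : NNReal → ℝ} {N C : ℝ}

/-- The Lieb-Robinson bound for `A` localized in `X` and `B` an observable over `Y`. -/
lemma norm_commutator_evolved_le (hF0 : ∀ r, 0 < F r) (hh : ∀ x, IsSelfAdjoint (h x))
    (hΦ : ∀ X, IsSelfAdjoint (Φ X)) (hW : IsUnitaryGroupOf (hamiltonian h Φ Λ) W)
    (hN0 : 0 ≤ N) (hC0 : 0 < C)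
    (hN : ∀ x y : Γ, ∑ Z : Finset Γ with x ∈ Z ∧ y ∈ Z, ‖Φ Z‖ ≤ N * F (nndist x y))
    (hC : ∀ x y : Γ, ∑ z, F (nndist x z) * F (nndist z y) ≤ C * F (nndist x y))
    (hX : X ⊆ Λ) (hY : Y ⊆ Λ) (hXY : Disjoint X Y) (A : LocalAlgebra H X) (B : LocalAlgebra H Y)
    (t : ℝ) :
    ‖ampliate Λ A * (W (-t) * ampliate Λ B * W t) - W (-t) * ampliate Λ B * W t * ampliate Λ A‖
      ≤ 2 * ‖A‖ * ‖B‖ / C * (Real.exp (2 * C * N * |t|) - 1) * leftBoundarySum F Φ X Y := by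
  choose U hU using fun x => exists_isUnitaryGroupOf (hh x)
  have hW' := hW.isUnitaryGroup
  -- The sign of `t` is split off so that the recursion runs over nonnegative times in either
  -- direction.
  obtain ⟨σ, hσ, hσt⟩ : ∃ σ : ℝ, |σ| = 1 ∧ σ * |t| = t := by
    rcases le_total 0 t with h0 | h0
    · exact ⟨1, by simp, by rw [abs_of_nonneg h0, one_mul]⟩
    · exact ⟨-1, by simp, by rw [abs_of_nonpos h0]; ring⟩
  obtain ⟨b, hb⟩ : ∃ b, ‖ampliate Λ B‖ = b := ⟨_, rfl⟩
  obtain ⟨v, hv⟩ : ∃ v, ∑ Z ∈ Λ.powerset, ‖Φ Z‖ = v := ⟨_, rfl⟩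
  have hv0 : 0 ≤ v := hv ▸ Finset.sum_nonneg fun _ _ => norm_nonneg _
  have hv1 : 0 < v + 1 := by linarith
  have hb0 : 0 ≤ b := hb ▸ norm_nonneg _
  have h0 : CommutatorBound (W (-(σ * 0)) * ampliate Λ B * W (σ * 0))
      fun Z => majorant F Φ b N C Y Z 0 := by
    intro Z S hS
    have e : W (-(σ * 0)) * ampliate Λ B * W (σ * 0) = ampliate Λ B := by
      rw [mul_zero, neg_zero, hW'.map_zero, one_mul, mul_one]
    rw [e]
    by_cases hd : Disjoint Z Y
    · rw [(mem_localCommutant.1 hS Y B hY hd).eq, sub_self, norm_zero]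
      exact mul_nonneg (majorant_nonneg hF0 hb0 hN0 hC0 le_rfl _ _) (norm_nonneg _)
    · simpa [majorant, hd, hb] using norm_commutator_le S (ampliate Λ B)
  -- The step limit `1/(v+1)` ensures `ε v ≤ 1`, also when `v = 0`. As evolution does not increase
  -- the norm of `B`, the error coefficient `140 b v²` does not depend on the time `r`.
  have hstep : ∀ (r ε : ℝ) (γ : Finset Γ → ℝ), 0 ≤ r → 0 ≤ ε → ε ≤ 1 / (v + 1) →
      (∀ Z, 0 ≤ γ Z) → CommutatorBound (W (-(σ * r)) * ampliate Λ B * W (σ * r)) γ →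
      CommutatorBound (W (-(σ * (r + ε))) * ampliate Λ B * W (σ * (r + ε))) fun X => γ X
        + ε * ∑ Z ∈ Λ.powerset, (if Z ∈ surface X then 2 * ‖Φ Z‖ else 0) * γ Z
        + 140 * b * v ^ 2 * ε ^ 2 := by
    intro r ε γ hr hε hε₀ hγ0 hP
    have hσε : |σ * ε| = ε := by rw [abs_mul, hσ, one_mul, abs_of_nonneg hε]
    have hle : |σ * ε| * ∑ Z ∈ Λ.powerset, ‖Φ Z‖ ≤ 1 := by
      rw [hσε, hv]
      calc ε * v ≤ 1 / (v + 1) * v := by gcongr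
        _ = v / (v + 1) := by ring
        _ ≤ 1 := (div_le_one hv1).2 (by linarith)
    have h1 := hP.step hh hΦ hU hW hγ0 hle
    have e : W (-(σ * ε)) * (W (-(σ * r)) * ampliate Λ B * W (σ * r)) * W (σ * ε)
        = W (-(σ * (r + ε))) * ampliate Λ B * W (σ * (r + ε)) := by
      have e1 : -(σ * (r + ε)) = -(σ * ε) + -(σ * r) := by ring
      rw [e1, mul_add, hW'.map_add, hW'.map_add]
      simp only [mul_assoc]
    rw [e, hσε, hv] at h1
    refine h1.mono fun Z => ?_
    have h2 : ‖W (-(σ * r)) * ampliate Λ B * W (σ * r)‖ ≤ b := (hW'.norm_conj_le' _ _).trans_eq hb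
    refine add_le_add le_rfl ?_
    have h3 : 0 ≤ v ^ 2 * ε ^ 2 := by positivity
    calc _ = 140 * ‖W (-(σ * r)) * ampliate Λ B * W (σ * r)‖ * (v ^ 2 * ε ^ 2) := mul_assoc _ _ _
      _ ≤ 140 * b * (v ^ 2 * ε ^ 2) := by gcongr
      _ = _ := (mul_assoc _ _ _).symm
  have hw : ∀ X : Finset Γ,
      ∑ Z ∈ Λ.powerset, (if Z ∈ surface X then 2 * ‖Φ Z‖ else 0) ≤ 2 * v := fun X => by
    rw [← hv, Finset.mul_sum]
    refine Finset.sum_le_sum fun Z _ => ?_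
    split_ifs
    · exact le_rfl
    · positivity
  obtain ⟨n₀, hn₀⟩ := bound_of_recursion
    (P := fun r γ => CommutatorBound (W (-(σ * r)) * ampliate Λ B * W (σ * r)) γ)
    (G := fun Z r => majorant F Φ b N C Y Z r) hw (by positivity) (by positivity)
    (one_div_pos.2 hv1) (fun r γ γ' hγ hP => hP.mono hγ) hstep
    (fun Z r hr => majorant_nonneg hF0 hb0 hN0 hC0 hr Z Y)
    (fun Z r ε hr hε => majorant_step hF0 hb0 hN0 hC0 hN hC hr hε Z Y Λ)
    h0 (abs_nonneg t)
  rw [hσt] at hn₀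
  have hlim : ∀ c : ℝ, Filter.Tendsto (fun n : ℕ => (majorant F Φ b N C Y X |t| + c / (n + 1))
      * ‖ampliate Λ A‖) Filter.atTop (nhds (majorant F Φ b N C Y X |t| * ‖ampliate Λ A‖)) := by
    intro c
    have h1 := (tendsto_one_div_add_atTop_nhds_zero_nat (𝕜 := ℝ)).const_mul c
    simp only [mul_one_div, mul_zero] at h1
    simpa using (h1.const_add (majorant F Φ b N C Y X |t|)).mul_const ‖ampliate Λ A‖
  -- Letting the number of steps tend to infinity removes the discretization error.
  have h1 := ge_of_tendsto (hlim _) (Filter.eventually_atTop.2 ⟨n₀, fun n hn =>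
    hn₀ n hn X _ (ampliate_mem_localCommutant hX A)⟩)
  refine h1.trans ?_
  rw [majorant, if_pos hXY, zero_add, ← hb]
  have hE : 0 ≤ Real.exp (2 * C * N * |t|) - 1 := by
    rw [sub_nonneg]; exact Real.one_le_exp (by positivity)
  have hS := leftBoundarySum_nonneg (Φ := Φ) hF0 X Y
  calc _ ≤ 2 * ‖B‖ * ((Real.exp (2 * C * N * |t|) - 1) / C * leftBoundarySum F Φ X Y) * ‖A‖ := by
        gcongr
        · exact norm_ampliate_le hY B
        · exact norm_ampliate_le hX A
    _ = _ := by ring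

end LiebRobinson

/-! ### Symmetry between `X` and `Y`, and the final bound. -/

variable {Γ : Type*} [DecidableEq Γ] [Fintype Γ] [MetricSpace Γ]

lemma disjoint_of_setDist_pos {X Y : Finset Γ} (h : 0 < setDist X Y) : Disjoint X Y := by
  rw [Finset.disjoint_left]
  intro x hX hY
  have : setDist X Y ≤ edist x x := (iInf₂_le x hX).trans (iInf₂_le x hY)
  rw [edist_self] at this
  exact (h.trans_le this).false

lemma boundarySum_eq_min {H : Γ → Type*} [∀ x, NormedAddCommGroup (H x)]
    [∀ x, InnerProductSpace ℂ (H x)] (F : NNReal → ℝ) (Φ : ∀ X : Finset Γ, LocalAlgebra H X)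
    (X Y : Finset Γ) :
    boundarySum F Φ X Y = min (leftBoundarySum F Φ X Y) (leftBoundarySum F Φ Y X) := by
  rw [boundarySum, leftBoundarySum, leftBoundarySum, Finset.sum_comm (s := X)]
  simp only [nndist_comm]

lemma conj_commutator {R : Type*} [Ring R] {u v a b : R} (huv : u * v = 1) :
    u * a * v * b - b * (u * a * v) = u * (a * (v * b * u) - v * b * u * a) * v := by
  have h1 : ∀ x, u * (v * x) = x := fun x => by rw [← mul_assoc, huv, one_mul]
  simp only [mul_sub, sub_mul, mul_assoc, h1, huv, mul_one]

end LR

end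

theorem theorem2p1 {Γ : Type*} [Fintype Γ] [DecidableEq Γ] [MetricSpace Γ]
    (H : Γ → Type*) [∀ x, NormedAddCommGroup (H x)] [∀ x, InnerProductSpace ℂ (H x)]
    [∀ x, CompleteSpace (H x)]
    (F : NNReal → ℝ) (hF : Antitone F) (hF0 : ∀ r, 0 < F r)
    (h : ∀ x, H x →ₗ.[ℂ] H x) (hh : ∀ x, IsSelfAdjoint (h x))
    (Φ : ∀ X : Finset Γ, LR.LocalAlgebra H X) (hΦ : ∀ X, IsSelfAdjoint (Φ X))
    (X Y Λ : Finset Γ) (hXY : 0 < LR.setDist X Y) (hΛ : X ∪ Y ⊆ Λ) :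
    IsSelfAdjoint (LR.hamiltonian h Φ Λ) ∧
    LR.IsUnitaryGroupOf (LR.hamiltonian h Φ Λ) (LR.expI (LR.hamiltonian h Φ Λ)) ∧
    ∀ (A : LR.LocalAlgebra H X) (B : LR.LocalAlgebra H Y) (t : ℝ),
      ‖LR.dynamics h Φ Λ t (LR.ampliate Λ A) * LR.ampliate Λ B
          - LR.ampliate Λ B * LR.dynamics h Φ Λ t (LR.ampliate Λ A)‖
        ≤ 2 * ‖A‖ * ‖B‖ / LR.convConst Γ F
          * (Real.exp (2 * LR.convConst Γ F * LR.interactionNorm F Φ * |t|) - 1)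
          * LR.boundarySum F Φ X Y := by
  have hsa : IsSelfAdjoint (LR.hamiltonian h Φ Λ) := (LR.isSelfAdjoint_hamiltonian hh hΦ).1
  have hW : LR.IsUnitaryGroupOf (LR.hamiltonian h Φ Λ) (LR.expI (LR.hamiltonian h Φ Λ)) := by
    rw [LR.expI, dif_pos (LR.exists_isUnitaryGroupOf hsa)]
    exact (LR.exists_isUnitaryGroupOf hsa).choose_spec
  refine ⟨hsa, hW, fun A B t => ?_⟩
  have hX : X ⊆ Λ := Finset.union_subset_left hΛ
  have hY : Y ⊆ Λ := Finset.union_subset_right hΛ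
  have hd : Disjoint X Y := LR.disjoint_of_setDist_pos hXY
  have hW' := hW.isUnitaryGroup
  rw [LR.dynamics]
  have hX1 := fun N C hN0 hC0 hN hC => LR.norm_commutator_evolved_le (N := N) (C := C) hF0 hh hΦ hW
    hN0 hC0 hN hC hX hY hd A B t
  -- Exchanging `A` and `B` and reversing time produces the same commutator up to sign, now bounded
  -- through the boundary of `Y`.
  have hY1 := fun N C hN0 hC0 hN hC => LR.norm_commutator_evolved_le (N := N) (C := C) hF0 hh hΦ hW
    hN0 hC0 hN hC hY hX hd.symm B A (-t)
  set W := LR.expI (LR.hamiltonian h Φ Λ)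
  have e1 : ‖W t * LR.ampliate Λ A * W (-t) * LR.ampliate Λ B
      - LR.ampliate Λ B * (W t * LR.ampliate Λ A * W (-t))‖
      ≤ ‖LR.ampliate Λ A * (W (-t) * LR.ampliate Λ B * W t)
        - W (-t) * LR.ampliate Λ B * W t * LR.ampliate Λ A‖ := by
    rw [LR.conj_commutator (hW'.mul_neg_self t)]
    exact hW'.norm_conj_le t _
  have hX2 := fun N C hN0 hC0 hN hC => e1.trans (hX1 N C hN0 hC0 hN hC)
  simp only [neg_neg, abs_neg, norm_sub_rev (LR.ampliate Λ B * _)] at hY1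
  rcases isEmpty_or_nonempty Γ with hΓ | hΓ
  -- For empty `Γ` the constant `convConst` is not positive, so `N = 0` and `C = 1` are used
  -- instead, their hypotheses being vacuous; both boundary sums are empty and the commutator
  -- vanishes.
  · have h1 := hX2 0 1 le_rfl one_pos (fun x => hΓ.elim x) fun x => hΓ.elim x
    have h2 : LR.leftBoundarySum F Φ X Y = 0 := by
      rw [LR.leftBoundarySum, Finset.eq_empty_of_isEmpty (LR.boundary Φ X), Finset.sum_empty]
    have h3 : LR.leftBoundarySum F Φ Y X = 0 := by
      rw [LR.leftBoundarySum, Finset.eq_empty_of_isEmpty (LR.boundary Φ Y), Finset.sum_empty]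
    rw [h2, mul_zero] at h1
    rwa [LR.boundarySum_eq_min, h2, h3, min_self, mul_zero]
  · have hN0 : 0 ≤ LR.interactionNorm F Φ := LR.interactionNorm_nonneg hF0
    have hC0 : 0 < LR.convConst Γ F := LR.convConst_pos hF0
    have hN := LR.sum_le_of_interactionNorm_le (Φ := Φ) hF0
    have hC := LR.sum_mul_le_convConst (Γ := Γ) hF0
    rw [LR.boundarySum_eq_min]
    rcases min_choice (LR.leftBoundarySum F Φ X Y) (LR.leftBoundarySum F Φ Y X) with hm | hm
    · rw [hm]
      exact hX2 _ _ hN0 hC0 hN hC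
    · rw [hm, mul_right_comm 2 ‖A‖]
      exact hY1 _ _ hN0 hC0 hN hC
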